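/- Let $G$ be a finite connected simple graph in which any two distinct vertices can be disconnected from each other by removing at most two edges (a \emph{cactus graph}). For $A\subseteq V(G)$ let $\operatorname{conv}(A)$ be the set of all vertices lying on a shortest path of $G$ between two (possibly equal) vertices of $A$. Let $k\ge 1$ and let $U\subseteq V(G)$ be a set of $4k-2$ vertices. Then $U$ can be partitioned into $k$ nonempty parts $A_1,\dots,A_k$ with $\bigcap_{i=1}^k\operatorname{conv}(A_i)\neq\emptyset$. Moreover, such a partition can be found in time $O(n^2)$, where $n=|V(G)|$: there are constants $c,C$ and one deterministic program for a random access machine (unit-cost addition, truncated subtraction, comparison and indirect addressing) that, for every such $G$ with vertex set $\{0,\dots,n-1\}$ given by adjacency lists, every $k\ge 1$ and every set $U$ of $4k-2$ vertices of $G$, stores and addresses only with numbers at most $(n+1)^c$ (that is, with words of $O(\log n)$ bits), halts after at most $Cn^2$ steps, and outputs such a partition, as a label in $\{0,\dots,k-1\}$ for each vertex of $U$. -/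

import Mathlib

namespace SimpleGraph

variable {V : Type*}

/-- A cactus (2-separable) graph: it is connected, and any two distinct vertices can be disconnected
from each other by removing at most two edges. -/
structure IsCactus (G : SimpleGraph V) : Prop where
  connected : G.Connected
  two_separable : ∀ u v : V, u ≠ v →
    ∃ s : Finset (Sym2 V), s.card ≤ 2 ∧ ¬ (G.deleteEdges (s : Set (Sym2 V))).Reachable u v

/-- The segment `[u, v]`: the set of all vertices lying on a shortest walk (necessarily a path)
from `u` to `v`. -/
def geodeticSegment (G : SimpleGraph V) (u v : V) : Set V :=
  {w | ∃ p : G.Walk u v, p.length = G.dist u v ∧ w ∈ p.support}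

/-- The geodetic hull of `A`: the union of the segments `[u, v]` over all `u, v ∈ A`. -/
def geodeticHull (G : SimpleGraph V) (A : Set V) : Set V :=
  ⋃ u ∈ A, ⋃ v ∈ A, G.geodeticSegment u v

/-- `A 0, …, A (k-1)` is a partition of `U` into `k` (nonempty) parts whose geodetic hulls have a
common vertex. -/
structure IsTverbergPartition (G : SimpleGraph V) (U : Finset V) {k : ℕ} (A : Fin k → Finset V) :
    Prop where
  nonempty : ∀ i, (A i).Nonempty
  disjoint : ∀ i j, i ≠ j → Disjoint (A i) (A j)
  cover : ∀ v, v ∈ U ↔ ∃ i, v ∈ A i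
  hulls_meet : ∃ x, ∀ i, x ∈ G.geodeticHull (A i : Set V)

end SimpleGraph

/-! A random access machine, programmed in structured form. The memory has registers and arrays
(each indexed by natural numbers, a given program mentions only finitely many of them); an array
cell may be addressed by a computed value. -/

namespace RAM

/-- A memory state: the contents of the registers and of the arrays. -/
structure Mem where
  reg : ℕ → ℕ
  arr : ℕ → ℕ → ℕ

/-- Expressions: constants, registers, array cells, addition, truncated subtraction and
comparisons. -/
inductive Expr where
  | const (c : ℕ)
  | reg (x : ℕ)
  | get (a : ℕ) (i : Expr)
  | add (e f : Expr)
  | sub (e f : Expr)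
  | lt (e f : Expr)
  | eq (e f : Expr)

namespace Expr

/-- The value of the comparison `a < b`. -/
def ltVal (a b : ℕ) : ℕ := if a < b then 1 else 0

/-- The value of the comparison `a = b`. -/
def eqVal (a b : ℕ) : ℕ := if a = b then 1 else 0

/-- The value of an expression. -/
def eval (m : Mem) : Expr → ℕ
  | const c => c
  | reg x => m.reg x
  | get a i => m.arr a (i.eval m)
  | add e f => e.eval m + f.eval m
  | sub e f => e.eval m - f.eval m
  | lt e f => ltVal (e.eval m) (f.eval m)
  | eq e f => eqVal (e.eval m) (f.eval m)

/-- The number of elementary operations needed to evaluate an expression. -/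
def cost : Expr → ℕ
  | const _ => 1
  | reg _ => 1
  | get _ i => i.cost + 1
  | add e f => e.cost + f.cost + 1
  | sub e f => e.cost + f.cost + 1
  | lt e f => e.cost + f.cost + 1
  | eq e f => e.cost + f.cost + 1

end Expr

/-- Programs. A guard is regarded as true when its value is nonzero. -/
inductive Prog where
  | skip
  | assign (x : ℕ) (e : Expr)
  | store (a : ℕ) (i e : Expr)
  | seq (p q : Prog)
  | ite (g : Expr) (p q : Prog)
  | loop (g : Expr) (p : Prog)

/-- Write `v` into register `x`. -/
def Mem.setReg (m : Mem) (x v : ℕ) : Mem :=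
  { m with reg := Function.update m.reg x v }

/-- Write `v` into cell `i` of array `a`. -/
def Mem.setArr (m : Mem) (a i v : ℕ) : Mem :=
  { m with arr := Function.update m.arr a (Function.update (m.arr a) i v) }

/-- `Exec B p m t m'`: on a machine whose words hold the numbers `0, …, B`, the program `p` started
in memory `m` halts after `t` steps in memory `m'`. Every elementary operation counts as one step.
An instruction that would write a number larger than `B`, or write at an address larger than `B`,
has no execution (so a program that overflows does not halt). Intermediate values inside an
expression exceed `B` and the constants at most by a factor bounded by the size of the program. -/
inductive Exec (B : ℕ) : Prog → Mem → ℕ → Mem → Prop where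
  | skip (m : Mem) : Exec B .skip m 1 m
  | assign (m : Mem) (x : ℕ) (e : Expr) (he : e.eval m ≤ B) :
      Exec B (.assign x e) m (e.cost + 1) (m.setReg x (e.eval m))
  | store (m : Mem) (a : ℕ) (i e : Expr) (hi : i.eval m ≤ B) (he : e.eval m ≤ B) :
      Exec B (.store a i e) m (i.cost + e.cost + 1) (m.setArr a (i.eval m) (e.eval m))
  | seq {p q : Prog} {m m' m'' : Mem} {s t : ℕ} (hp : Exec B p m s m') (hq : Exec B q m' t m'') :
      Exec B (.seq p q) m (s + t) m''
  | ite_true {g : Expr} {p q : Prog} {m m' : Mem} {t : ℕ} (hg : g.eval m ≠ 0)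
      (hp : Exec B p m t m') : Exec B (.ite g p q) m (g.cost + 1 + t) m'
  | ite_false {g : Expr} {p q : Prog} {m m' : Mem} {t : ℕ} (hg : g.eval m = 0)
      (hq : Exec B q m t m') : Exec B (.ite g p q) m (g.cost + 1 + t) m'
  | loop_true {g : Expr} {p : Prog} {m m' m'' : Mem} {s t : ℕ} (hg : g.eval m ≠ 0)
      (hp : Exec B p m s m') (hl : Exec B (.loop g p) m' t m'') :
      Exec B (.loop g p) m (g.cost + 1 + s + t) m''
  | loop_false {g : Expr} {p : Prog} {m : Mem} (hg : g.eval m = 0) :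
      Exec B (.loop g p) m (g.cost + 1) m

/-- The machine is deterministic: the final memory and the number of steps are unique. -/
theorem Exec.deterministic {B : ℕ} {p : Prog} {m m₁ m₂ : Mem} {s t : ℕ}
    (h₁ : Exec B p m s m₁) (h₂ : Exec B p m t m₂) : s = t ∧ m₁ = m₂ := by
  induction h₁ generalizing t m₂ with
  | skip => cases h₂; exact ⟨rfl, rfl⟩
  | assign => cases h₂; exact ⟨rfl, rfl⟩
  | store => cases h₂; exact ⟨rfl, rfl⟩
  | seq _ _ ihp ihq =>
    cases h₂ with
    | seq hp hq =>
      obtain ⟨rfl, rfl⟩ := ihp hp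
      obtain ⟨rfl, rfl⟩ := ihq hq
      exact ⟨rfl, rfl⟩
  | ite_true hg _ ih =>
    cases h₂ with
    | ite_true _ hp => obtain ⟨rfl, rfl⟩ := ih hp; exact ⟨rfl, rfl⟩
    | ite_false hg' _ => exact absurd hg' hg
  | ite_false hg _ ih =>
    cases h₂ with
    | ite_true hg' _ => exact absurd hg hg'
    | ite_false _ hq => obtain ⟨rfl, rfl⟩ := ih hq; exact ⟨rfl, rfl⟩
  | loop_true hg _ _ ihp ihl =>
    cases h₂ with
    | loop_true _ hp hl =>
      obtain ⟨rfl, rfl⟩ := ihp hp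
      obtain ⟨rfl, rfl⟩ := ihl hl
      exact ⟨rfl, rfl⟩
    | loop_false hg' => exact absurd hg' hg
  | loop_false hg =>
    cases h₂ with
    | loop_true hg' _ _ => exact absurd hg hg'
    | loop_false _ => exact ⟨rfl, rfl⟩

/-- The memory `m` holds the input `(n, k, G, U)`: registers 0 and 1 hold `n` and `k`; arrays 0
and 1 hold the adjacency lists of `G`, the neighbours of `v` being listed without repetition, in
any order, in the cells `p` of array 1 with `arr 0 v ≤ p < arr 0 (v + 1)`; array 2 holds the
indicator function of `U`; all other registers and arrays are zero. (Nothing is assumed about the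
cells of arrays 0, 1, 2 beyond these ranges.) -/
structure IsInput {n : ℕ} (G : SimpleGraph (Fin n)) (k : ℕ) (U : Finset (Fin n)) (m : Mem) :
    Prop where
  reg_zero : m.reg 0 = n
  reg_one : m.reg 1 = k
  reg_rest : ∀ x, 2 ≤ x → m.reg x = 0
  offset_zero : m.arr 0 0 = 0
  offset_mono : ∀ v < n, m.arr 0 v ≤ m.arr 0 (v + 1)
  vertex : ∀ p < m.arr 0 n, m.arr 1 p < n
  adj_iff : ∀ v w : Fin n, G.Adj v w ↔
    ∃ p, m.arr 0 v ≤ p ∧ p < m.arr 0 (v + 1) ∧ m.arr 1 p = w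
  nodup : ∀ v < n, ∀ p q, m.arr 0 v ≤ p → p < m.arr 0 (v + 1) →
    m.arr 0 v ≤ q → q < m.arr 0 (v + 1) → m.arr 1 p = m.arr 1 q → p = q
  mem_iff : ∀ v : Fin n, m.arr 2 v = if v ∈ U then 1 else 0
  arr_rest : ∀ a, 3 ≤ a → ∀ i, m.arr a i = 0

/-- The family of `k` subsets of `U` written in array 3 of the memory `m`: the vertex `v ∈ U` is in
part number `m.arr 3 v`. -/
def outputParts {n : ℕ} (k : ℕ) (U : Finset (Fin n)) (m : Mem) : Fin k → Finset (Fin n) :=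
  fun i => U.filter fun v => m.arr 3 v = i

end RAM

/-!
Let `h = 2 * k - 1`, so that `U` has `2 * h` points.

*Geometry.* Fix a spanning tree of the cactus `G`; let `D` be its metric and let the root `v`
minimize the total tree distance to the points of `U`. Then no branch at `v` (component of the
tree without `v`) holds more than `h` of the points (`IsTreeMetricOn.card_branch_le`). A subtree
below a vertex and its complement are both connected, and a cactus has at most two edges between
two such sets (`IsCactus.not_three_edges`); so besides the edge to the parent at most one edge of
`G` leaves a subtree (`IsTreeMetricOn.leaving_edge`). In particular every branch at `v` is joined
by an edge to at most one other branch.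

If no two branches joined by an edge hold more than `h` points together, then no component of
`G - v` does, and `v` is on every shortest path between points of different components
(`IsTreeMetricOn.isPairingKey_of_light`). Otherwise, let the edge `a b` join two branches with
more than `h` points. With the tree paths from `v` to `a` and `b` it forms a cycle, from which all
other vertices hang: an edge of `G` either joins vertices hanging from the same vertex of the
cycle or belongs to the cycle. A shortest path between vertices hanging from `s` and `t` can be
led along any shortest arc from `s` to `t`, and no vertex of the cycle has more than `h` points
hanging from it (`IsTreeMetricOn.isPairingKey_of_heavy`). Both cases are captured by one notion,
`IsPairingKey`: a key for each point, namely the component or the position on the cycle.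

Sort the points by their keys and pair the points number `i` and `i + h`, which have different
keys. Each of the `h` arcs so obtained covers at least `h + 1` points, so some position is covered
by at least `h * (h + 1) / (2 * h) = k` of them (`exists_position_on_many_arcs`). The vertex at
this position lies in the segments of `k` disjoint pairs; the remaining points are added to any
part.

*Algorithm.* All steps are effective. The program builds the adjacency matrix, grows the spanning
tree leaf by leaf while filling the table of `D`, and then finds the root, the branches, the edges
between branches, the keys, the sorted order (by running through the possible keys, of which there
are at most `4 * n + 1`), the position and the pairs. Each phase consists of counting loops,
nested at most twice, of length `O(n)`. The triple loop hidden in growing the tree is avoided by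
keeping, for each vertex outside, a neighbour in the tree. Correctness is derived in the form of
total correctness triples with time bounds (`RAM.Runs`), with one rule for loops
(`RAM.Runs.forLoop`).
-/

namespace SimpleGraph

variable {V : Type*} {G : SimpleGraph V}

/-! ### Edges between complementary connected sets -/

/-- `G.JoinedWithin X x y`: some walk of `G` from `x` to `y` stays inside `X`. -/
def JoinedWithin (G : SimpleGraph V) (X : Set V) (x y : V) : Prop :=
  ∃ p : G.Walk x y, ∀ z ∈ p.support, z ∈ X

namespace JoinedWithin

variable {X : Set V} {x y z : V}

theorem refl (hx : x ∈ X) : G.JoinedWithin X x x :=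
  ⟨.nil, by simpa using hx⟩

theorem symm (h : G.JoinedWithin X x y) : G.JoinedWithin X y x := by
  obtain ⟨p, hp⟩ := h
  exact ⟨p.reverse, by simpa using hp⟩

theorem trans (h : G.JoinedWithin X x y) (h' : G.JoinedWithin X y z) :
    G.JoinedWithin X x z := by
  obtain ⟨p, hp⟩ := h
  obtain ⟨q, hq⟩ := h'
  refine ⟨p.append q, fun w hw => ?_⟩
  rcases (Walk.mem_support_append_iff p q).1 hw with h | h
  exacts [hp _ h, hq _ h]

theorem of_adj (h : G.Adj x y) (hx : x ∈ X) (h' : G.JoinedWithin X y z) :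
    G.JoinedWithin X x z := by
  obtain ⟨q, hq⟩ := h'
  refine ⟨.cons h q, fun w hw => ?_⟩
  rcases (by simpa using hw : w = x ∨ w ∈ q.support) with rfl | h
  exacts [hx, hq _ h]

end JoinedWithin

/-- In a walk-connected set, any three vertices `a`, `b`, `c` are reached from some vertex `m` by
three walks which pairwise share no edge: `m` is the place where a walk from `c` first meets a
fixed path from `a` to `b`. -/
theorem exists_edge_disjoint_fan {X : Set V}
    (hX : ∀ x ∈ X, ∀ y ∈ X, G.JoinedWithin X x y) {a b c : V} (ha : a ∈ X) (hb : b ∈ X)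
    (hc : c ∈ X) :
    ∃ m ∈ X, ∃ (p : G.Walk m a) (q : G.Walk m b) (r : G.Walk m c),
      (∀ z ∈ p.support, z ∈ X) ∧ (∀ z ∈ q.support, z ∈ X) ∧ (∀ z ∈ r.support, z ∈ X) ∧
      (∀ e ∈ p.edges, e ∉ q.edges) ∧ (∀ e ∈ p.edges, e ∉ r.edges) ∧
      (∀ e ∈ q.edges, e ∉ r.edges) := by
  classical
  obtain ⟨P₀, hP₀⟩ := hX a ha b hb
  obtain ⟨P, hPpath, hP⟩ : ∃ P : G.Walk a b, P.IsPath ∧ ∀ z ∈ P.support, z ∈ X :=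
    ⟨P₀.bypass, P₀.bypass_isPath, fun z hz => hP₀ z (P₀.support_bypass_subset_support hz)⟩
  -- follow `W` from `u` until it first meets `P`; up to there it uses no edge of `P`
  have key : ∀ (u w : V) (W : G.Walk u w), w ∈ P.support → (∀ z ∈ W.support, z ∈ X) →
      ∃ m ∈ P.support, ∃ r : G.Walk m u, (∀ z ∈ r.support, z ∈ X) ∧
        ∀ e ∈ P.edges, e ∉ r.edges := by
    intro u w W
    induction W with
    | nil => exact fun h hs => ⟨_, h, .nil, hs, by simp⟩
    | @cons u u' w hadj W ih =>
      intro hw hs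
      by_cases hu : u ∈ P.support
      · exact ⟨u, hu, .nil, by simpa using hs u (by simp), by simp⟩
      · obtain ⟨m, hm, r, hr, hr'⟩ := ih hw fun z hz => hs z (by simp [hz])
        refine ⟨m, hm, r.append (.cons hadj.symm .nil), fun z hz => ?_, fun e he he' => ?_⟩
        · rcases (Walk.mem_support_append_iff _ _).1 hz with h | h
          · exact hr z h
          · refine hs z ?_
            rcases (by simpa using h : z = u' ∨ z = u) with rfl | rfl <;> simp
        · rw [Walk.edges_append, List.mem_append] at he'
          rcases he' with h | h
          · exact hr' e he h
          · have : e = s(u', u) := by simpa using h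
            subst this
            exact hu (P.snd_mem_support_of_mem_edges he)
  obtain ⟨W, hW⟩ := hX c hc a ha
  obtain ⟨m, hm, r, hr, hr'⟩ := key c a W P.start_mem_support hW
  have hnd := hPpath.isTrail.edges_nodup
  have hsplit : (P.takeUntil m hm).edges ++ (P.dropUntil m hm).edges = P.edges := by
    rw [← Walk.edges_append, Walk.take_spec]
  rw [← hsplit, List.nodup_append] at hnd
  refine ⟨m, hP m hm, (P.takeUntil m hm).reverse, P.dropUntil m hm, r,
    fun z hz => hP z (P.support_takeUntil_subset_support hm (by simpa using hz)),
    fun z hz => hP z (P.support_dropUntil_subset_support hm hz), hr, fun e he he' => ?_,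
    fun e he => hr' e ?_, fun e he => hr' e (P.edges_dropUntil_subset_edges hm he)⟩
  · exact hnd.2.2 e (by simpa using he) e he' rfl
  · exact P.edges_takeUntil_subset_edges hm (by simpa using he)

/-- A cactus has at most two edges between a connected set and its connected complement: three
edges, completed by fans on both sides, would give three edge-disjoint walks between the centres
of the fans. -/
theorem IsCactus.not_three_edges (hG : G.IsCactus) {X : Set V}
    (hX : ∀ x ∈ X, ∀ y ∈ X, G.JoinedWithin X x y)
    (hY : ∀ x ∈ Xᶜ, ∀ y ∈ Xᶜ, G.JoinedWithin Xᶜ x y)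
    {x₁ x₂ x₃ y₁ y₂ y₃ : V} (hx₁ : x₁ ∈ X) (hx₂ : x₂ ∈ X) (hx₃ : x₃ ∈ X)
    (hy₁ : y₁ ∈ Xᶜ) (hy₂ : y₂ ∈ Xᶜ) (hy₃ : y₃ ∈ Xᶜ)
    (h₁ : G.Adj x₁ y₁) (h₂ : G.Adj x₂ y₂) (h₃ : G.Adj x₃ y₃)
    (h₁₂ : ¬ (x₁ = x₂ ∧ y₁ = y₂)) (h₁₃ : ¬ (x₁ = x₃ ∧ y₁ = y₃))
    (h₂₃ : ¬ (x₂ = x₃ ∧ y₂ = y₃)) : False := by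
  classical
  obtain ⟨m, hm, p₁, p₂, p₃, hp₁, hp₂, hp₃, p12, p13, p23⟩ :=
    exists_edge_disjoint_fan hX hx₁ hx₂ hx₃
  obtain ⟨m', hm', q₁, q₂, q₃, hq₁, hq₂, hq₃, q12, q13, q23⟩ :=
    exists_edge_disjoint_fan hY hy₁ hy₂ hy₃
  obtain ⟨s, hs, hsep⟩ := hG.two_separable m m' (by rintro rfl; exact hm' hm)
  -- every walk through one of the three edges meets the separating set `s`
  have hit : ∀ {x y : V} (p : G.Walk m x) (q : G.Walk m' y) (h : G.Adj x y),
      ∃ e ∈ s, e ∈ p.edges ∨ e ∈ q.edges ∨ e = s(x, y) := by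
    intro x y p q h
    by_contra hcon
    push Not at hcon
    refine hsep ⟨(p.append (.cons h q.reverse)).toDeleteEdges _ fun e he hes => ?_⟩
    have := hcon e hes
    rw [Walk.edges_append, List.mem_append] at he
    rcases he with he | he
    · exact this.1 he
    · rcases (by simpa using he : e = s(x, y) ∨ e ∈ q.edges) with he | he
      exacts [this.2.2 he, this.2.1 he]
  obtain ⟨e₁, hs₁, he₁⟩ := hit p₁ q₁ h₁
  obtain ⟨e₂, hs₂, he₂⟩ := hit p₂ q₂ h₂
  obtain ⟨e₃, hs₃, he₃⟩ := hit p₃ q₃ h₃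
  -- walks through different edges share no edge, so `s` would need three elements
  have inside : ∀ {Z : Set V} {u w : V} {p : G.Walk u w}, (∀ z ∈ p.support, z ∈ Z) →
      ∀ {e : Sym2 V}, e ∈ p.edges → ∀ z ∈ e, z ∈ Z := by
    intro Z u w p hp e he z hz
    induction e with
    | _ a b =>
      rcases Sym2.mem_iff.1 hz with rfl | rfl
      · exact hp _ (p.fst_mem_support_of_mem_edges he)
      · exact hp _ (p.snd_mem_support_of_mem_edges he)
  have apart : ∀ {x y x' y' : V} {p : G.Walk m x} {q : G.Walk m' y} {p' : G.Walk m x'}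
      {q' : G.Walk m' y'}, (∀ z ∈ p.support, z ∈ X) → (∀ z ∈ q.support, z ∈ Xᶜ) →
      (∀ z ∈ p'.support, z ∈ X) → (∀ z ∈ q'.support, z ∈ Xᶜ) →
      (∀ e ∈ p.edges, e ∉ p'.edges) → (∀ e ∈ q.edges, e ∉ q'.edges) →
      x ∈ X → y ∈ Xᶜ → x' ∈ X → y' ∈ Xᶜ → ¬ (x = x' ∧ y = y') → ∀ {e e' : Sym2 V},
      (e ∈ p.edges ∨ e ∈ q.edges ∨ e = s(x, y)) →
      (e' ∈ p'.edges ∨ e' ∈ q'.edges ∨ e' = s(x', y')) → e ≠ e' := by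
    rintro x y x' y' p q p' q' hp hq hp' hq' hpp hqq hx hy hx' hy' hne e e' he he' rfl
    rcases he with he | he | he <;> rcases he' with he' | he' | he'
    · exact hpp e he he'
    · obtain ⟨z, hz⟩ : ∃ z, z ∈ e := ⟨_, e.out_fst_mem⟩
      exact inside hq' he' z hz (inside hp he z hz)
    · exact hy' (inside hp he y' (by simp [he']))
    · obtain ⟨z, hz⟩ : ∃ z, z ∈ e := ⟨_, e.out_fst_mem⟩
      exact inside hq he z hz (inside hp' he' z hz)
    · exact hqq e he he'
    · exact inside hq he x' (by simp [he']) hx'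
    · exact hy (inside hp' he' y (by simp [he]))
    · exact inside hq' he' x (by simp [he]) hx
    · rw [he, Sym2.eq_iff] at he'
      rcases he' with h | ⟨rfl, rfl⟩
      · exact hne h
      · exact hy' hx
  have hcard : ({e₁, e₂, e₃} : Finset (Sym2 V)).card = 3 :=
    Finset.card_eq_three.2 ⟨e₁, e₂, e₃,
      apart hp₁ hq₁ hp₂ hq₂ p12 q12 hx₁ hy₁ hx₂ hy₂ h₁₂ he₁ he₂,
      apart hp₁ hq₁ hp₃ hq₃ p13 q13 hx₁ hy₁ hx₃ hy₃ h₁₃ he₁ he₃,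
      apart hp₂ hq₂ hp₃ hq₃ p23 q23 hx₂ hy₂ hx₃ hy₃ h₂₃ he₂ he₃, rfl⟩
  have hsub : ({e₁, e₂, e₃} : Finset (Sym2 V)) ⊆ s := by
    intro e he
    simp only [Finset.mem_insert, Finset.mem_singleton] at he
    rcases he with rfl | rfl | rfl <;> assumption
  have := Finset.card_le_card hsub
  omega

/-! ### Spanning trees and their metrics -/

/-- `D` is, on the set `S`, the distance function of a spanning tree of `G[S]`. The tree is
recovered as the pairs at distance one. The field `edge` is bipartiteness; `concat` says that when
the two ends `x`, `w` of a tree edge point away from each other towards `a` and `v`, then the tree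
path from `v` to `a` runs through that edge. -/
structure IsTreeMetricOn (G : SimpleGraph V) (S : Set V) (D : V → V → ℕ) : Prop where
  self : ∀ x ∈ S, D x x = 0
  symm : ∀ x ∈ S, ∀ y ∈ S, D x y = D y x
  step : ∀ x ∈ S, ∀ y ∈ S, x ≠ y → ∃ w ∈ S, G.Adj x w ∧ D x w = 1 ∧ D x y = D w y + 1
  edge : ∀ x ∈ S, ∀ w ∈ S, D x w = 1 → ∀ y ∈ S, D w y = D x y + 1 ∨ D x y = D w y + 1
  concat : ∀ x ∈ S, ∀ w ∈ S, ∀ v ∈ S, ∀ a ∈ S, D x w = 1 → D v x = D v w + 1 →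
    D a w = D a x + 1 → D v a = D v w + 1 + D x a

theorem isTreeMetricOn_singleton {D : V → V → ℕ} {x : V} (h : D x x = 0) :
    G.IsTreeMetricOn {x} D := by
  constructor <;> simp_all

/-- Attaching a leaf `w` to the vertex `c` of a tree. -/
theorem IsTreeMetricOn.insert {S : Set V} {D D' : V → V → ℕ} (hD : G.IsTreeMetricOn S D)
    {c w : V} (hc : c ∈ S) (hw : w ∉ S) (hadj : G.Adj w c)
    (hold : ∀ x ∈ S, ∀ y ∈ S, D' x y = D x y) (hself : D' w w = 0)
    (hl : ∀ u ∈ S, D' w u = D c u + 1) (hr : ∀ u ∈ S, D' u w = D c u + 1) :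
    G.IsTreeMetricOn (Insert.insert w S) D' := by
  have hcc : D c c = 0 := hD.self c hc
  have hzero : ∀ x ∈ S, D c x = 0 → x = c := by
    intro x hx h
    by_contra hne
    obtain ⟨z, -, -, -, h'⟩ := hD.step c hc x hx (Ne.symm hne)
    omega
  constructor
  · rintro x (rfl | hx)
    · exact hself
    · rw [hold x hx x hx, hD.self x hx]
  · rintro x (rfl | hx) y (rfl | hy)
    · rfl
    · rw [hl y hy, hr y hy]
    · rw [hl x hx, hr x hx]
    · rw [hold x hx y hy, hold y hy x hx, hD.symm x hx y hy]
  · rintro x (rfl | hx) y (rfl | hy) hne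
    · exact absurd rfl hne
    · exact ⟨c, Or.inr hc, hadj, by rw [hl c hc, hcc], by rw [hl y hy, hold c hc y hy]⟩
    · by_cases hxc : x = c
      · subst hxc
        exact ⟨y, Or.inl rfl, hadj.symm, by rw [hr x hc, hcc], by rw [hr x hc, hcc, hself]⟩
      · obtain ⟨z, hz, hadj', h1, h2⟩ := hD.step x hx c hc hxc
        exact ⟨z, Or.inr hz, hadj', by rw [hold x hx z hz, h1],
          by rw [hr x hx, hr z hz, hD.symm c hc x hx, hD.symm c hc z hz, h2]⟩
    · obtain ⟨z, hz, hadj', h1, h2⟩ := hD.step x hx y hy hne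
      exact ⟨z, Or.inr hz, hadj', by rw [hold x hx z hz, h1],
        by rw [hold x hx y hy, hold z hz y hy, h2]⟩
  · rintro x (rfl | hx) z (rfl | hz) h1 y (rfl | hy)
    · omega
    · omega
    · have := hl z hz; have := hr z hz; omega
    · obtain rfl := hzero z hz (by have := hl z hz; omega)
      rw [hl y hy, hold z hz y hy]; omega
    · have := hl x hx; have := hr x hx; omega
    · obtain rfl := hzero x hx (by have := hr x hx; omega)
      rw [hl y hy, hold x hx y hy]; omega
    · rw [hold x hx z hz] at h1
      have := hD.edge x hx z hz h1 c hc
      rw [hr x hx, hr z hz, hD.symm c hc x hx, hD.symm c hc z hz]; omega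
    · rw [hold x hx z hz] at h1
      have := hD.edge x hx z hz h1 y hy
      rwa [hold x hx y hy, hold z hz y hy]
  · rintro x (rfl | hx) z (rfl | hz) v hv a ha h1 h2 h3
    · omega
    · obtain rfl := hzero z hz (by have := hl z hz; omega)
      rcases ha with rfl | ha
      · rw [h2, hself]
      · rw [hr a ha, hold a ha z hz, hD.symm a ha z hz] at h3; omega
    · obtain rfl := hzero x hx (by have := hr x hx; omega)
      rcases hv with rfl | hv
      · rcases ha with rfl | ha
        · omega
        · rw [hl a ha, hself, hold x hx a ha]; omega
      · rw [hr v hv, hold v hv x hx, hD.symm v hv x hx] at h2; omega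
    · rw [hold x hx z hz] at h1
      rcases hv with rfl | hv <;> rcases ha with rfl | ha
      · omega
      · rw [hl x hx, hl z hz] at h2
        rw [hold a ha x hx, hold a ha z hz] at h3
        rw [hl a ha, hl z hz, hold x hx a ha]
        have := hD.concat x hx z hz c hc a ha h1 (by omega) h3
        omega
      · rw [hl x hx, hl z hz] at h3
        rw [hold v hv x hx, hold v hv z hz] at h2
        rw [hr v hv, hr x hx, hold v hv z hz]
        have := hD.concat x hx z hz v hv c hc h1 h2 (by omega)
        rw [hD.symm v hv c hc, hD.symm x hx c hc] at this
        omega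
      · rw [hold v hv x hx, hold v hv z hz] at h2
        rw [hold a ha x hx, hold a ha z hz] at h3
        rw [hold v hv a ha, hold v hv z hz, hold x hx a ha]
        exact hD.concat x hx z hz v hv a ha h1 h2 h3

/-- Some edge leaves every nonempty proper subset of a connected graph. -/
theorem Connected.exists_adj_boundary (hG : G.Connected) {S : Set V} {x y : V} (hx : x ∈ S)
    (hy : y ∉ S) : ∃ c ∈ S, ∃ w, w ∉ S ∧ G.Adj w c := by
  obtain ⟨p⟩ := hG.preconnected x y
  obtain ⟨d, -, h1, h2⟩ := p.exists_boundary_dart S hx hy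
  exact ⟨d.fst, h1, d.snd, h2, d.adj.symm⟩

/-- Every finite connected graph has a spanning tree, grown by attaching one leaf at a time. -/
theorem Connected.exists_isTreeMetricOn_univ [Finite V] (hG : G.Connected) :
    ∃ D, G.IsTreeMetricOn Set.univ D := by
  classical
  have := Fintype.ofFinite V
  obtain ⟨r⟩ := hG.nonempty
  have key : ∀ i, i + 1 ≤ Fintype.card V →
      ∃ (S : Finset V) (D : V → V → ℕ), S.card = i + 1 ∧ G.IsTreeMetricOn (S : Set V) D := by
    intro i
    induction i with
    | zero =>
      intro _
      refine ⟨{r}, fun _ _ => 0, rfl, ?_⟩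
      simpa using isTreeMetricOn_singleton (G := G) (x := r) (D := fun _ _ => 0) rfl
    | succ i ih =>
      intro hi
      obtain ⟨S, D, hS, hD⟩ := ih (by omega)
      obtain ⟨x, hx⟩ : S.Nonempty := Finset.card_pos.1 (by omega)
      obtain ⟨y, hy⟩ : ∃ y, y ∉ S := by
        by_contra hcon
        push Not at hcon
        rw [Finset.eq_univ_iff_forall.2 hcon, Finset.card_univ] at hS
        omega
      obtain ⟨c, hc, w, hw, hadj⟩ := hG.exists_adj_boundary (S := (S : Set V)) hx hy
      refine ⟨Insert.insert w S, fun a b => if a = w then (if b = w then 0 else D c b + 1) else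
        if b = w then D c a + 1 else D a b, by rw [Finset.card_insert_of_notMem hw, hS], ?_⟩
      have hne : ∀ u ∈ S, u ≠ w := fun u hu h => hw (h ▸ hu)
      rw [Finset.coe_insert]
      refine hD.insert hc hw hadj (fun x hx y hy => ?_) (by simp) (fun u hu => ?_)
        (fun u hu => ?_)
      · simp [hne x hx, hne y hy]
      · simp [hne u hu]
      · simp [hne u hu]
  obtain ⟨S, D, hS, hD⟩ := key (Fintype.card V - 1)
    (by have := Fintype.card_pos_iff.2 ⟨r⟩; omega)
  have hpos := Fintype.card_pos_iff.2 ⟨r⟩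
  rw [(Finset.card_eq_iff_eq_univ S).1 (by omega), Finset.coe_univ] at hD
  exact ⟨D, hD⟩

namespace IsTreeMetricOn

variable {D : V → V → ℕ}

theorem dist_self (hD : G.IsTreeMetricOn Set.univ D) (x : V) : D x x = 0 := hD.self x trivial

theorem dist_comm (hD : G.IsTreeMetricOn Set.univ D) (x y : V) : D x y = D y x :=
  hD.symm x trivial y trivial

theorem exists_step (hD : G.IsTreeMetricOn Set.univ D) {x y : V} (h : x ≠ y) :
    ∃ w, G.Adj x w ∧ D x w = 1 ∧ D x y = D w y + 1 := by
  obtain ⟨w, -, h⟩ := hD.step x trivial y trivial h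
  exact ⟨w, h⟩

theorem dist_edge (hD : G.IsTreeMetricOn Set.univ D) {x w : V} (h : D x w = 1) (y : V) :
    D w y = D x y + 1 ∨ D x y = D w y + 1 := hD.edge x trivial w trivial h y trivial

theorem dist_concat (hD : G.IsTreeMetricOn Set.univ D) {x w v a : V} (h : D x w = 1)
    (h₁ : D v x = D v w + 1) (h₂ : D a w = D a x + 1) : D v a = D v w + 1 + D x a :=
  hD.concat x trivial w trivial v trivial a trivial h h₁ h₂

theorem eq_of_dist_eq_zero (hD : G.IsTreeMetricOn Set.univ D) {x y : V} (h : D x y = 0) :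
    x = y := by
  by_contra hne
  obtain ⟨w, -, -, h'⟩ := hD.exists_step hne
  omega

theorem dist_triangle (hD : G.IsTreeMetricOn Set.univ D) (x y z : V) :
    D x z ≤ D x y + D y z := by
  induction hn : D x y generalizing x with
  | zero => rw [hD.eq_of_dist_eq_zero hn]; omega
  | succ n ih =>
    obtain ⟨w, -, h1, h2⟩ := hD.exists_step (x := x) (y := y)
      (by rintro rfl; rw [hD.dist_self] at hn; omega)
    have := ih w (by omega)
    have := hD.dist_edge h1 z
    omega

/-- In the tree rooted at `v`, parents are unique. -/
theorem parent_unique (hD : G.IsTreeMetricOn Set.univ D) {v x w w' : V} (hw : D x w = 1)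
    (hw' : D x w' = 1) (h : D v x = D v w + 1) (h' : D v x = D v w' + 1) : w = w' := by
  have h1 := hD.dist_edge hw w'
  have h2 := hD.dist_comm w' w
  have h3 := hD.dist_comm w' x
  rcases h1 with h1 | h1
  · have := hD.dist_concat hw h (a := w') (by omega)
    omega
  · exact hD.eq_of_dist_eq_zero (by omega)

/-- The descendants of `c` in the tree rooted at `v`. -/
def subtree (D : V → V → ℕ) (v c : V) : Set V := {x | D v x = D v c + D c x}

theorem mem_subtree {v c x : V} : x ∈ subtree D v c ↔ D v x = D v c + D c x := Iff.rfl

theorem step_mem_subtree (hD : G.IsTreeMetricOn Set.univ D) {v c x w : V}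
    (hx : x ∈ subtree D v c) (hw : D x w = 1) (h : D x c = D w c + 1) :
    w ∈ subtree D v c ∧ D v x = D v w + 1 := by
  have h1 := hD.dist_edge hw v
  have h2 := hD.dist_triangle v c w
  have h3 := hD.dist_comm c x
  have h4 := hD.dist_comm c w
  have h5 := hD.dist_comm x v
  have h6 := hD.dist_comm w v
  simp only [mem_subtree] at *
  omega

theorem mem_subtree_of_step (hD : G.IsTreeMetricOn Set.univ D) {v c x w : V}
    (hw : w ∈ subtree D v c) (hxw : D x w = 1) (h : D v x = D v w + 1) :
    x ∈ subtree D v c := by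
  have h1 := hD.dist_edge hxw c
  have h2 := hD.dist_triangle v c x
  have h3 := hD.dist_comm c x
  have h4 := hD.dist_comm c w
  simp only [mem_subtree] at *
  omega

theorem subtree_self (hD : G.IsTreeMetricOn Set.univ D) (v c : V) : c ∈ subtree D v c := by
  simp [mem_subtree, hD.dist_self]

theorem root_notMem_subtree (hD : G.IsTreeMetricOn Set.univ D) {v c : V} (hc : c ≠ v) :
    v ∉ subtree D v c := by
  intro h
  rw [mem_subtree, hD.dist_self] at h
  exact hc (hD.eq_of_dist_eq_zero (by omega)).symm

theorem mem_subtree_trans (hD : G.IsTreeMetricOn Set.univ D) {v c c' x : V}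
    (h : c ∈ subtree D v c') (hx : x ∈ subtree D v c) : x ∈ subtree D v c' := by
  have h1 := hD.dist_triangle c' c x
  have h2 := hD.dist_triangle v c' x
  simp only [mem_subtree] at *
  omega

/-- In the tree rooted at `v`, ancestors at a given depth are unique. -/
theorem ancestor_unique (hD : G.IsTreeMetricOn Set.univ D) {v c c' x : V}
    (h : x ∈ subtree D v c) (h' : x ∈ subtree D v c') (hcc : D v c = D v c') : c = c' := by
  induction hn : D c x generalizing x with
  | zero =>
    have := hD.eq_of_dist_eq_zero hn
    subst this
    refine (hD.eq_of_dist_eq_zero (x := c') (y := c) ?_).symm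
    rw [mem_subtree] at h'
    omega
  | succ n ih =>
    have e1 : c ≠ x := by rintro rfl; rw [hD.dist_self] at hn; omega
    have e2 : D c' x = n + 1 := by
      rw [mem_subtree] at h h'; omega
    have e3 : c' ≠ x := by rintro rfl; rw [hD.dist_self] at e2; omega
    obtain ⟨w, -, hw1, hw2⟩ := hD.exists_step e1.symm
    obtain ⟨w', -, hw1', hw2'⟩ := hD.exists_step e3.symm
    obtain ⟨m, hm⟩ := hD.step_mem_subtree h hw1 hw2
    obtain ⟨m', hm'⟩ := hD.step_mem_subtree h' hw1' hw2'
    obtain rfl := hD.parent_unique hw1 hw1' hm hm'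
    exact ih m m' (by have := hD.dist_comm c x; have := hD.dist_comm w c; omega)

theorem exists_ancestor (hD : G.IsTreeMetricOn Set.univ D) (v x : V) {i : ℕ} (hi : i ≤ D v x) :
    ∃ c, D v c = i ∧ x ∈ subtree D v c := by
  induction hn : D v x - i generalizing x with
  | zero => exact ⟨x, by omega, hD.subtree_self v x⟩
  | succ n ih =>
    obtain ⟨w, -, h1, h2⟩ := hD.exists_step (x := x) (y := v)
      (by rintro rfl; rw [hD.dist_self] at hn; omega)
    rw [hD.dist_comm x v, hD.dist_comm w v] at h2
    obtain ⟨c, hc, hw⟩ := ih w (by omega) (by omega)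
    exact ⟨c, hc, hD.mem_subtree_of_step hw h1 h2⟩

theorem subtree_joined (hD : G.IsTreeMetricOn Set.univ D) (v c : V) {x : V}
    (hx : x ∈ subtree D v c) : G.JoinedWithin (subtree D v c) x c := by
  induction hn : D x c generalizing x with
  | zero => rw [hD.eq_of_dist_eq_zero hn] at hx ⊢; exact .refl hx
  | succ n ih =>
    obtain ⟨w, hadj, h1, h2⟩ := hD.exists_step (x := x) (y := c)
      (by rintro rfl; rw [hD.dist_self] at hn; omega)
    exact .of_adj hadj hx (ih (hD.step_mem_subtree hx h1 h2).1 (by omega))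

theorem compl_subtree_joined (hD : G.IsTreeMetricOn Set.univ D) {v c : V} (hc : c ≠ v) {x : V}
    (hx : x ∈ (subtree D v c)ᶜ) : G.JoinedWithin (subtree D v c)ᶜ x v := by
  induction hn : D x v generalizing x with
  | zero =>
    rw [hD.eq_of_dist_eq_zero hn]
    exact .refl (hD.root_notMem_subtree hc)
  | succ n ih =>
    obtain ⟨w, hadj, h1, h2⟩ := hD.exists_step (x := x) (y := v)
      (by rintro rfl; rw [hD.dist_self] at hn; omega)
    refine .of_adj hadj hx (ih (fun hw => hx (hD.mem_subtree_of_step hw h1 ?_)) (by omega))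
    rw [hD.dist_comm v x, hD.dist_comm v w, h2]

/-- In a cactus, besides the tree edge from `c` to its parent `p` at most one edge leaves the
subtree of `c`. -/
theorem leaving_edge (hD : G.IsTreeMetricOn Set.univ D) (hG : G.IsCactus) {v c p : V}
    (hcp : G.Adj c p) (hp : D v c = D v p + 1) {x y x' y' : V} (hx : x ∈ subtree D v c)
    (hy : y ∉ subtree D v c) (hxy : G.Adj x y) (hx' : x' ∈ subtree D v c)
    (hy' : y' ∉ subtree D v c) (hxy' : G.Adj x' y') (hne : ¬ (c = x' ∧ p = y')) :
    (x = c ∧ y = p) ∨ (x = x' ∧ y = y') := by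
  have hc : c ≠ v := by rintro rfl; rw [hD.dist_self] at hp; omega
  by_contra hcon
  push Not at hcon
  refine hG.not_three_edges (X := subtree D v c)
    (fun a ha b hb => (hD.subtree_joined v c ha).trans (hD.subtree_joined v c hb).symm)
    (fun a ha b hb => (hD.compl_subtree_joined hc ha).trans (hD.compl_subtree_joined hc hb).symm)
    hx (hD.subtree_self v c) hx' hy (fun h => ?_) hy' hxy hcp hxy' (fun h => hcon.1 h.1 h.2)
    (fun h => hcon.2 h.1 h.2) hne
  rw [mem_subtree] at h
  omega

end IsTreeMetricOn

/-! ### Shortest walks across a cycle -/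

theorem Connected.mem_geodeticSegment (hG : G.Connected) {u w x : V}
    (h : G.dist u x + G.dist x w ≤ G.dist u w) : x ∈ G.geodeticSegment u w := by
  obtain ⟨p, hp⟩ := hG.exists_walk_length_eq_dist u x
  obtain ⟨q, hq⟩ := hG.exists_walk_length_eq_dist x w
  refine ⟨p.append q, le_antisymm ?_ (dist_le _), ?_⟩
  · rw [Walk.length_append, hp, hq]; exact h
  · rw [Walk.mem_support_append_iff]; exact Or.inl p.end_mem_support

/-- A cyclic walk `c 0, …, c (L - 1), c 0` in `G` together with a map `π` sending every vertex to
the index of its branch: every edge of `G` runs inside a branch or is one of the edges of the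
walk. -/
structure IsCycleProjection (G : SimpleGraph V) (L : ℕ) (c : ℕ → V) (π : V → ℕ) : Prop where
  lt : ∀ x, π x < L
  adj_succ : ∀ i, i + 1 < L → G.Adj (c i) (c (i + 1))
  adj_wrap : G.Adj (c (L - 1)) (c 0)
  edge : ∀ x y, G.Adj x y → π x = π y ∨ (x = c (π x) ∧ y = c (π y) ∧
    (π y = π x + 1 ∨ π x = π y + 1 ∨ (π x = 0 ∧ π y = L - 1) ∨ (π x = L - 1 ∧ π y = 0)))

/-- The distance of two positions on a cycle of length `L`. -/
def cycDist (L i j : ℕ) : ℕ := min ((i - j) + (j - i)) (L - ((i - j) + (j - i)))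

namespace IsCycleProjection

variable {L : ℕ} {c : ℕ → V} {π : V → ℕ}

theorem dist_le_sub (hG : G.Connected) (hc : G.IsCycleProjection L c π) {i j : ℕ} (hij : i ≤ j)
    (hj : j < L) : G.dist (c i) (c j) ≤ j - i := by
  induction j, hij using Nat.le_induction with
  | base => simp
  | succ j hij ih =>
    have h1 := hG.dist_triangle (u := c i) (v := c j) (w := c (j + 1))
    have h2 := (dist_eq_one_iff_adj (G := G)).2 (hc.adj_succ j hj)
    have := ih (by omega)
    omega

theorem dist_le_cycDist (hG : G.Connected) (hc : G.IsCycleProjection L c π) {i j : ℕ}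
    (hi : i < L) (hj : j < L) : G.dist (c i) (c j) ≤ cycDist L i j := by
  wlog hij : i ≤ j generalizing i j
  · rw [dist_comm, show cycDist L i j = cycDist L j i by
      unfold cycDist; rw [add_comm (i - j)]]
    exact this hj hi (by omega)
  have h0 := dist_le_sub hG hc hij hj
  have h1 := dist_le_sub hG hc (Nat.zero_le i) hi
  have h2 := dist_le_sub hG hc (show j ≤ L - 1 by omega) (by omega)
  have h3 := (dist_eq_one_iff_adj (G := G)).2 hc.adj_wrap
  have h4 := hG.dist_triangle (u := c i) (v := c 0) (w := c j)
  have h5 := hG.dist_triangle (u := c 0) (v := c (L - 1)) (w := c j)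
  have h6 := G.dist_comm (u := c i) (v := c 0)
  have h7 := G.dist_comm (u := c (L - 1)) (v := c 0)
  have h8 := G.dist_comm (u := c (L - 1)) (v := c j)
  unfold cycDist
  omega

/-- A walk to another branch has to leave its own branch at the cycle, follow the cycle, and enter
the other branch from the cycle. The right-hand side of the inequality, extended by `dist y w` on
the branch of `w`, changes by at most one along every edge. -/
theorem le_dist (hG : G.Connected) (hc : G.IsCycleProjection L c π) {y w : V}
    (h : π y ≠ π w) :
    G.dist y (c (π y)) + cycDist L (π y) (π w) + G.dist (c (π w)) w ≤ G.dist y w := by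
  have key : ∀ (y w : V) (p : G.Walk y w), (if π y = π w then G.dist y w else
      G.dist y (c (π y)) + cycDist L (π y) (π w) + G.dist (c (π w)) w) ≤ p.length := by
    intro y w p
    induction p with
    | nil => simp
    | @cons y y' w hadj p ih =>
      have e1 := (dist_eq_one_iff_adj (G := G)).2 hadj
      have t1 := hG.dist_triangle (u := y) (v := y') (w := w)
      have t2 := hG.dist_triangle (u := y) (v := y') (w := c (π y))
      rw [Walk.length_cons]
      rcases hc.edge y y' hadj with he | ⟨hy, hy', he⟩
      · rw [← he] at ih
        split_ifs at ih ⊢ <;> omega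
      · have l1 := hc.lt y
        have l2 := hc.lt y'
        have l3 := hc.lt w
        have d1 : G.dist y (c (π y)) = 0 := by rw [← hy, dist_self]
        have d2 : G.dist y' (c (π y')) = 0 := by rw [← hy', dist_self]
        have d3 : π y = π w → G.dist (c (π w)) w = G.dist y w := fun h => by rw [← h, ← hy]
        have d4 : π y' = π w → G.dist (c (π w)) w = G.dist y' w := fun h => by rw [← h, ← hy']
        unfold cycDist at ih ⊢
        split_ifs at ih ⊢ with i1 i2 i2
        · omega
        · have := d3 i1; omega
        · have := d4 i2; omega
        · omega
  obtain ⟨p, hp⟩ := hG.exists_walk_length_eq_dist y w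
  have := key y w p
  rwa [if_neg h, hp] at this

end IsCycleProjection

/-- For positions `s < t` on a cycle of length `L`: the position `τ` lies on a shortest arc
between `s` and `t`. If `2 * (t - s) = L`, both arcs are shortest. For `L = 0` the condition says
that `τ` is not strictly between `s` and `t`. -/
def OnShortArc (L s t τ : ℕ) : Prop :=
  (2 * (t - s) ≤ L ∧ s ≤ τ ∧ τ ≤ t) ∨ (L ≤ 2 * (t - s) ∧ (τ ≤ s ∨ t ≤ τ))

/-- Shortest walks between two branches of the cycle can be led through any vertex of a shortest arc
between the feet of the branches. -/
theorem IsCycleProjection.mem_geodeticSegment {L : ℕ} {c : ℕ → V} {π : V → ℕ}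
    (hG : G.Connected) (hc : G.IsCycleProjection L c π) {u w : V} {τ : ℕ} (hτ : τ < L)
    (h : π u < π w) (harc : OnShortArc L (π u) (π w) τ) : c τ ∈ G.geodeticSegment u w := by
  apply hG.mem_geodeticSegment
  have l1 := hc.lt u
  have l2 := hc.lt w
  have h0 := hc.le_dist hG (y := u) (w := w) (by omega)
  have h1 := hG.dist_triangle (u := u) (v := c (π u)) (w := c τ)
  have h2 := hG.dist_triangle (u := c τ) (v := c (π w)) (w := w)
  have h3 := hc.dist_le_cycDist hG l1 hτ
  have h4 := hc.dist_le_cycDist hG hτ l2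
  have h5 : cycDist L (π u) τ + cycDist L τ (π w) = cycDist L (π u) (π w) := by
    unfold cycDist OnShortArc at *
    omega
  omega

/-- The counting step. Place `2 * h` points in order on a cycle, where `h = 2 * k - 1`, and join
the points number `i` and `i + h` by a shortest arc. Each of these `h` arcs covers at least `h + 1`
of the points, so on average a point is covered `(h + 1) / 2 = k` times. -/
theorem exists_position_on_many_arcs {k L : ℕ} (hk : 1 ≤ k) {t : ℕ → ℕ}
    (hmono : ∀ i j, i ≤ j → j < 4 * k - 2 → t i ≤ t j)
    [∀ s t τ, Decidable (OnShortArc L s t τ)] :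
    ∃ j < 4 * k - 2, k ≤ ((Finset.range (2 * k - 1)).filter
      fun i => OnShortArc L (t i) (t (i + (2 * k - 1))) (t j)).card := by
  by_contra hcon
  push Not at hcon
  set h := 2 * k - 1 with hh
  -- count the incidences of points and arcs by points (`e1`) and by arcs (`e2`)
  have e1 : ∑ j ∈ Finset.range (4 * k - 2), ((Finset.range h).filter
      fun i => OnShortArc L (t i) (t (i + h)) (t j)).card ≤ (4 * k - 2) * (k - 1) := by
    have := Finset.sum_le_card_nsmul (Finset.range (4 * k - 2)) (fun j => ((Finset.range h).filter
      fun i => OnShortArc L (t i) (t (i + h)) (t j)).card) (k - 1)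
      (fun j hj => by have := hcon j (Finset.mem_range.1 hj); omega)
    simpa using this
  have e2 : h * (h + 1) ≤ ∑ i ∈ Finset.range h, ((Finset.range (4 * k - 2)).filter
      fun j => OnShortArc L (t i) (t (i + h)) (t j)).card := by
    have := Finset.card_nsmul_le_sum (Finset.range h) (fun i => ((Finset.range (4 * k - 2)).filter
      fun j => OnShortArc L (t i) (t (i + h)) (t j)).card) (h + 1) (fun i hi => ?_)
    · simpa using this
    · have hi := Finset.mem_range.1 hi
      rcases le_total (2 * (t (i + h) - t i)) L with hL | hL
      · have : Finset.Icc i (i + h) ⊆ (Finset.range (4 * k - 2)).filter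
            fun j => OnShortArc L (t i) (t (i + h)) (t j) := by
          intro j hj
          rw [Finset.mem_Icc] at hj
          rw [Finset.mem_filter, Finset.mem_range]
          exact ⟨by omega, Or.inl ⟨hL, hmono _ _ hj.1 (by omega), hmono _ _ hj.2 (by omega)⟩⟩
        have := Finset.card_le_card this
        rw [Nat.card_Icc] at this
        omega
      · have : Finset.range (i + 1) ∪ Finset.Ico (i + h) (4 * k - 2) ⊆
            (Finset.range (4 * k - 2)).filter
              fun j => OnShortArc L (t i) (t (i + h)) (t j) := by
          intro j hj
          rw [Finset.mem_union, Finset.mem_range, Finset.mem_Ico] at hj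
          rw [Finset.mem_filter, Finset.mem_range]
          refine ⟨by omega, Or.inr ⟨hL, ?_⟩⟩
          rcases hj with hj | hj
          · exact Or.inl (hmono _ _ (by omega) (by omega))
          · exact Or.inr (hmono _ _ hj.1 hj.2)
        have := Finset.card_le_card this
        rw [Finset.card_union_of_disjoint, Finset.card_range, Nat.card_Ico] at this
        · omega
        · rw [Finset.disjoint_left]
          intro j hj hj'
          rw [Finset.mem_range] at hj
          rw [Finset.mem_Ico] at hj'
          omega
  have e3 := Finset.sum_card_bipartiteAbove_eq_sum_card_bipartiteBelow (s := Finset.range h)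
    (t := Finset.range (4 * k - 2)) (fun i j => OnShortArc L (t i) (t (i + h)) (t j))
  unfold Finset.bipartiteAbove Finset.bipartiteBelow at e3
  rw [e3] at e2
  have e4 := e2.trans e1
  obtain ⟨k, rfl⟩ : ∃ m, k = m + 1 := ⟨k - 1, by omega⟩
  have : h = 2 * k + 1 := by omega
  rw [this, show 4 * (k + 1) - 2 = 2 * (2 * k + 1) by omega, Nat.add_sub_cancel] at e4
  nlinarith

/-! ### Branches at a median of the points -/

/-- `lab` sends every vertex other than the root `v` to the child of `v` above it, in the tree
with metric `D`; the root is its own label. The branches at `v` are the classes of equal label. -/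
structure IsBranchLabel (D : V → V → ℕ) (v : V) (lab : V → V) : Prop where
  root : lab v = v
  child : ∀ x, x ≠ v → D v (lab x) = 1 ∧ D v x = D (lab x) x + 1

/-- An edge of `G` between two different branches at `v` (and not at `v` itself). -/
def Crossing (G : SimpleGraph V) (v : V) (lab : V → V) (x y : V) : Prop :=
  G.Adj x y ∧ x ≠ v ∧ y ≠ v ∧ lab x ≠ lab y

/-- `mate` sends the label of a branch to that of the branch joined to it by a crossing edge, and
fixes the other labels. -/
structure IsBranchMate (G : SimpleGraph V) (v : V) (lab mate : V → V) : Prop where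
  of_crossing : ∀ x y, G.Crossing v lab x y →
    ∃ x' y', G.Crossing v lab x' y' ∧ lab x' = lab x ∧ mate (lab x) = lab y'
  eq_or : ∀ c, mate c = c ∨ ∃ x y, G.Crossing v lab x y ∧ lab x = c ∧ mate c = lab y

/-- Keys `key u` on the points of `U` such that no key is taken more than `h` times and such that,
for each point `z`, some vertex lies in all the segments between points of `U` whose keys span a
short arc through the key of `z`. -/
structure IsPairingKey (G : SimpleGraph V) (U : Finset V) (h : ℕ) (key : V → ℕ) (L : ℕ) :
    Prop where
  card_le : ∀ r, (U.filter fun u => key u = r).card ≤ h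
  sound : ∀ z ∈ U, ∃ x, ∀ u ∈ U, ∀ w ∈ U, key u < key w → OnShortArc L (key u) (key w) (key z) →
    x ∈ G.geodeticSegment u w

theorem IsBranchLabel.mem_subtree {D : V → V → ℕ} {v : V} {lab : V → V}
    (hl : IsBranchLabel D v lab) {x : V} (hx : x ≠ v) :
    x ∈ IsTreeMetricOn.subtree D v (lab x) := by
  have := hl.child x hx
  rw [IsTreeMetricOn.mem_subtree]
  omega

theorem Crossing.symm {v : V} {lab : V → V} {x y : V} (h : G.Crossing v lab x y) :
    G.Crossing v lab y x := ⟨h.1.symm, h.2.2.1, h.2.1, h.2.2.2.symm⟩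

namespace IsTreeMetricOn

variable {D : V → V → ℕ} {v : V} {lab mate : V → V}

theorem adj_of_dist_eq_one (hD : G.IsTreeMetricOn Set.univ D) {x y : V} (h : D x y = 1) :
    G.Adj x y := by
  obtain ⟨w, h1, h2, h3⟩ := hD.exists_step (x := x) (y := y)
    (by rintro rfl; rw [hD.dist_self] at h; omega)
  rwa [← hD.eq_of_dist_eq_zero (x := w) (y := y) (by omega)]

theorem label_ne_root (hD : G.IsTreeMetricOn Set.univ D) (hl : IsBranchLabel D v lab) {x : V}
    (hx : x ≠ v) : lab x ≠ v := by
  intro h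
  have := (hl.child x hx).1
  rw [h, hD.dist_self] at this
  omega

theorem label_eq_of_mem (hD : G.IsTreeMetricOn Set.univ D) (hl : IsBranchLabel D v lab) {x c : V}
    (hc : D v c = 1) (hx : x ∈ subtree D v c) : lab x = c := by
  have hxv : x ≠ v := by
    rintro rfl
    exact hD.root_notMem_subtree (by rintro rfl; rw [hD.dist_self] at hc; omega) hx
  exact hD.ancestor_unique (hl.mem_subtree hxv) hx (by rw [hc, (hl.child x hxv).1])

theorem label_eq_label (hD : G.IsTreeMetricOn Set.univ D) (hl : IsBranchLabel D v lab) {x c : V}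
    (hc : c ≠ v) (hx : x ∈ subtree D v c) : lab x = lab c :=
  hD.label_eq_of_mem hl (hl.child c hc).1 (hD.mem_subtree_trans (hl.mem_subtree hc) hx)

/-- If `v` minimizes the total distance to the points of `U`, then no branch at `v` holds more than
half of them: otherwise the root of that branch would be better. -/
theorem card_branch_le (hD : G.IsTreeMetricOn Set.univ D) (hl : IsBranchLabel D v lab)
    [DecidableEq V] {U : Finset V} {h : ℕ} (hh : 1 ≤ h) (hU : U.card = 2 * h)
    (hmin : ∀ c, ∑ u ∈ U, D v u ≤ ∑ u ∈ U, D c u) (c : V) :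
    (U.filter fun u => lab u = c).card ≤ h := by
  by_cases hcv : c = v
  · refine le_trans (Finset.card_le_one.2 fun a ha b hb => ?_) hh
    rw [Finset.mem_filter] at ha hb
    have : ∀ x, lab x = c → x = v := fun x hx => by
      by_contra hne
      exact hD.label_ne_root hl hne (hx.trans hcv)
    rw [this a ha.2, this b hb.2]
  by_cases hc : D v c = 1
  · have hsum : ∑ u ∈ U, (D c u + if lab u = c then 1 else 0) ≤
        ∑ u ∈ U, (D v u + if lab u = c then 0 else 1) := by
      refine Finset.sum_le_sum fun u _ => ?_
      split_ifs with hu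
      · have := (hl.child u (by rintro rfl; exact hcv (hu.symm.trans hl.root))).2
        rw [hu] at this
        omega
      · have := hD.dist_edge hc u
        omega
    rw [Finset.sum_add_distrib, Finset.sum_add_distrib, ← Finset.card_filter,
      Finset.sum_ite, Finset.sum_const_zero, zero_add, ← Finset.card_eq_sum_ones] at hsum
    have h1 := hmin c
    have h2 := Finset.card_filter_add_card_filter_not (s := U) (fun u => lab u = c)
    omega
  · rw [Finset.card_eq_zero.2]
    · omega
    · refine Finset.filter_eq_empty_iff.2 fun u _ hu => hc ?_
      rw [← hu]
      exact (hl.child u (by rintro rfl; exact hcv (hu.symm.trans hl.root))).1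

/-- A branch at `v` has at most one crossing edge: with the edge to `v` it is the second one to
leave the branch. -/
theorem crossing_unique (hD : G.IsTreeMetricOn Set.univ D) (hl : IsBranchLabel D v lab)
    (hG : G.IsCactus) {x y x' y' : V} (h : G.Crossing v lab x y) (h' : G.Crossing v lab x' y')
    (he : lab x = lab x') : x = x' ∧ y = y' := by
  have h1 := (hl.child x h.2.1).1
  have hadj := (hD.adj_of_dist_eq_one h1).symm
  have := hD.leaving_edge hG (v := v) hadj (by rw [h1, hD.dist_self])
    (hl.mem_subtree h.2.1)
    (fun hy => h.2.2.2 (hD.label_eq_of_mem hl h1 hy).symm) h.1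
    (he ▸ hl.mem_subtree h'.2.1)
    (fun hy => h'.2.2.2 (he ▸ (hD.label_eq_of_mem hl h1 hy).symm)) h'.1
    (fun hh => h'.2.2.1 hh.2.symm)
  rcases this with hh | hh
  · exact absurd hh.2 h.2.2.1
  · exact hh

theorem mate_eq (hD : G.IsTreeMetricOn Set.univ D) (hl : IsBranchLabel D v lab)
    (hm : IsBranchMate G v lab mate) (hG : G.IsCactus) {x y : V} (h : G.Crossing v lab x y) :
    mate (lab x) = lab y := by
  obtain ⟨x', y', h', e1, e2⟩ := hm.of_crossing x y h
  rw [e2, (hD.crossing_unique hl hG h h' e1.symm).2]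

/-- If no two branches at `v` joined by an edge together hold more than half of the points, then
neither does a component of `G - v`, and `v` lies in every segment between two components. The key
numbers the components, so the arc test may be passed or failed arbitrarily and `L` is free. -/
theorem isPairingKey_of_light (hD : G.IsTreeMetricOn Set.univ D) (hl : IsBranchLabel D v lab)
    (hm : IsBranchMate G v lab mate) (hG : G.IsCactus) [DecidableEq V] {U : Finset V} {h : ℕ}
    (hbranch : ∀ c, (U.filter fun u => lab u = c).card ≤ h)
    (hlight : ∀ x y, G.Crossing v lab x y →
      (U.filter fun u => lab u = lab x).card + (U.filter fun u => lab u = lab y).card ≤ h)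
    {e : V → ℕ} (he : Function.Injective e) {key : V → ℕ}
    (hkey : ∀ u, key u = min (e (lab u)) (e (mate (lab u)))) (L : ℕ) :
    IsPairingKey G U h key L := by
  -- `mate` is an involution, and its orbits are the components of `G - v`
  have hinv : ∀ c c', mate c = c' → c ≠ c' → mate c' = c ∧ ∃ x y, G.Crossing v lab x y ∧
      lab x = c ∧ lab y = c' := by
    intro c c' hc hne
    rcases hm.eq_or c with h1 | ⟨x, y, hxy, h1, h2⟩
    · exact absurd (h1.symm.trans hc) hne
    · obtain rfl : lab y = c' := by rw [← h2, hc]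
      exact ⟨by rw [hD.mate_eq hl hm hG hxy.symm, h1], x, y, hxy, h1, rfl⟩
  constructor
  · intro r
    rcases (U.filter fun u => key u = r).eq_empty_or_nonempty with hemp | ⟨u₀, hu₀⟩
    · rw [hemp]; simp
    · rw [Finset.mem_filter, hkey] at hu₀
      obtain ⟨c, hc⟩ : ∃ c, e c = r := by
        rcases min_choice (e (lab u₀)) (e (mate (lab u₀))) with hh | hh
        · exact ⟨_, hh.symm.trans hu₀.2⟩
        · exact ⟨_, hh.symm.trans hu₀.2⟩
      have hsub : (U.filter fun u => key u = r) ⊆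
          (U.filter fun u => lab u = c) ∪ (U.filter fun u => lab u = mate c) := by
        intro u hu
        rw [Finset.mem_filter, hkey] at hu
        simp only [Finset.mem_union, Finset.mem_filter, hu.1, true_and]
        rcases min_choice (e (lab u)) (e (mate (lab u))) with hh | hh
        · exact Or.inl (he (by rw [hc, ← hu.2, hh]))
        · have h1 : mate (lab u) = c := he (by rw [hc, ← hu.2, hh])
          by_cases h2 : lab u = c
          · exact Or.inl h2
          · exact Or.inr (hinv _ _ h1 h2).1.symm
      refine (Finset.card_le_card hsub).trans ?_
      by_cases hcc : mate c = c
      · rw [hcc, Finset.union_self]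
        exact hbranch c
      · obtain ⟨-, x, y, hxy, h1, h2⟩ := hinv c (mate c) rfl (Ne.symm hcc)
        have := hlight x y hxy
        rw [h1, h2] at this
        exact (Finset.card_union_le _ _).trans this
  · refine fun z _ => ⟨v, fun u _ w _ hlt _ => ?_⟩
    -- the key is constant on walks that avoid `v`
    have hadj : ∀ x y, G.Adj x y → x ≠ v → y ≠ v → key x = key y := by
      intro x y hxy hx hy
      rw [hkey, hkey]
      by_cases hlab : lab x = lab y
      · rw [hlab]
      · have hc : G.Crossing v lab x y := ⟨hxy, hx, hy, hlab⟩
        rw [hD.mate_eq hl hm hG hc, hD.mate_eq hl hm hG hc.symm, min_comm]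
    have hwalk : ∀ (x y : V) (p : G.Walk x y), v ∉ p.support → key x = key y := by
      intro x y p
      induction p with
      | nil => exact fun _ => rfl
      | cons hxy p ih =>
        intro hv
        rw [Walk.support_cons, List.mem_cons, not_or] at hv
        rw [← ih hv.2]
        exact hadj _ _ hxy (Ne.symm hv.1) fun h => hv.2 (h ▸ p.start_mem_support)
    obtain ⟨p, hp⟩ := hG.connected.exists_walk_length_eq_dist u w
    refine ⟨p, hp, ?_⟩
    by_contra hv
    exact hlt.ne (hwalk u w p hv)

end IsTreeMetricOn

/-! ### Positions on a heavy cycle -/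

namespace IsTreeMetricOn

variable {D : V → V → ℕ} {v : V} {lab : V → V}

/-- The last common ancestor `c` of `x` and `a`; its depth is the Gromov product of `x` and `a`. -/
theorem exists_last_common_ancestor (hD : G.IsTreeMetricOn Set.univ D) (v a x : V) :
    ∃ c, a ∈ subtree D v c ∧ x ∈ subtree D v c ∧ D v x + D v a = D x a + 2 * D v c := by
  induction hn : D x v generalizing x with
  | zero =>
    rw [hD.eq_of_dist_eq_zero hn]
    exact ⟨v, by simp [mem_subtree, hD.dist_self], hD.subtree_self v v, by simp [hD.dist_self]⟩
  | succ n ih =>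
    obtain ⟨w, -, h1, h2⟩ := hD.exists_step (x := x) (y := v)
      (by rintro rfl; rw [hD.dist_self] at hn; omega)
    rw [hD.dist_comm x v, hD.dist_comm w v] at h2
    rcases hD.dist_edge h1 a with h3 | h3
    · have h4 := hD.dist_concat h1 h2 (a := a)
        (by rw [hD.dist_comm a w, hD.dist_comm a x]; exact h3)
      refine ⟨x, ?_, hD.subtree_self v x, ?_⟩
      · rw [mem_subtree]; omega
      · omega
    · obtain ⟨c, hc1, hc2, hc3⟩ := ih w (by rw [hD.dist_comm w v]; rw [hD.dist_comm x v] at hn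
                                            omega)
      exact ⟨c, hc1, hD.mem_subtree_of_step hc2 h1 h2, by omega⟩

/-- An edge inside the branch of `a` between vertices which leave the path from `v` to `a` at
different places `c` and `c'` is an edge of that path. The crossing edge `a b` and the parent edge
of `c` are the only ones that leave the subtree of `c`. -/
theorem edge_on_path (hD : G.IsTreeMetricOn Set.univ D) (hl : IsBranchLabel D v lab)
    (hG : G.IsCactus) {a b x y c c' : V} (hab : G.Crossing v lab a b) (hxy : G.Adj y x)
    (hxa : lab x = lab a) (hca : a ∈ subtree D v c) (hcy : y ∈ subtree D v c)
    (hca' : a ∈ subtree D v c') (hx : D v x + D v a = D x a + 2 * D v c')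
    (hlt : D v c' < D v c) : y = c ∧ x = c' ∧ D v c = D v c' + 1 := by
  have hcv : c ≠ v := by rintro rfl; rw [hD.dist_self] at hlt; omega
  obtain ⟨p, hcp, hp1, hp2⟩ := hD.exists_step hcv
  rw [hD.dist_comm c v, hD.dist_comm p v] at hp2
  have hac : lab a = lab c := hD.label_eq_label hl hcv hca
  have hxc : x ∉ subtree D v c := by
    intro h
    have := hD.dist_triangle x c a
    rw [hD.dist_comm x c] at this
    rw [mem_subtree] at h hca
    omega
  have hbc : b ∉ subtree D v c := fun h =>
    hab.2.2.2 (hac.trans (hD.label_eq_label hl hcv h).symm)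
  have hcp' : c ∈ subtree D v p := hD.mem_subtree_of_step (hD.subtree_self v p) hp1 hp2
  have hap : a ∈ subtree D v p := hD.mem_subtree_trans hcp' hca
  have hcab : ¬ (c = a ∧ p = b) := fun h =>
    hab.2.2.2 (hD.label_eq_label hl hab.2.2.1 (by rw [← h.2]; exact hap))
  rcases hD.leaving_edge hG hcp hp2 hcy hxc hxy hca hbc hab.1 hcab with
    ⟨rfl, rfl⟩ | ⟨rfl, rfl⟩
  · have hxc' : D v x = D v c' := by
      rw [mem_subtree] at hap
      omega
    exact ⟨rfl, hD.ancestor_unique hap hca' hxc', by omega⟩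
  · exact absurd hxa.symm hab.2.2.2

/-- The crossing edge `a b` and the edge to the root are the only ones that leave the branch
of `a`. -/
theorem edge_leaving_branch (hD : G.IsTreeMetricOn Set.univ D) (hl : IsBranchLabel D v lab)
    (hG : G.IsCactus) {a b x y : V} (hab : G.Crossing v lab a b) (hxy : G.Adj x y)
    (hxa : lab x = lab a) (hya : lab y ≠ lab a) :
    (x = lab a ∧ y = v) ∨ (x = a ∧ y = b) := by
  have hxv : x ≠ v := by
    rintro rfl
    rw [hl.root] at hxa
    exact hD.label_ne_root hl hab.2.1 hxa.symm
  by_cases hyv : y = v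
  · subst hyv
    have h1 := (hl.child a hab.2.1).1
    have hadj := (hD.adj_of_dist_eq_one h1).symm
    rcases hD.leaving_edge hG (v := y) hadj (by rw [h1, hD.dist_self])
      (hxa ▸ hl.mem_subtree hxv)
      (hD.root_notMem_subtree hadj.ne) hxy (hl.mem_subtree hab.2.1)
      (fun hb => hab.2.2.2 (hD.label_eq_of_mem hl h1 hb).symm) hab.1
      (fun h => hab.2.2.1 h.2.symm) with h | h
    · exact Or.inl h
    · exact Or.inr h
  · have hc : G.Crossing v lab x y := ⟨hxy, hxv, hyv, fun h => hya (h ▸ hxa)⟩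
    exact Or.inr (hD.crossing_unique hl hG hc hab hxa)

/-- If two branches at `v` joined by an edge `a b` together hold more than half of the points, the
position on the cycle formed by `a b` and the tree paths from `v` to `a` and `b` is a pairing key.
Positions are doubled: a vertex in the branch of `a` has as key twice its Gromov product with `a`,
and symmetrically, counted from the other end, for `b`. -/
theorem isPairingKey_of_heavy (hD : G.IsTreeMetricOn Set.univ D) (hl : IsBranchLabel D v lab)
    (hG : G.IsCactus) [DecidableEq V] {U : Finset V} {h : ℕ} (hU : U.card = 2 * h)
    (hbranch : ∀ c, (U.filter fun u => lab u = c).card ≤ h) {a b : V}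
    (hab : G.Crossing v lab a b)
    (hheavy : h < (U.filter fun u => lab u = lab a).card + (U.filter fun u => lab u = lab b).card)
    {L : ℕ} (hL : L = 2 * (D v a + D v b + 1)) {key : V → ℕ}
    (hkey : ∀ u, key u = if lab u = lab a then D v u + D v a - D u a
      else if lab u = lab b then L - (D v u + D v b - D u b) else 0) :
    IsPairingKey G U h key L := by
  -- where a vertex leaves the path from `v` to the end `a` of its branch
  have hbr : ∀ a, a ≠ v → ∀ x, lab x = lab a →
      ∃ c, a ∈ subtree D v c ∧ x ∈ subtree D v c ∧ D v x + D v a = D x a + 2 * D v c ∧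
        1 ≤ D v c ∧ D v c ≤ D v a := by
    intro a ha x hx
    obtain ⟨c, h1, h2, h3⟩ := hD.exists_last_common_ancestor v a x
    have hxv : x ≠ v := by
      rintro rfl
      exact hD.label_ne_root hl ha (hx.symm.trans hl.root)
    have h4 := (hl.child x hxv).2
    have h5 := (hl.child a ha).2
    have h6 := hD.dist_triangle x (lab a) a
    rw [hD.dist_comm x (lab a)] at h6
    rw [hx] at h4
    exact ⟨c, h1, h2, h3, by omega, by rw [mem_subtree] at h1; omega⟩
  -- the path from `v` to `a`, vertex by vertex
  have hanc : ∀ a, ∃ A : ℕ → V, ∀ i ≤ D v a, D v (A i) = i ∧ a ∈ subtree D v (A i) := by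
    intro a
    have : ∀ i, ∃ c, i ≤ D v a → D v c = i ∧ a ∈ subtree D v c := by
      intro i
      by_cases hi : i ≤ D v a
      · obtain ⟨c, hc⟩ := hD.exists_ancestor v a hi
        exact ⟨c, fun _ => hc⟩
      · exact ⟨a, fun h => absurd h hi⟩
    choose A hA using this
    exact ⟨A, hA⟩
  obtain ⟨A, hA⟩ := hanc a
  obtain ⟨B, hB⟩ := hanc b
  have hA0 : A 0 = v := (hD.eq_of_dist_eq_zero (hA 0 (Nat.zero_le _)).1).symm
  have hAtop : A (D v a) = a :=
    hD.ancestor_unique (hA _ le_rfl).2 (hD.subtree_self v a) (hA _ le_rfl).1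
  have hBtop : B (D v b) = b :=
    hD.ancestor_unique (hB _ le_rfl).2 (hD.subtree_self v b) (hB _ le_rfl).1
  have hva : D v a ≠ 0 := fun h => hab.2.1 (hD.eq_of_dist_eq_zero h).symm
  have hvb : D v b ≠ 0 := fun h => hab.2.2.1 (hD.eq_of_dist_eq_zero h).symm
  have hAadj : ∀ (a : V) (A : ℕ → V), (∀ i ≤ D v a, D v (A i) = i ∧ a ∈ subtree D v (A i)) →
      ∀ i, i + 1 ≤ D v a → G.Adj (A i) (A (i + 1)) := by
    intro a A hA i hi
    obtain ⟨h1, h2⟩ := hA (i + 1) hi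
    obtain ⟨p, hp, hp1, hp2⟩ := hD.exists_step (x := A (i + 1)) (y := v)
      (by intro h; rw [h, hD.dist_self] at h1; omega)
    rw [hD.dist_comm _ v, hD.dist_comm p v] at hp2
    have hpa := hD.mem_subtree_trans (hD.mem_subtree_of_step (hD.subtree_self v p) hp1 hp2) h2
    rw [← hD.ancestor_unique hpa (hA i (by omega)).2 (by rw [(hA i (by omega)).1]; omega)]
    exact hp.symm
  set M := D v a + D v b + 1 with hM
  -- the cycle, up from `v` to `a` and down from `b` to `v`, and the projection onto it
  obtain ⟨c, hc⟩ : ∃ c : ℕ → V, ∀ i, c i = if i ≤ D v a then A i else B (M - i) := ⟨_, fun _ => rfl⟩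
  obtain ⟨π, hπ⟩ : ∃ π : V → ℕ, ∀ x, π x = key x / 2 := ⟨_, fun _ => rfl⟩
  -- the branch of `a`, the branch of `b`, and all other vertices, which project to `v`
  have hπa : ∀ x, lab x = lab a → ∃ i, key x = 2 * i ∧ π x = i ∧ 1 ≤ i ∧ i ≤ D v a ∧ c i = A i ∧
      x ∈ subtree D v (A i) ∧ D v x + D v a = D x a + 2 * D v (A i) := by
    intro x hx
    obtain ⟨z, h1, h2, h3, h4, h5⟩ := hbr a hab.2.1 x hx
    have hz := hD.ancestor_unique h1 (hA _ h5).2 (hA _ h5).1.symm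
    have hk := hkey x
    have := hπ x
    rw [if_pos hx] at hk
    exact ⟨_, by omega, by omega, h4, h5, by rw [hc, if_pos h5], by rw [← hz]; exact h2,
      by rw [(hA _ h5).1]; exact h3⟩
  have hπb : ∀ x, lab x = lab b → ∃ i, key x = 2 * (M - i) ∧ π x = M - i ∧ 1 ≤ i ∧ i ≤ D v b ∧
      c (M - i) = B i ∧ x ∈ subtree D v (B i) ∧ D v x + D v b = D x b + 2 * D v (B i) := by
    intro x hx
    obtain ⟨z, h1, h2, h3, h4, h5⟩ := hbr b hab.2.2.1 x hx
    have hz := hD.ancestor_unique h1 (hB _ h5).2 (hB _ h5).1.symm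
    have hk := hkey x
    have := hπ x
    rw [if_neg (by rw [hx]; exact hab.2.2.2.symm), if_pos hx] at hk
    exact ⟨_, by omega, by omega, h4, h5,
      by rw [hc, if_neg (by omega), Nat.sub_sub_self (by omega)], by rw [← hz]; exact h2,
      by rw [(hB _ h5).1]; exact h3⟩
  have hπ0 : ∀ x, lab x ≠ lab a → lab x ≠ lab b → key x = 0 ∧ π x = 0 := by
    intro x hxa hxb
    have hk := hkey x
    have := hπ x
    rw [if_neg hxa, if_neg hxb] at hk
    omega
  have hc0 : c 0 = v := by rw [hc, if_pos (Nat.zero_le _), hA0]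
  have hv0 : π v = 0 := (hπ0 v (by rw [hl.root]; exact (hD.label_ne_root hl hab.2.1).symm)
    (by rw [hl.root]; exact (hD.label_ne_root hl hab.2.2.1).symm)).2
  have hkey2 : ∀ x, key x = 2 * π x := by
    intro x
    by_cases hxa : lab x = lab a
    · obtain ⟨i, h1, h2, -⟩ := hπa x hxa; omega
    by_cases hxb : lab x = lab b
    · obtain ⟨i, h1, h2, -⟩ := hπb x hxb; omega
    have := hπ0 x hxa hxb
    omega
  have hlt : ∀ x, π x < M := by
    intro x
    by_cases hxa : lab x = lab a
    · obtain ⟨i, h1, h2, h3, h4, -⟩ := hπa x hxa; omega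
    by_cases hxb : lab x = lab b
    · obtain ⟨i, h1, h2, h3, h4, -⟩ := hπb x hxb; omega
    have := hπ0 x hxa hxb
    omega
  -- edges inside one of the two branches, the foot of `y` being farther from `v` than that of `x`
  have inner_a : ∀ x y, G.Adj y x → lab x = lab a → lab y = lab a → π x < π y →
      x = c (π x) ∧ y = c (π y) ∧ π y = π x + 1 := by
    intro x y hyx hx hy hlt
    obtain ⟨i, -, i1, i2, i3, i4, i5, i6⟩ := hπa x hx
    obtain ⟨j, -, j1, j2, j3, j4, j5, j6⟩ := hπa y hy
    have ei := (hA i i3).1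
    have ej := (hA j j3).1
    obtain ⟨h1, h2, h3⟩ := hD.edge_on_path hl hG hab hyx hx (hA j j3).2 j5 (hA i i3).2 i6
      (by omega)
    exact ⟨by rw [i1, i4, h2], by rw [j1, j4, h1], by omega⟩
  have inner_b : ∀ x y, G.Adj y x → lab x = lab b → lab y = lab b → π y < π x →
      x = c (π x) ∧ y = c (π y) ∧ π x = π y + 1 := by
    intro x y hyx hx hy hlt
    obtain ⟨i, -, i1, i2, i3, i4, i5, i6⟩ := hπb x hx
    obtain ⟨j, -, j1, j2, j3, j4, j5, j6⟩ := hπb y hy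
    have ei := (hB i i3).1
    have ej := (hB j j3).1
    obtain ⟨h1, h2, h3⟩ := hD.edge_on_path hl hG hab.symm hyx hx (hB j j3).2 j5 (hB i i3).2 i6
      (by omega)
    exact ⟨by rw [i1, i4, h2], by rw [j1, j4, h1], by omega⟩
  have ea : π a = D v a ∧ c (D v a) = a := by
    obtain ⟨i, -, i1, i2, i3, i4, i5, i6⟩ := hπa a rfl
    rw [(hA i i3).1, hD.dist_self] at i6
    exact ⟨by omega, by rw [hc, if_pos le_rfl, hAtop]⟩
  have eb : π b = D v a + 1 ∧ c (D v a + 1) = b := by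
    obtain ⟨i, -, i1, i2, i3, i4, i5, i6⟩ := hπb b rfl
    rw [(hB i i3).1, hD.dist_self] at i6
    refine ⟨by omega, ?_⟩
    rw [hc, if_neg (by omega), show M - (D v a + 1) = D v b by omega, hBtop]
  have ela : π (lab a) = 1 ∧ c 1 = lab a := by
    have h1 := (hl.child a hab.2.1).1
    have h2 := hD.label_eq_of_mem hl h1 (hD.subtree_self v (lab a))
    obtain ⟨i, -, i1, i2, i3, i4, i5, i6⟩ := hπa (lab a) h2
    rw [mem_subtree, (hA i i3).1] at i5
    refine ⟨by omega, ?_⟩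
    rw [hc, if_pos (by omega)]
    exact hD.ancestor_unique (hA 1 (by omega)).2 (hl.mem_subtree hab.2.1)
      (by rw [h1, (hA 1 (by omega)).1])
  have elb : π (lab b) = M - 1 ∧ c (M - 1) = lab b := by
    have h1 := (hl.child b hab.2.2.1).1
    have h2 := hD.label_eq_of_mem hl h1 (hD.subtree_self v (lab b))
    obtain ⟨i, -, i1, i2, i3, i4, i5, i6⟩ := hπb (lab b) h2
    rw [mem_subtree, (hB i i3).1] at i5
    refine ⟨by omega, ?_⟩
    rw [hc, if_neg (by omega), show M - (M - 1) = 1 by omega]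
    exact hD.ancestor_unique (hB 1 (by omega)).2 (hl.mem_subtree hab.2.2.1)
      (by rw [h1, (hB 1 (by omega)).1])
  -- the edges of `G` that do not run inside a branch of the cycle are those of the cycle
  have hproj : G.IsCycleProjection M c π := by
    refine ⟨hlt, fun i hi => ?_, ?_, ?_⟩
    · rw [hc, hc]
      by_cases h1 : i + 1 ≤ D v a
      · rw [if_pos h1, if_pos (by omega)]
        exact hAadj a A hA i h1
      · by_cases h2 : i ≤ D v a
        · obtain rfl : i = D v a := by omega
          rw [if_pos le_rfl, if_neg h1, hAtop, show M - (D v a + 1) = D v b by omega, hBtop]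
          exact hab.1
        · rw [if_neg h1, if_neg h2, show M - i = M - (i + 1) + 1 by omega]
          exact (hAadj b B hB _ (by omega)).symm
    · rw [elb.2, hc0]
      exact (hD.adj_of_dist_eq_one (hl.child b hab.2.2.1).1).symm
    · have out_a : ∀ x y, G.Adj x y → lab x = lab a → lab y ≠ lab a →
          x = c (π x) ∧ y = c (π y) ∧ (π x = π y + 1 ∨ π y = π x + 1) := by
        intro x y hxy hx hy
        rcases hD.edge_leaving_branch hl hG hab hxy hx hy with ⟨rfl, rfl⟩ | ⟨rfl, rfl⟩
        · rw [ela.1, ela.2, hv0, hc0]; simp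
        · rw [ea.1, ea.2, eb.1, eb.2]; simp
      have out_b : ∀ x y, G.Adj x y → lab x = lab b → lab y ≠ lab b → lab y ≠ lab a →
          x = c (π x) ∧ y = c (π y) ∧ π x = M - 1 ∧ π y = 0 := by
        intro x y hxy hx hy hy'
        rcases hD.edge_leaving_branch hl hG hab.symm hxy hx hy with ⟨rfl, rfl⟩ | ⟨rfl, rfl⟩
        · rw [elb.1, elb.2, hv0, hc0]; simp
        · exact absurd rfl hy'
      intro x y hxy
      by_cases hne : π x = π y
      · exact Or.inl hne
      right
      by_cases hxa : lab x = lab a <;> by_cases hya : lab y = lab a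
      · rcases lt_or_gt_of_ne hne with h | h
        · obtain ⟨h1, h2, h3⟩ := inner_a x y hxy.symm hxa hya h
          exact ⟨h1, h2, Or.inl h3⟩
        · obtain ⟨h1, h2, h3⟩ := inner_a y x hxy hya hxa h
          exact ⟨h2, h1, Or.inr (Or.inl h3)⟩
      · obtain ⟨h1, h2, h3⟩ := out_a x y hxy hxa hya
        exact ⟨h1, h2, by omega⟩
      · obtain ⟨h1, h2, h3⟩ := out_a y x hxy.symm hya hxa
        exact ⟨h2, h1, by omega⟩
      by_cases hxb : lab x = lab b <;> by_cases hyb : lab y = lab b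
      · rcases lt_or_gt_of_ne hne with h | h
        · obtain ⟨h1, h2, h3⟩ := inner_b y x hxy hyb hxb h
          exact ⟨h2, h1, Or.inl h3⟩
        · obtain ⟨h1, h2, h3⟩ := inner_b x y hxy.symm hxb hyb h
          exact ⟨h1, h2, Or.inr (Or.inl h3)⟩
      · obtain ⟨h1, h2, h3⟩ := out_b x y hxy hxb hyb hya
        exact ⟨h1, h2, by omega⟩
      · obtain ⟨h1, h2, h3⟩ := out_b y x hxy.symm hyb hxb hxa
        exact ⟨h2, h1, by omega⟩
      · exact absurd ((hπ0 x hxa hxb).2.trans (hπ0 y hya hyb).2.symm) hne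
  -- key `0` is left to the points outside two branches with more than half of the points; any
  -- other key occurs in one branch only
  constructor
  · intro r
    by_cases hr : r = 0
    · have hdisj : Disjoint (U.filter fun u => lab u = lab a) (U.filter fun u => lab u = lab b) :=
        Finset.disjoint_filter.2 fun u _ h1 h2 => hab.2.2.2 (h1.symm.trans h2)
      have hsub : (U.filter fun u => key u = r) ⊆
          U \ ((U.filter fun u => lab u = lab a) ∪ (U.filter fun u => lab u = lab b)) := by
        intro u hu
        rw [Finset.mem_filter] at hu
        simp only [Finset.mem_sdiff, Finset.mem_union, Finset.mem_filter, hu.1, true_and]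
        rintro (hx | hx)
        · obtain ⟨i, h1, h2, h3, -⟩ := hπa u hx; omega
        · obtain ⟨i, h1, h2, h3, h4, -⟩ := hπb u hx; omega
      have h1 := Finset.card_le_card hsub
      rw [Finset.card_sdiff_of_subset (Finset.union_subset (Finset.filter_subset _ _)
        (Finset.filter_subset _ _)), Finset.card_union_of_disjoint hdisj] at h1
      omega
    · by_cases hr' : r ≤ 2 * D v a
      · refine (Finset.card_le_card fun u hu => ?_).trans (hbranch (lab a))
        rw [Finset.mem_filter] at hu ⊢
        refine ⟨hu.1, ?_⟩
        by_contra hxa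
        by_cases hxb : lab u = lab b
        · obtain ⟨i, h1, h2, h3, h4, -⟩ := hπb u hxb; omega
        · have := hπ0 u hxa hxb; omega
      · refine (Finset.card_le_card fun u hu => ?_).trans (hbranch (lab b))
        rw [Finset.mem_filter] at hu ⊢
        refine ⟨hu.1, ?_⟩
        by_contra hxb
        by_cases hxa : lab u = lab a
        · obtain ⟨i, h1, h2, h3, h4, -⟩ := hπa u hxa; omega
        · have := hπ0 u hxa hxb; omega
  · intro z _
    refine ⟨c (π z), fun u _ w _ huw harc => ?_⟩
    have e1 := hkey2 u
    have e2 := hkey2 w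
    have e3 := hkey2 z
    refine hproj.mem_geodeticSegment hG.connected (hlt z) (by omega) ?_
    unfold OnShortArc at harc ⊢
    omega

end IsTreeMetricOn

/-! ### From pairing keys to a partition -/

/-- `P 0, …, P (N - 1)` are distinct points of `U` in the order of their keys. -/
structure IsSortedEnum (U : Finset V) (key : V → ℕ) (N : ℕ) (P : ℕ → V) : Prop where
  mem : ∀ i < N, P i ∈ U
  inj : ∀ i < N, ∀ j < N, P i = P j → i = j
  mono : ∀ i j, i ≤ j → j < N → key (P i) ≤ key (P j)

theorem exists_isSortedEnum (U : Finset V) (key : V → ℕ) (hU : U.Nonempty) :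
    ∃ P, IsSortedEnum U key U.card P := by
  obtain ⟨u₀, hu₀⟩ := hU
  let e : Fin U.card ≃ U := (U.equivFinOfCardEq rfl).symm
  let f : Fin U.card → ℕ := fun i => key (e i)
  refine ⟨fun i => if h : i < U.card then e (Tuple.sort f ⟨i, h⟩) else u₀, ?_, ?_, ?_⟩
  · intro i hi
    simp [hi]
  · intro i hi j hj h
    simp only [hi, hj, dif_pos] at h
    simpa using (Tuple.sort f).injective (e.injective (Subtype.ext h))
  · intro i j hij hj
    simp only [lt_of_le_of_lt hij hj, hj, dif_pos]
    exact Tuple.monotone_sort f (show (⟨i, lt_of_le_of_lt hij hj⟩ : Fin U.card) ≤ ⟨j, hj⟩ from hij)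

theorem IsSortedEnum.insert [DecidableEq V] {S : Finset V} {key : V → ℕ} {N : ℕ}
    {P : ℕ → V} (hP : IsSortedEnum S key N P) {u : V} (hu : u ∉ S)
    (hkey : ∀ w ∈ S, key w ≤ key u) :
    IsSortedEnum (insert u S) key (N + 1) (Function.update P N u) := by
  have hlt : ∀ i < N, Function.update P N u i = P i := fun i hi =>
    Function.update_of_ne hi.ne _ _
  have hN : Function.update P N u N = u := Function.update_self _ _ _
  refine ⟨fun i hi => ?_, fun i hi j hj h => ?_, fun i j hij hj => ?_⟩
  · rcases (Nat.lt_succ_iff_lt_or_eq.1 hi) with h | rfl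
    · rw [hlt i h]; exact Finset.mem_insert_of_mem (hP.mem i h)
    · rw [hN]; exact Finset.mem_insert_self _ _
  · rcases (Nat.lt_succ_iff_lt_or_eq.1 hi) with hi | rfl <;>
      rcases (Nat.lt_succ_iff_lt_or_eq.1 hj) with hj | rfl
    · rw [hlt i hi, hlt j hj] at h
      exact hP.inj i hi j hj h
    · rw [hlt i hi, hN] at h
      exact absurd (h ▸ hP.mem i hi) hu
    · rw [hlt j hj, hN] at h
      exact absurd (h ▸ hP.mem j hj) hu
    · rfl
  · rcases (Nat.lt_succ_iff_lt_or_eq.1 hj) with hj | rfl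
    · rw [hlt i (by omega), hlt j hj]
      exact hP.mono i j hij hj
    · rcases hij.lt_or_eq with hi | rfl
      · rw [hlt i hi, hN]
        exact hkey _ (hP.mem i hi)
      · rfl

/-- Opposite points in the sorted order have different keys, since no key is taken by more than
half of the points. -/
theorem IsPairingKey.key_lt {U : Finset V} {h L N : ℕ} {key : V → ℕ} {P : ℕ → V}
    (hk : G.IsPairingKey U h key L) (hP : IsSortedEnum U key N P) {i : ℕ} (hi : i + h < N) :
    key (P i) < key (P (i + h)) := by
  classical
  refine lt_of_le_of_ne (hP.mono _ _ (by omega) hi) fun heq => ?_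
  have hsub : (Finset.Icc i (i + h)).image P ⊆ U.filter fun u => key u = key (P i) := by
    intro u hu
    obtain ⟨j, hj, rfl⟩ := Finset.mem_image.1 hu
    rw [Finset.mem_Icc] at hj
    have h1 := hP.mono i j hj.1 (by omega)
    have h2 := hP.mono j (i + h) hj.2 hi
    exact Finset.mem_filter.2 ⟨hP.mem j (by omega), by omega⟩
  have hcard := (Finset.card_le_card hsub).trans (hk.card_le _)
  rw [Finset.card_image_of_injOn, Nat.card_Icc] at hcard
  · omega
  · intro a ha b hb hab
    rw [Finset.coe_Icc, Set.mem_Icc] at ha hb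
    exact hP.inj a (by omega) b (by omega) hab

/-- The segments of the pairs of opposite points passing the arc test at one position have a
common vertex. -/
theorem IsPairingKey.exists_common {U : Finset V} {k L : ℕ} {key : V → ℕ} {P : ℕ → V}
    (hk : G.IsPairingKey U (2 * k - 1) key L) (hP : IsSortedEnum U key (4 * k - 2) P) {j : ℕ}
    (hj : j < 4 * k - 2) :
    ∃ x, ∀ i < 2 * k - 1, OnShortArc L (key (P i)) (key (P (i + (2 * k - 1)))) (key (P j)) →
      x ∈ G.geodeticSegment (P i) (P (i + (2 * k - 1))) := by
  obtain ⟨x, hx⟩ := hk.sound (P j) (hP.mem j hj)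
  exact ⟨x, fun i hi => hx _ (hP.mem _ (by omega)) _ (hP.mem _ (by omega))
    (hk.key_lt hP (by omega))⟩

/-- It is enough that each label is taken by the two ends of a segment through `x`; the other points
may carry any label. -/
theorem isTverbergPartition_of_labels {U : Finset V} {k : ℕ} (lab : V → ℕ)
    (hlt : ∀ u ∈ U, lab u < k) {x : V}
    (hpair : ∀ i < k, ∃ u ∈ U, ∃ w ∈ U, lab u = i ∧ lab w = i ∧ x ∈ G.geodeticSegment u w) :
    G.IsTverbergPartition U (fun i : Fin k => U.filter fun v => lab v = i) := by
  refine ⟨fun i => ?_, fun i j hij => ?_, fun v => ?_, x, fun i => ?_⟩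
  · obtain ⟨u, hu, -, -, h, -⟩ := hpair i i.2
    exact ⟨u, Finset.mem_filter.2 ⟨hu, h⟩⟩
  · exact Finset.disjoint_filter.2 fun v _ h h' => hij (Fin.ext (h.symm.trans h'))
  · exact ⟨fun hv => ⟨⟨lab v, hlt v hv⟩, Finset.mem_filter.2 ⟨hv, rfl⟩⟩,
      fun ⟨i, hi⟩ => (Finset.mem_filter.1 hi).1⟩
  · obtain ⟨u, hu, w, hw, h1, h2, h3⟩ := hpair i i.2
    simp only [geodeticHull, Set.mem_iUnion]
    exact ⟨u, by simp [hu, h1], w, by simp [hw, h2], h3⟩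

/-- The first `k` pairs of opposite points that pass the arc test at a suitable position get
different labels, all other points the label `0`. -/
theorem IsPairingKey.exists_partition {U : Finset V} {k L : ℕ} {key : V → ℕ} (hk1 : 1 ≤ k)
    (hU : U.card = 4 * k - 2) (hk : G.IsPairingKey U (2 * k - 1) key L) :
    ∃ A : Fin k → Finset V, G.IsTverbergPartition U A := by
  classical
  obtain ⟨P, hP⟩ := exists_isSortedEnum U key (Finset.card_pos.1 (by omega))
  rw [hU] at hP
  obtain ⟨j, hj, hcard⟩ := exists_position_on_many_arcs hk1 (L := L) (t := fun i => key (P i))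
    hP.mono
  obtain ⟨x, hx⟩ := hk.exists_common hP hj
  set I := (Finset.range (2 * k - 1)).filter
    fun i => OnShortArc L (key (P i)) (key (P (i + (2 * k - 1)))) (key (P j))
  let f := I.orderEmbOfCardLe hcard
  have hf : ∀ i, f i < 2 * k - 1 ∧
      OnShortArc L (key (P (f i))) (key (P (f i + (2 * k - 1)))) (key (P j)) := by
    intro i
    have h := Finset.mem_filter.1 (I.orderEmbOfCardLe_mem hcard i)
    exact ⟨Finset.mem_range.1 h.1, h.2⟩
  let lab : V → ℕ := fun u =>
    if h : ∃ i, u = P (f i) ∨ u = P (f i + (2 * k - 1)) then (h.choose : Fin k) else 0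
  have hlab : ∀ i u, (u = P (f i) ∨ u = P (f i + (2 * k - 1))) → lab u = i := by
    intro i u hu
    have hex : ∃ i, u = P (f i) ∨ u = P (f i + (2 * k - 1)) := ⟨i, hu⟩
    have hspec := hex.choose_spec
    simp only [lab, dif_pos hex]
    congr 1
    apply f.injective
    have h1 := (hf i).1
    have h2 := (hf hex.choose).1
    rcases hu with hu | hu <;> rcases hspec with hs | hs
    all_goals
      have := hP.inj _ (by omega) _ (by omega) (hs.symm.trans hu)
      omega
  refine ⟨_, isTverbergPartition_of_labels lab (fun u _ => ?_) (x := x) fun i hi => ?_⟩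
  · simp only [lab]
    split_ifs
    · exact Fin.is_lt _
    · omega
  · have h1 := (hf ⟨i, hi⟩).1
    exact ⟨_, hP.mem (f ⟨i, hi⟩) (by omega), _, hP.mem (f ⟨i, hi⟩ + (2 * k - 1)) (by omega),
      hlab ⟨i, hi⟩ _ (Or.inl rfl), hlab ⟨i, hi⟩ _ (Or.inr rfl), hx _ h1 (hf ⟨i, hi⟩).2⟩

theorem IsTreeMetricOn.exists_isBranchLabel {D : V → V → ℕ} (hD : G.IsTreeMetricOn Set.univ D)
    (v : V) : ∃ lab, IsBranchLabel D v lab := by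
  have : ∀ x, ∃ c, (x = v → c = v) ∧ (x ≠ v → D v c = 1 ∧ D v x = D c x + 1) := by
    intro x
    by_cases hx : x = v
    · exact ⟨v, fun _ => rfl, fun h => absurd hx h⟩
    · obtain ⟨c, h1, h2⟩ := hD.exists_ancestor v x (i := 1)
        (Nat.one_le_iff_ne_zero.2 fun h => hx (hD.eq_of_dist_eq_zero h).symm)
      rw [mem_subtree] at h2
      exact ⟨c, fun h => absurd h hx, fun _ => ⟨h1, by omega⟩⟩
  choose lab hlab using this
  exact ⟨lab, (hlab v).1 rfl, fun x => (hlab x).2⟩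

theorem exists_isBranchMate (G : SimpleGraph V) (v : V) (lab : V → V) :
    ∃ mate, IsBranchMate G v lab mate := by
  have : ∀ c, ∃ d, (∀ x y, G.Crossing v lab x y → lab x = c →
      ∃ x' y', G.Crossing v lab x' y' ∧ lab x' = c ∧ d = lab y') ∧
      (d = c ∨ ∃ x y, G.Crossing v lab x y ∧ lab x = c ∧ d = lab y) := by
    intro c
    by_cases h : ∃ x y, G.Crossing v lab x y ∧ lab x = c
    · obtain ⟨x, y, h1, h2⟩ := h
      exact ⟨lab y, fun _ _ _ _ => ⟨x, y, h1, h2, rfl⟩, Or.inr ⟨x, y, h1, h2, rfl⟩⟩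
    · push Not at h
      exact ⟨c, fun x y h1 h2 => absurd h2 (h x y h1), Or.inl rfl⟩
  choose mate hmate using this
  exact ⟨mate, fun x y h => (hmate _).1 x y h rfl, fun c => (hmate c).2⟩

theorem IsCactus.exists_isTverbergPartition [Finite V] (hG : G.IsCactus) {k : ℕ} (hk : 1 ≤ k)
    {U : Finset V} (hU : U.card = 4 * k - 2) :
    ∃ A : Fin k → Finset V, G.IsTverbergPartition U A := by
  classical
  obtain ⟨D, hD⟩ := hG.connected.exists_isTreeMetricOn_univ
  have := hG.connected.nonempty
  obtain ⟨v, hv⟩ := Finite.exists_min fun c => ∑ u ∈ U, D c u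
  obtain ⟨lab, hl⟩ := hD.exists_isBranchLabel v
  obtain ⟨mate, hm⟩ := exists_isBranchMate G v lab
  have hbranch := hD.card_branch_le hl (h := 2 * k - 1) (by omega) (by omega) hv
  by_cases hlight : ∀ x y, G.Crossing v lab x y →
      (U.filter fun u => lab u = lab x).card + (U.filter fun u => lab u = lab y).card ≤ 2 * k - 1
  · obtain ⟨m, ⟨e⟩⟩ := Finite.exists_equiv_fin V
    exact (hD.isPairingKey_of_light hl hm hG hbranch hlight
      (e := fun x => (e x : ℕ)) (Fin.val_injective.comp e.injective) (fun _ => rfl)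
      0).exists_partition hk hU
  · push Not at hlight
    obtain ⟨a, b, hab, hheavy⟩ := hlight
    exact (hD.isPairingKey_of_heavy hl hG (by omega) hbranch hab hheavy rfl
      fun _ => rfl).exists_partition hk hU

end SimpleGraph

namespace RAM

/-! ### Total correctness of programs -/

/-- Total correctness with a time bound: from `m`, the program `P` halts within `T` steps in a
memory satisfying `Q`. -/
def Runs (B : ℕ) (P : Prog) (T : ℕ) (m : Mem) (Q : Mem → Prop) : Prop :=
  ∃ t m', Exec B P m t m' ∧ t ≤ T ∧ Q m'

namespace Prog

/-- Whether the program contains an assignment to register `x`. -/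
def writesReg (x : ℕ) : Prog → Bool
  | skip => false
  | assign y _ => x == y
  | store _ _ _ => false
  | seq p q => p.writesReg x || q.writesReg x
  | ite _ p q => p.writesReg x || q.writesReg x
  | loop _ p => p.writesReg x

/-- Whether the program contains a store into array `a`. -/
def writesArr (a : ℕ) : Prog → Bool
  | skip => false
  | assign _ _ => false
  | store b _ _ => a == b
  | seq p q => p.writesArr a || q.writesArr a
  | ite _ p q => p.writesArr a || q.writesArr a
  | loop _ p => p.writesArr a

/-- The weakest precondition of a loop-free program; loops get the precondition `False`. -/
def wp (B : ℕ) : Prog → (Mem → Prop) → Mem → Prop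
  | skip, Q, m => Q m
  | assign x e, Q, m => e.eval m ≤ B ∧ Q (m.setReg x (e.eval m))
  | store a i e, Q, m => i.eval m ≤ B ∧ e.eval m ≤ B ∧ Q (m.setArr a (i.eval m) (e.eval m))
  | seq p q, Q, m => p.wp B (q.wp B Q) m
  | ite g p q, Q, m => (g.eval m ≠ 0 → p.wp B Q m) ∧ (g.eval m = 0 → q.wp B Q m)
  | loop _ _, _, _ => False

/-- A bound for the running time of a loop-free program. (The value at loops is irrelevant.) -/
def time : Prog → ℕ
  | skip => 1
  | assign _ e => e.cost + 1
  | store _ i e => i.cost + e.cost + 1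
  | seq p q => p.time + q.time
  | ite g p q => g.cost + 1 + max p.time q.time
  | loop _ _ => 0

/-- `for i := lo, lo + 1, … while i < reg b do body`. -/
def forLoop (i : ℕ) (lo : Expr) (b : ℕ) (body : Prog) : Prog :=
  seq (assign i lo)
    (loop (.lt (.reg i) (.reg b)) (seq body (assign i (.add (.reg i) (.const 1)))))

end Prog

/-- The memories `m` and `m'` agree on all registers and arrays that `P` does not mention as
targets. That `P` does not mention a target is a computation, proved by `rfl` in concrete cases. -/
def Frame (P : Prog) (m m' : Mem) : Prop :=
  (∀ x, P.writesReg x = false → m'.reg x = m.reg x) ∧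
    (∀ a, P.writesArr a = false → m'.arr a = m.arr a)

@[simp] theorem Mem.reg_setReg (m : Mem) (x v y : ℕ) :
    (m.setReg x v).reg y = if y = x then v else m.reg y := by
  simp [Mem.setReg, Function.update_apply]

@[simp] theorem Mem.arr_setReg (m : Mem) (x v : ℕ) : (m.setReg x v).arr = m.arr := rfl

@[simp] theorem Mem.reg_setArr (m : Mem) (a i v : ℕ) : (m.setArr a i v).reg = m.reg := rfl

@[simp] theorem Mem.arr_setArr (m : Mem) (a i v b j : ℕ) :
    (m.setArr a i v).arr b j = if b = a then (if j = i then v else m.arr b j) else m.arr b j := by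
  simp only [Mem.setArr, Function.update_apply]
  split_ifs <;> simp_all

theorem Frame.refl (P : Prog) (m : Mem) : Frame P m m := ⟨fun _ _ => rfl, fun _ _ => rfl⟩

theorem Frame.trans {P : Prog} {m m' m'' : Mem} (h : Frame P m m') (h' : Frame P m' m'') :
    Frame P m m'' :=
  ⟨fun x hx => (h'.1 x hx).trans (h.1 x hx), fun a ha => (h'.2 a ha).trans (h.2 a ha)⟩

theorem Frame.mono {P P' : Prog} {m m' : Mem} (h : Frame P m m')
    (hr : ∀ x, P'.writesReg x = false → P.writesReg x = false)
    (ha : ∀ a, P'.writesArr a = false → P.writesArr a = false) : Frame P' m m' :=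
  ⟨fun x hx => h.1 x (hr x hx), fun a hx => h.2 a (ha a hx)⟩

theorem Exec.frame {B : ℕ} {P : Prog} {m m' : Mem} {t : ℕ} (h : Exec B P m t m') :
    Frame P m m' := by
  induction h with
  | skip => exact .refl _ _
  | assign m x e he =>
    exact ⟨fun y hy => by simp_all [Prog.writesReg], fun _ _ => rfl⟩
  | store m a i e hi he =>
    refine ⟨fun _ _ => rfl, fun b hb => ?_⟩
    funext j
    simp_all [Prog.writesArr]
  | seq _ _ ihp ihq =>
    exact (ihp.mono (fun x => by simp_all [Prog.writesReg])
      (fun x => by simp_all [Prog.writesArr])).trans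
      (ihq.mono (fun x => by simp_all [Prog.writesReg]) (fun x => by simp_all [Prog.writesArr]))
  | ite_true _ _ ih =>
    exact ih.mono (fun x => by simp_all [Prog.writesReg]) (fun x => by simp_all [Prog.writesArr])
  | ite_false _ _ ih =>
    exact ih.mono (fun x => by simp_all [Prog.writesReg]) (fun x => by simp_all [Prog.writesArr])
  | loop_true _ _ _ ihp ihl =>
    exact Frame.trans (ihp.mono (fun _ h => h) (fun _ h => h)) ihl
  | loop_false => exact .refl _ _

namespace Runs

variable {B : ℕ} {P P' : Prog} {T T' : ℕ} {m : Mem} {Q R : Mem → Prop}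

theorem mono (h : Runs B P T m R) (hT : T ≤ T') (hQ : ∀ m', R m' → Q m') : Runs B P T' m Q := by
  obtain ⟨t, m', h1, h2, h3⟩ := h
  exact ⟨t, m', h1, h2.trans hT, hQ m' h3⟩

theorem frame (h : Runs B P T m Q) : Runs B P T m fun m' => Q m' ∧ Frame P m m' := by
  obtain ⟨t, m', h1, h2, h3⟩ := h
  exact ⟨t, m', h1, h2, h3, h1.frame⟩

theorem seq (h : Runs B P T m R) (h' : ∀ m', R m' → Frame P m m' → Runs B P' T' m' Q) :
    Runs B (.seq P P') (T + T') m Q := by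
  obtain ⟨t, m', h1, h2, h3⟩ := h
  obtain ⟨t', m'', h1', h2', h3'⟩ := h' m' h3 h1.frame
  exact ⟨t + t', m'', .seq h1 h1', by omega, h3'⟩

theorem of_wp (h : P.wp B Q m) : Runs B P P.time m Q := by
  induction P generalizing m Q with
  | skip => exact ⟨_, _, .skip m, le_rfl, h⟩
  | assign x e => exact ⟨_, _, .assign m x e h.1, le_rfl, h.2⟩
  | store a i e => exact ⟨_, _, .store m a i e h.1 h.2.1, le_rfl, h.2.2⟩
  | seq p q ihp ihq => exact Runs.seq (ihp h) fun m' h' _ => ihq h'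
  | ite g p q ihp ihq =>
    by_cases hg : g.eval m = 0
    · obtain ⟨t, m', h1, h2, h3⟩ := ihq (h.2 hg)
      exact ⟨_, m', .ite_false hg h1, by simp only [Prog.time]; omega, h3⟩
    · obtain ⟨t, m', h1, h2, h3⟩ := ihp (h.1 hg)
      exact ⟨_, m', .ite_true hg h1, by simp only [Prog.time]; omega, h3⟩
  | loop g p => exact h.elim

/-- The rule for counting loops. The invariant `I j` holds before the round with counter `j`; each
round takes at most `T` steps, to which the test and the increment of the counter add `8`. -/
theorem forLoop {i b : ℕ} {lo : Expr} {body : Prog} {l : ℕ} (I : ℕ → Mem → Prop)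
    (hlo : lo.eval m = l) (hle : l ≤ m.reg b) (hB : m.reg b ≤ B)
    (h0 : I l (m.setReg i l))
    (hstep : ∀ j m', l ≤ j → j < m.reg b → m'.reg i = j → Frame (.forLoop i lo b body) m m' →
      I j m' → Runs B body T m' fun m'' => I (j + 1) (m''.setReg i (j + 1)))
    (hib : (b == i) = false := by rfl) (hb : body.writesReg b = false := by rfl)
    (hi : body.writesReg i = false := by rfl) :
    Runs B (.forLoop i lo b body) ((m.reg b - l) * (T + 8) + (lo.cost + 5)) m
      fun m' => I (m.reg b) m' := by
  have hib' : b ≠ i := by simpa using hib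
  have hF : ∀ x, (Prog.forLoop i lo b body).writesReg x = false →
      x ≠ i ∧ body.writesReg x = false := by
    intro x hx
    have : (x ≠ i ∧ body.writesReg x = false ∧ x ≠ i) := by
      simpa [Prog.forLoop, Prog.writesReg] using hx
    exact ⟨this.1, this.2.1⟩
  have hFa : ∀ x, (Prog.forLoop i lo b body).writesArr x = false →
      body.writesArr x = false := by
    intro x hx
    simpa [Prog.forLoop, Prog.writesArr] using hx
  -- `d` rounds before the end
  have key : ∀ d j m', m.reg b - j = d → l ≤ j → j ≤ m.reg b → m'.reg i = j →
      m'.reg b = m.reg b → Frame (.forLoop i lo b body) m m' → I j m' →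
      Runs B (.loop (.lt (.reg i) (.reg b)) (.seq body (.assign i (.add (.reg i) (.const 1)))))
        (d * (T + 8) + 4) m' fun m' => I (m.reg b) m' := by
    intro d
    induction d with
    | zero =>
      intro j m' hd hl hj hmi hmb _ hI
      obtain rfl : j = m.reg b := by omega
      refine ⟨_, m', .loop_false ?_, by simp [Expr.cost], hI⟩
      simp [Expr.eval, Expr.ltVal, hmi, hmb]
    | succ d ih =>
      intro j m' hd hl hj hmi hmb hfr hI
      obtain ⟨t, m₁, e1, e2, e3⟩ := (hstep j m' hl (by omega) hmi hfr hI)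
      have f1 := e1.frame
      have r1 : m₁.reg i = j := (f1.1 i hi).trans hmi
      have r2 : m₁.reg b = m.reg b := (f1.1 b hb).trans hmb
      have a1 : Exec B (.assign i (.add (.reg i) (.const 1))) m₁ 4 (m₁.setReg i (j + 1)) := by
        have := Exec.assign (B := B) m₁ i (.add (.reg i) (.const 1))
          (by simp only [Expr.eval, r1]; omega)
        simpa [Expr.eval, Expr.cost, r1] using this
      obtain ⟨t', m₂, g1, g2, g3⟩ := ih (j + 1) (m₁.setReg i (j + 1)) (by omega) (by omega)
        (by omega) (by simp) (by simp [hib', r2]) (hfr.trans ⟨fun x hx => by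
          simp [(hF x hx).1, f1.1 x (hF x hx).2], fun a ha => by simpa using f1.2 a (hFa a ha)⟩) e3
      · refine ⟨_, m₂, .loop_true ?_ (.seq e1 a1) g1, ?_, g3⟩
        · simp [Expr.eval, Expr.ltVal, hmi, hmb]; omega
        · simp only [Expr.cost]
          have : (d + 1) * (T + 8) = d * (T + 8) + (T + 8) := by ring
          omega
  have a0 : Exec B (.assign i lo) m (lo.cost + 1) (m.setReg i l) := by
    have := Exec.assign (B := B) m i lo (by omega)
    rwa [hlo] at this
  obtain ⟨t, m', e1, e2, e3⟩ := key (m.reg b - l) l (m.setReg i l) rfl le_rfl hle (by simp)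
    (by simp [hib']) ⟨fun x hx => by simp [(hF x hx).1], fun _ _ => rfl⟩ h0
  exact ⟨_, m', .seq a0 e1, by omega, e3⟩

end Runs

open RAM.Expr RAM.Prog SimpleGraph

/-! ### The adjacency matrix -/

/-- Tabulates the adjacency matrix in array 4, the entry `(x, y)` in cell `x * n + y`. The row
offsets `x * n` are kept in array 5. -/
def buildMatrix : Prog :=
  .seq (assign 2 (const 0))
    (forLoop 3 (const 0) 0
      (.seq (.seq (store 5 (.reg 3) (.reg 2)) (assign 5 (get 0 (.add (.reg 3) (const 1)))))
        (.seq (forLoop 4 (get 0 (.reg 3)) 5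
            (store 4 (.add (.reg 2) (get 1 (.reg 4))) (const 1)))
          (assign 2 (.add (.reg 2) (.reg 0))))))

theorem index_lt {n x y : ℕ} (hx : x < n) (hy : y < n) : x * n + y < n * n := by
  have : (x + 1) * n ≤ n * n := Nat.mul_le_mul_right n hx
  rw [Nat.succ_mul] at this
  omega

theorem index_eq_iff {n x y x' y' : ℕ} (hy : y < n) (hy' : y' < n) :
    x * n + y = x' * n + y' ↔ x = x' ∧ y = y' := by
  refine ⟨fun h => ?_, fun h => by rw [h.1, h.2]⟩
  have h1 : (x * n + y) / n = x := by
    rw [mul_comm, Nat.mul_add_div (by omega), Nat.div_eq_of_lt hy, add_zero]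
  have h2 : (x' * n + y') / n = x' := by
    rw [mul_comm, Nat.mul_add_div (by omega), Nat.div_eq_of_lt hy', add_zero]
  have : x = x' := by rw [← h1, h, h2]
  subst this
  exact ⟨rfl, by omega⟩

theorem IsInput.degree_le {n : ℕ} {G : SimpleGraph (Fin n)} {k : ℕ} {U : Finset (Fin n)} {m : Mem}
    (hm : IsInput G k U m) {v : ℕ} (hv : v < n) (hend : m.arr 0 (v + 1) ≤ m.arr 0 n) :
    m.arr 0 (v + 1) - m.arr 0 v ≤ n := by
  have : (Finset.Ico (m.arr 0 v) (m.arr 0 (v + 1))).card ≤ (Finset.range n).card := by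
    refine Finset.card_le_card_of_injOn (fun p => m.arr 1 p) (fun p hp => ?_)
      (fun p hp q hq h => ?_)
    · rw [Finset.coe_Ico, Set.mem_Ico] at hp
      simpa using hm.vertex p (by omega)
    · rw [Finset.coe_Ico, Set.mem_Ico] at hp hq
      exact hm.nodup v hv p q hp.1 hp.2 hq.1 hq.2 h
  simpa using this

/-- The adjacency lists end within the first `n * n` cells, so all offsets fit into a word. -/
theorem IsInput.offset_le {n : ℕ} {G : SimpleGraph (Fin n)} {k : ℕ} {U : Finset (Fin n)} {m : Mem}
    (hm : IsInput G k U m) {v : ℕ} (hv : v ≤ n) : m.arr 0 v ≤ v * n ∧ m.arr 0 v ≤ m.arr 0 n := by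
  have h1 : ∀ d v, v + d = n → m.arr 0 v ≤ m.arr 0 n := by
    intro d
    induction d with
    | zero => intro v hv; rw [show v = n by omega]
    | succ d ih => exact fun v hv => (hm.offset_mono v (by omega)).trans (ih (v + 1) (by omega))
  refine ⟨?_, h1 (n - v) v (by omega)⟩
  induction v with
  | zero => rw [hm.offset_zero]; exact Nat.zero_le _
  | succ v ih =>
    have h2 := ih (by omega)
    have h3 := hm.degree_le (v := v) (by omega) (h1 (n - (v + 1)) (v + 1) (by omega))
    rw [Nat.succ_mul]
    omega

/-- Array 4 holds the adjacency matrix (row by row, nonzero entries for edges) and array 5 the row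
offsets. -/
structure HasMatrix {n : ℕ} (G : SimpleGraph (Fin n)) (m : Mem) : Prop where
  row : ∀ x < n, m.arr 5 x = x * n
  adj : ∀ x y : Fin n, m.arr 4 (x * n + y) ≠ 0 ↔ G.Adj x y

theorem runs_buildMatrix {n : ℕ} {G : SimpleGraph (Fin n)} {k : ℕ} {U : Finset (Fin n)} {m : Mem}
    (hm : IsInput G k U m) {B : ℕ} (hB : n * n + n ≤ B) (hB1 : 1 ≤ B) :
    Runs B buildMatrix (2 + (n * (n * 14 + 30) + 6)) m fun m' =>
      HasMatrix G m' ∧ m'.reg 2 = n * n := by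
  have hreg0 := hm.reg_zero
  refine .mono (.seq (.of_wp (Q := fun m' => m' = m.setReg 2 0) ?_) (T' := n * (n * 14 + 30) + 6)
    fun m₁ h₁ _ => ?_) le_rfl fun m' h => h
  · simp [Prog.wp, Expr.eval]
  have e0 : m₁.reg 0 = n := by rw [h₁]; simpa using hreg0
  refine .mono (.forLoop (l := 0) (T := n * 14 + 22) (fun j m' => m'.reg 2 = j * n ∧
    (∀ x < j, m'.arr 5 x = x * n) ∧
    (∀ x y : Fin n, m'.arr 4 (x * n + y) ≠ 0 ↔ x < j ∧ G.Adj x y)) rfl (Nat.zero_le _)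
    (by omega) ?_ ?_) ?_ ?_
  · rw [h₁]
    simp [hm.arr_rest]
  · intro j m₂ _ hj hj2 hfr hI
    rw [e0] at hj
    have f0 : m₂.reg 0 = n := (hfr.1 0 rfl).trans e0
    have g0 : m₂.arr 0 = m.arr 0 := (hfr.2 0 rfl).trans (by rw [h₁]; rfl)
    have g1 : m₂.arr 1 = m.arr 1 := (hfr.2 1 rfl).trans (by rw [h₁]; rfl)
    have o1 := hm.offset_le (v := j) (by omega)
    have o2 := hm.offset_le (v := j + 1) (by omega)
    have o3 := hm.degree_le hj o2.2
    have o4 : (j + 1) * n ≤ n * n := Nat.mul_le_mul_right n hj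
    have o5 : (j + 1) * n = j * n + n := Nat.succ_mul j n
    have o6 := hm.offset_mono j hj
    refine .mono (.seq (.of_wp (Q := fun m' => m' = (m₂.setArr 5 j (j * n)).setReg 5
      (m.arr 0 (j + 1))) ?_) (T' := n * 14 + 14) fun m₃ h₃ _ => ?_) ?_ fun _ h => h
    · simp only [Prog.wp, Expr.eval, Mem.reg_setArr, Mem.arr_setArr, hj2, hI.1, g0]
      simp
      omega
    · refine .mono (.seq (.forLoop (T := 6) (l := m.arr 0 j) (fun p m' => m'.reg 2 = j * n ∧
        (∀ x < j + 1, m'.arr 5 x = x * n) ∧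
        (∀ x y : Fin n, m'.arr 4 (x * n + y) ≠ 0 ↔ (x < j ∧ G.Adj x y) ∨ (x.val = j ∧
          ∃ q, m.arr 0 j ≤ q ∧ q < p ∧ m.arr 1 q = y))) ?_ ?_ ?_ ?_ ?_) (T' := 4)
          fun m₄ h₄ fr₄ => ?_) ?_ fun m' h => h
      · simp [h₃, Expr.eval, hj2, g0]
      · simp [h₃, o6]
      · simp [h₃]; omega
      · refine ⟨by simp [h₃, hI.1], fun x hx => ?_, fun x y => ?_⟩
        · by_cases hxj : x = j
          · simp [h₃, hxj]
          · have := hI.2.1 x (by omega)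
            simpa [h₃, hxj] using this
        · have := hI.2.2 x y
          simp only [h₃, Mem.arr_setReg, Mem.arr_setArr]
          simp only [show (4 : ℕ) ≠ 5 by omega, if_false]
          rw [this]
          refine (or_iff_left ?_).symm
          rintro ⟨-, q, h1, h2, -⟩
          omega
      · intro p m₄ hp1 hp2 hp3 hfr₄ hI₄
        have hp2' : p < m.arr 0 (j + 1) := by simpa [h₃] using hp2
        have g1' : m₄.arr 1 = m.arr 1 := (hfr₄.2 1 rfl).trans (by
          rw [h₃]; funext z; simp [g1])
        have hv := hm.vertex p (by omega)
        have hlt := index_lt hj hv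
        refine .of_wp ?_
        simp only [Prog.wp, Expr.eval, hp3, g1', hI₄.1]
        refine ⟨by omega, hB1, by simp [hI₄.1], fun x hx => ?_, fun x y => ?_⟩
        · simpa using hI₄.2.1 x hx
        · have := hI₄.2.2 x y
          simp only [Mem.arr_setReg, Mem.arr_setArr, if_true, index_eq_iff y.2 hv]
          split_ifs with hxy
          · refine iff_of_true one_ne_zero (Or.inr ⟨hxy.1, p, hp1, by omega, hxy.2.symm⟩)
          · rw [this]
            refine or_congr_right (and_congr_right fun hx => ⟨?_, ?_⟩)
            · rintro ⟨q, h1, h2, h3⟩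
              exact ⟨q, h1, by omega, h3⟩
            · rintro ⟨q, h1, h2, h3⟩
              refine ⟨q, h1, lt_of_le_of_ne (by omega) ?_, h3⟩
              rintro rfl
              exact hxy ⟨hx, h3.symm⟩
      · have f2 : m₄.reg 0 = n := (fr₄.1 0 rfl).trans (by simp [h₃, f0])
        have hhi : m₃.reg 5 = m.arr 0 (j + 1) := by simp [h₃]
        rw [hhi] at h₄
        refine .of_wp ?_
        simp only [Prog.wp, Expr.eval, h₄.1, f2]
        refine ⟨by omega, by simp [o5], fun x hx => by simpa using h₄.2.1 x hx, fun x y => ?_⟩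
        simp only [Mem.arr_setReg]
        rw [h₄.2.2 x y]
        constructor
        · rintro (⟨h1, h2⟩ | ⟨h1, q, h2, h3, h4⟩)
          · exact ⟨by omega, h2⟩
          · exact ⟨by omega, (hm.adj_iff x y).2 ⟨q, by rw [h1]; exact h2, by rw [h1]; exact h3, h4⟩⟩
        · rintro ⟨h1, h2⟩
          by_cases hxj : x.val = j
          · obtain ⟨q, h3, h4, h5⟩ := (hm.adj_iff x y).1 h2
            rw [hxj] at h3 h4
            exact Or.inr ⟨hxj, q, h3, h4, h5⟩
          · exact Or.inl ⟨by omega, h2⟩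
      · have hhi : m₃.reg 5 = m.arr 0 (j + 1) := by simp [h₃]
        rw [hhi]
        simp only [Expr.cost]
        omega
    · simp only [Prog.time, Expr.cost]
      omega
  · rw [e0]; simp [Expr.cost]
  · intro m' h
    rw [e0] at h
    exact ⟨⟨h.2.1, fun x y => by rw [h.2.2 x y]; simp⟩, h.1⟩

/-! ### Growing a spanning tree -/

/-- Finds in register 6 a vertex outside the tree with a neighbour inside. -/
def findLeaf : Prog :=
  forLoop 4 (const 0) 0
    (ite (get 6 (.reg 4)) .skip (ite (get 7 (.reg 4)) (assign 6 (.reg 4)) .skip))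

/-- Attaches the vertex in register 6 as a leaf: registers 24 and 25 hold the row offsets of the
leaf and of its neighbour in the tree. The distances from the leaf are one more than those from
that neighbour, and the neighbours of the leaf become candidates for the next rounds. -/
def updateTables : Prog :=
  forLoop 4 (const 0) 0
    (ite (get 6 (.reg 4))
      (.seq (store 8 (.add (.reg 24) (.reg 4))
          (.add (get 8 (.add (.reg 25) (.reg 4))) (const 1)))
        (store 8 (.add (get 5 (.reg 4)) (.reg 6))
          (.add (get 8 (.add (.reg 25) (.reg 4))) (const 1))))
      (ite (get 4 (.add (.reg 24) (.reg 4)))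
        (store 7 (.reg 4) (.add (.reg 6) (const 1))) .skip))

/-- One round of `buildTree`. The `- 1` undoes the shift by which array 7 tells the candidate parent
`0` from no candidate. -/
def attachLeaf : Prog :=
  .seq findLeaf
    (.seq (.seq (assign 24 (get 5 (.reg 6)))
        (assign 25 (get 5 (.sub (get 7 (.reg 6)) (const 1)))))
      (.seq updateTables (store 6 (.reg 6) (const 1))))

/-- Grows a spanning tree from the vertex `0` and tabulates its metric in array 8. Array 6 marks the
vertices in the tree; for a vertex outside, array 7 holds the successor of some neighbour in the
tree, or `0` if there is none. -/
def buildTree : Prog :=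
  .seq (store 6 (const 0) (const 1))
    (.seq (forLoop 4 (const 0) 0
        (ite (get 4 (.reg 4)) (store 7 (.reg 4) (const 1)) .skip))
      (forLoop 3 (const 1) 0 attachLeaf))

/-- The square table stored in array 8. -/
def table {n : ℕ} (m : Mem) (x y : Fin n) : ℕ := m.arr 8 (x * n + y)

/-- The state of `buildTree` when the tree spans `S`. -/
structure TreeState {n : ℕ} (G : SimpleGraph (Fin n)) (S : Finset (Fin n)) (m : Mem) : Prop where
  visited : ∀ u : Fin n, m.arr 6 u ≠ 0 ↔ u ∈ S
  cand_spec : ∀ u : Fin n, u ∉ S → m.arr 7 u ≠ 0 → ∃ c ∈ S, m.arr 7 u = c + 1 ∧ G.Adj u c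
  cand_ne : ∀ u : Fin n, u ∉ S → ∀ c ∈ S, G.Adj u c → m.arr 7 u ≠ 0
  tree : G.IsTreeMetricOn (S : Set (Fin n)) (table m)
  zero : ∀ u : Fin n, u ∉ S → table m u u = 0
  lt : ∀ x ∈ S, ∀ y ∈ S, table m x y < S.card

theorem HasMatrix.frame {n : ℕ} {G : SimpleGraph (Fin n)} {m m' : Mem} (h : HasMatrix G m)
    (h4 : m'.arr 4 = m.arr 4) (h5 : m'.arr 5 = m.arr 5) : HasMatrix G m' :=
  ⟨by rw [h5]; exact h.row, by rw [h4]; exact h.adj⟩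

theorem runs_findLeaf {n : ℕ} {m : Mem} {B : ℕ} (hB : n ≤ B) (hn : m.reg 0 = n)
    {S : Finset (Fin n)} (hvis : ∀ u : Fin n, m.arr 6 u ≠ 0 ↔ u ∈ S)
    (hex : ∃ u : Fin n, u ∉ S ∧ m.arr 7 u ≠ 0) :
    Runs B findLeaf (n * 18 + 6) m fun m' =>
      ∃ u : Fin n, m'.reg 6 = u ∧ u ∉ S ∧ m.arr 7 u ≠ 0 := by
  refine .mono (.forLoop (l := 0) (T := 10) (fun j m' =>
    (∃ u : Fin n, u.val < j ∧ u ∉ S ∧ m.arr 7 u ≠ 0) →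
      ∃ u : Fin n, m'.reg 6 = u ∧ u ∉ S ∧ m.arr 7 u ≠ 0) rfl (Nat.zero_le _) (by omega) ?_ ?_)
    ?_ fun m' h => ?_
  · rintro ⟨u, hu, -⟩; omega
  · intro j m₁ _ hj hj4 fr hI
    rw [hn] at hj
    have g6 : m₁.arr 6 = m.arr 6 := fr.2 6 rfl
    have g7 : m₁.arr 7 = m.arr 7 := fr.2 7 rfl
    have hv := hvis ⟨j, hj⟩
    refine .mono (.of_wp ?_) (show _ ≤ 10 by decide) fun _ h => h
    simp only [Prog.wp, Expr.eval, hj4, g6, g7]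
    have step : ∀ m₂ : Mem, m₂ = m₁ → ¬ (⟨j, hj⟩ ∉ S ∧ m.arr 7 j ≠ 0) →
        (∃ u : Fin n, u.val < j + 1 ∧ u ∉ S ∧ m.arr 7 u ≠ 0) →
          ∃ u : Fin n, (m₂.setReg 4 (j + 1)).reg 6 = u ∧ u ∉ S ∧ m.arr 7 u ≠ 0 := by
      rintro m₂ rfl hno ⟨u, hu1, hu2, hu3⟩
      refine hI ⟨u, lt_of_le_of_ne (by omega) ?_, hu2, hu3⟩
      intro huj
      obtain rfl : u = ⟨j, hj⟩ := Fin.ext huj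
      exact hno ⟨hu2, hu3⟩
    refine ⟨fun h => step m₁ rfl fun hh => hh.1 (hv.1 h), fun h => ⟨fun h' => ⟨by omega, ?_⟩,
      fun h' => step m₁ rfl fun hh => hh.2 h'⟩⟩
    exact fun _ => ⟨⟨j, hj⟩, by simp, fun hmem => hv.2 hmem h, h'⟩
  · rw [hn]; exact le_rfl
  · rw [hn] at h
    obtain ⟨u, hu⟩ := hex
    exact h ⟨u, u.2, hu⟩

theorem runs_updateTables {n : ℕ} {G : SimpleGraph (Fin n)} {m : Mem} {B : ℕ}
    (hB : n * n + n ≤ B) (hn : m.reg 0 = n) (hM : HasMatrix G m) {S : Finset (Fin n)}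
    (hvis : ∀ u : Fin n, m.arr 6 u ≠ 0 ↔ u ∈ S) {c w : Fin n} (hcS : c ∈ S) (hwS : w ∉ S)
    (hlt : ∀ y ∈ S, table m c y < n) (h6 : m.reg 6 = w) (h24 : m.reg 24 = w * n)
    (h25 : m.reg 25 = c * n) :
    Runs B updateTables (n * 36 + 6) m fun m' =>
      (∀ x y : Fin n, table m' x y = if x = w ∧ y ∈ S then table m c y + 1
        else if y = w ∧ x ∈ S then table m c x + 1 else table m x y) ∧
      (∀ u : Fin n, m'.arr 7 u =
        if u ∉ S ∧ m.arr 4 (w * n + u) ≠ 0 then w.val + 1 else m.arr 7 u) := by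
  have hcw : c ≠ w := fun h => hwS (h ▸ hcS)
  have hltS := hlt
  refine .mono (.forLoop (l := 0) (T := 28) (fun j m' =>
    (∀ x y : Fin n, table m' x y =
      if x = w ∧ y ∈ S ∧ y.val < j then table m c y + 1
      else if y = w ∧ x ∈ S ∧ x.val < j then table m c x + 1 else table m x y) ∧
    (∀ u : Fin n, m'.arr 7 u = if u.val < j ∧ u ∉ S ∧ m.arr 4 (w * n + u) ≠ 0 then w.val + 1
      else m.arr 7 u)) rfl (Nat.zero_le _) (by omega) ?_ ?_) ?_ fun m' h => ?_
  · simp [table]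
  · intro j m₃ _ hj hj4 fr hI
    rw [hn] at hj
    have g4 : m₃.arr 4 = m.arr 4 := fr.2 4 rfl
    have g5 : m₃.arr 5 = m.arr 5 := fr.2 5 rfl
    have g6 : m₃.arr 6 = m.arr 6 := fr.2 6 rfl
    have s6 : m₃.reg 6 = w := (fr.1 6 rfl).trans h6
    have s24 : m₃.reg 24 = w * n := (fr.1 24 rfl).trans h24
    have s25 : m₃.reg 25 = c * n := (fr.1 25 rfl).trans h25
    have hv := hvis ⟨j, hj⟩
    have i1 := index_lt w.2 hj
    have i2 := index_lt hj w.2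
    refine .mono (.of_wp ?_) (show _ ≤ 28 by decide) fun _ h => h
    simp only [Prog.wp, Expr.eval, hj4, g4, g5, g6, s6, s24, s25, Mem.reg_setArr,
      Mem.arr_setArr, hM.row _ hj, Mem.arr_setReg]
    refine ⟨fun hvs => ?_, fun hvs => ⟨fun hadj => ⟨by omega, ?_, ?_, ?_⟩, fun hadj => ⟨?_, ?_⟩⟩⟩
    · have hjS : (⟨j, hj⟩ : Fin n) ∈ S := hv.1 hvs
      have hjw : (⟨j, hj⟩ : Fin n) ≠ w := fun h => hwS (h ▸ hjS)
      have hold : m₃.arr 8 (c * n + j) = table m c ⟨j, hj⟩ := by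
        have := hI.1 c ⟨j, hj⟩
        rw [if_neg (fun h => hcw h.1), if_neg (fun h => hjw h.1)] at this
        exact this
      have hltD := hltS _ hjS
      have hne1 : ¬ ((c : ℕ) * n + j = w * n + j) := by
        rw [index_eq_iff hj hj]
        exact fun h => hcw (Fin.ext h.1)
      simp only [hne1, Nat.reduceEqDiff, if_true, if_false, hold]
      refine ⟨by omega, by omega, by omega, by omega, fun x y => ?_, fun u => ?_⟩
      · have hxy := hI.1 x y
        have e1 : ((x : ℕ) * n + y = j * n + w) ↔ (y = w ∧ x = ⟨j, hj⟩) := by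
          rw [index_eq_iff y.2 w.2, Fin.ext_iff, Fin.ext_iff, and_comm]
        have e2 : ((x : ℕ) * n + y = w * n + j) ↔ (x = w ∧ y = ⟨j, hj⟩) := by
          rw [index_eq_iff y.2 hj, Fin.ext_iff, Fin.ext_iff]
        simp only [table, Mem.arr_setReg, Mem.arr_setArr, if_true, e1, e2] at hxy ⊢
        have hlt : ∀ z : Fin n, z.val < j + 1 ↔ z.val < j ∨ z = ⟨j, hj⟩ := by
          intro z; rw [Fin.ext_iff]; simp only; omega
        by_cases k1 : y = w ∧ x = ⟨j, hj⟩
        · rw [if_pos k1, if_neg (fun h => hjw (k1.2.symm.trans h.1)),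
            if_pos ⟨k1.1, k1.2 ▸ hjS, (hlt x).2 (Or.inr k1.2)⟩, k1.2]
        · rw [if_neg k1]
          by_cases k2 : x = w ∧ y = ⟨j, hj⟩
          · rw [if_pos k2, if_pos ⟨k2.1, k2.2 ▸ hjS, (hlt y).2 (Or.inr k2.2)⟩, k2.2]
          · rw [if_neg k2, hxy]
            have l1 : (x = w ∧ y ∈ S ∧ y.val < j) ↔ (x = w ∧ y ∈ S ∧ y.val < j + 1) := by
              rw [hlt]; exact ⟨fun h => ⟨h.1, h.2.1, Or.inl h.2.2⟩, fun h => ⟨h.1, h.2.1,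
                  h.2.2.resolve_right fun h' => k2 ⟨h.1, h'⟩⟩⟩
            have l2 : (y = w ∧ x ∈ S ∧ x.val < j) ↔ (y = w ∧ x ∈ S ∧ x.val < j + 1) := by
              rw [hlt]; exact ⟨fun h => ⟨h.1, h.2.1, Or.inl h.2.2⟩, fun h => ⟨h.1, h.2.1,
                  h.2.2.resolve_right fun h' => k1 ⟨h.1, h'⟩⟩⟩
            simp only [l1, l2]
      · have hu := hI.2 u
        rw [hu]
        by_cases huj : u = ⟨j, hj⟩
        · rw [if_neg (fun h => h.2.1 (huj ▸ hjS)), if_neg (fun h => h.2.1 (huj ▸ hjS))]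
        · have : u.val ≠ j := fun h => huj (Fin.ext h)
          have l : (u.val < j + 1) ↔ u.val < j := by omega
          simp only [l]
    · omega
    · intro x y
      have hxy := hI.1 x y
      simp only [table, Mem.arr_setReg, Mem.arr_setArr] at hxy ⊢
      simp only [show (8 : ℕ) ≠ 7 by omega, if_false]
      rw [hxy]
      have hlt : ∀ z : Fin n, z ∈ S ∧ z.val < j ↔ z ∈ S ∧ z.val < j + 1 := by
        intro z
        refine and_congr_right fun hz => ⟨fun h => by omega, fun h => ?_⟩
        refine lt_of_le_of_ne (by omega) fun h' => ?_
        obtain rfl : z = ⟨j, hj⟩ := Fin.ext h'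
        exact hv.2 hz hvs
      simp only [hlt]
    · intro u
      have hu := hI.2 u
      simp only [if_true]
      by_cases huj : u.val = j
      · obtain rfl : u = ⟨j, hj⟩ := Fin.ext huj
        rw [if_pos rfl, if_pos ⟨by simp, fun h => hv.2 h hvs, hadj⟩]
      · rw [if_neg huj, hu]
        have l : (u.val < j + 1) ↔ u.val < j := by omega
        simp only [l]
    · intro x y
      have hxy := hI.1 x y
      simp only [table, Mem.arr_setReg] at hxy ⊢
      rw [hxy]
      have hlt : ∀ z : Fin n, z ∈ S ∧ z.val < j ↔ z ∈ S ∧ z.val < j + 1 := by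
        intro z
        refine and_congr_right fun hz => ⟨fun h => by omega, fun h => ?_⟩
        refine lt_of_le_of_ne (by omega) fun h' => ?_
        obtain rfl : z = ⟨j, hj⟩ := Fin.ext h'
        exact hv.2 hz hvs
      simp only [hlt]
    · intro u
      have hu := hI.2 u
      rw [hu]
      by_cases huj : u.val = j
      · rw [if_neg (fun h => by omega), if_neg (fun h => h.2.2 (by rw [huj]; exact hadj))]
      · have l : (u.val < j + 1) ↔ u.val < j := by omega
        simp only [l]
  · rw [hn]; exact le_rfl
  · rw [hn] at h
    refine ⟨fun x y => ?_, fun u => ?_⟩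
    · have := h.1 x y
      simpa only [Fin.is_lt, and_true] using this
    · have := h.2 u
      simpa only [Fin.is_lt, true_and] using this

theorem runs_attachLeaf {n : ℕ} {G : SimpleGraph (Fin n)} (hG : G.Connected) {m : Mem} {B : ℕ}
    (hB : n * n + n ≤ B) (hn : m.reg 0 = n) (hM : HasMatrix G m) {S : Finset (Fin n)}
    (hne : S.Nonempty) (hlt : S.card < n) (hS : TreeState G S m) :
    Runs B attachLeaf (n * 54 + 30) m fun m' =>
      ∃ S' : Finset (Fin n), S'.card = S.card + 1 ∧ TreeState G S' m' := by
  obtain ⟨x₀, hx₀⟩ := hne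
  obtain ⟨y₀, hy₀⟩ : ∃ y, y ∉ S := by
    by_contra hcon
    push Not at hcon
    rw [Finset.eq_univ_iff_forall.2 hcon, Finset.card_univ, Fintype.card_fin] at hlt
    omega
  obtain ⟨c₀, hc₀, w₀, hw₀, hadj₀⟩ := hG.exists_adj_boundary (S := (S : Set (Fin n))) hx₀ hy₀
  have hw₀' := hS.cand_ne w₀ hw₀ c₀ hc₀ hadj₀
  refine .mono (.seq (T' := n * 36 + 24) (runs_findLeaf (by omega) hn hS.visited ⟨w₀, hw₀, hw₀'⟩)
    fun m₁ h₁ fr₁ => ?_) (by omega) fun _ h => h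
  obtain ⟨w, hw6, hwS, hw7⟩ := h₁
  obtain ⟨c, hcS, hc7, hwc⟩ := hS.cand_spec w hwS hw7
  have a4 : m₁.arr 4 = m.arr 4 := fr₁.2 4 rfl
  have a5 : m₁.arr 5 = m.arr 5 := fr₁.2 5 rfl
  have a6 : m₁.arr 6 = m.arr 6 := fr₁.2 6 rfl
  have a7 : m₁.arr 7 = m.arr 7 := fr₁.2 7 rfl
  have a8 : m₁.arr 8 = m.arr 8 := fr₁.2 8 rfl
  have r0 : m₁.reg 0 = n := (fr₁.1 0 rfl).trans hn
  have hwn := index_lt w.2 w.2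
  have hcn := index_lt c.2 c.2
  refine .mono (.seq (T := 10) (T' := n * 36 + 14) (.mono (.of_wp (Q := fun m' =>
    m' = (m₁.setReg 24 (w * n)).setReg 25 (c * n)) ?_) (by decide) fun _ h => h) fun m₂ h₂ _ => ?_)
    (by omega) fun _ h => h
  · simp only [Prog.wp, Expr.eval, hw6, a5, a7, hM.row _ w.2, Mem.arr_setReg, Mem.reg_setReg]
    simp [hc7, hM.row _ c.2]
    omega
  have t₂ : table (n := n) m₂ = table m := by
    funext x y; simp [table, h₂, a8]
  refine .mono (.seq (T' := 5) (runs_updateTables hB (by simp [h₂, r0])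
    (hM.frame (by simp [h₂, a4]) (by simp [h₂, a5])) (S := S)
    (by simpa [h₂, a6] using hS.visited) hcS hwS
    (fun y hy => by rw [t₂]; have := hS.lt c hcS y hy; omega)
    (by simpa [h₂] using hw6) (by simp [h₂]) (by simp [h₂])) fun m₃ h₃ fr₃ => ?_)
    (by omega) fun _ h => h
  have s6 : m₃.reg 6 = w := (fr₃.1 6 rfl).trans (by rw [h₂]; simpa using hw6)
  have g6 : m₃.arr 6 = m.arr 6 := (fr₃.2 6 rfl).trans (by rw [h₂]; exact a6)
  rw [t₂, show m₂.arr 7 = m.arr 7 by rw [h₂]; exact a7,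
    show m₂.arr 4 = m.arr 4 by rw [h₂]; exact a4] at h₃
  refine .mono (.of_wp ?_) (show _ ≤ 5 by decide) fun _ h => h
  simp only [Prog.wp, Expr.eval, s6]
  have w2 := w.2
  refine ⟨by omega, by omega, insert w S, Finset.card_insert_of_notMem hwS, ?_⟩
  have ht : ∀ x y : Fin n, table (m₃.setArr 6 w 1) x y =
      if x = w ∧ y ∈ S then table m c y + 1
      else if y = w ∧ x ∈ S then table m c x + 1 else table m x y := by
    intro x y
    rw [← h₃.1 x y]
    simp [table]
  have h7 : ∀ u : Fin n, (m₃.setArr 6 w 1).arr 7 u =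
      if u ∉ S ∧ m.arr 4 (w * n + u) ≠ 0 then w.val + 1 else m.arr 7 u := by
    intro u
    rw [← h₃.2 u]
    simp
  have hnew : ∀ x, x ∈ S → x ≠ w := fun x hx h => hwS (h ▸ hx)
  have htl : ∀ u ∈ S, table (m₃.setArr 6 w 1) w u = table m c u + 1 := by
    intro u hu
    rw [ht, if_pos ⟨rfl, hu⟩]
  have htr : ∀ u ∈ S, table (m₃.setArr 6 w 1) u w = table m c u + 1 := by
    intro u hu
    rw [ht, if_neg (fun h => hnew u hu h.1), if_pos ⟨rfl, hu⟩]
  have hto : ∀ x, x ≠ w → ∀ y, y ≠ w → table (m₃.setArr 6 w 1) x y = table m x y := by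
    intro x hx y hy
    rw [ht, if_neg (fun h => hx h.1), if_neg (fun h => hy h.1)]
  have hself : table (m₃.setArr 6 w 1) w w = 0 := by
    rw [ht, if_neg (fun h => hwS h.2), if_neg (fun h => hwS h.2)]
    exact hS.zero w hwS
  constructor
  · intro u
    simp only [Mem.arr_setArr, if_true, g6, Finset.mem_insert, ← Fin.ext_iff]
    split_ifs with huw
    · simp [huw]
    · simpa [huw] using hS.visited u
  · intro u hu hne
    rw [Finset.mem_insert, not_or] at hu
    rw [h7] at hne ⊢
    split_ifs at hne ⊢ with hh
    · exact ⟨w, Finset.mem_insert_self w S, rfl, ((hM.adj w u).1 hh.2).symm⟩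
    · obtain ⟨d, hd, h1, h2⟩ := hS.cand_spec u hu.2 hne
      exact ⟨d, Finset.mem_insert_of_mem hd, h1, h2⟩
  · intro u hu d hd hud
    rw [Finset.mem_insert, not_or] at hu
    rw [h7]
    split_ifs with hh
    · omega
    · rcases Finset.mem_insert.1 hd with hdw | hd
      · rw [hdw] at hud
        exact absurd ⟨hu.2, (hM.adj w u).2 hud.symm⟩ hh
      · exact hS.cand_ne u hu.2 d hd hud
  · rw [Finset.coe_insert]
    exact hS.tree.insert hcS hwS hwc (fun x hx y hy => hto x (hnew x hx) y (hnew y hy))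
      hself htl htr
  · intro u hu
    rw [Finset.mem_insert, not_or] at hu
    rw [hto u hu.1 u hu.1]
    exact hS.zero u hu.2
  · rw [Finset.card_insert_of_notMem hwS]
    intro x hx y hy
    rcases Finset.mem_insert.1 hx with hx | hx <;> rcases Finset.mem_insert.1 hy with hy | hy
    · rw [hx, hy, hself]; omega
    · rw [hx, htl y hy]; have := hS.lt c hcS y hy; omega
    · rw [hy, htr x hx]; have := hS.lt c hcS x hx; omega
    · rw [hto x (hnew x hx) y (hnew y hy)]; have := hS.lt x hx y hy; omega

theorem runs_buildTree {n : ℕ} {G : SimpleGraph (Fin n)} (hG : G.Connected) {m : Mem} {B : ℕ}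
    (hB : n * n + n ≤ B) (hn : m.reg 0 = n) (hM : HasMatrix G m)
    (h6 : ∀ i, m.arr 6 i = 0) (h7 : ∀ i, m.arr 7 i = 0) (h8 : ∀ i, m.arr 8 i = 0) :
    Runs B buildTree (n * (n * 54 + 60) + 20) m fun m' =>
      G.IsTreeMetricOn Set.univ (table (n := n) m') ∧ ∀ x y : Fin n, table m' x y < n := by
  classical
  have hn0 : 0 < n := by
    obtain ⟨x⟩ := hG.nonempty
    exact x.pos
  set o : Fin n := ⟨0, hn0⟩ with ho
  have e0 : ∀ u : Fin n, (u : ℕ) = 0 ↔ u = o := fun u => by rw [Fin.ext_iff]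
  refine .mono (.seq (T := 3) (T' := n * (n * 54 + 56) + 17) (.mono (.of_wp (Q := fun m' =>
    m' = m.setArr 6 0 1) ?_) (by decide) fun _ h => h) fun m₁ h₁ _ => ?_) (by
      have : n * (n * 54 + 60) = n * (n * 54 + 56) + n * 4 := by ring
      omega) fun _ h => h
  · simp [Prog.wp, Expr.eval]; omega
  have r1 : m₁.reg 0 = n := by rw [h₁]; exact hn
  refine .mono (.seq (T := n * 18 + 6) (T' := n * (n * 54 + 38) + 6) (.mono (.forLoop (l := 0)
    (T := 10) (fun j m' => ∀ u : Fin n, m'.arr 7 u = if u.val < j ∧ m.arr 4 u ≠ 0 then 1 else 0)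
    rfl (Nat.zero_le _) (by omega) ?_ ?_) (by rw [r1]; exact le_rfl) fun _ h => h)
    fun m₂ h₂ fr₂ => ?_) (by
      have : n * (n * 54 + 56) = n * (n * 54 + 38) + n * 18 := by ring
      omega) fun _ h => h
  · intro u; simp [h₁, h7]
  · intro j m₂ _ hj hj4 fr hI
    rw [r1] at hj
    have g4 : m₂.arr 4 = m.arr 4 := (fr.2 4 rfl).trans (by rw [h₁]; funext i; simp)
    refine .mono (.of_wp ?_) (show _ ≤ 10 by decide) fun _ h => h
    simp only [Prog.wp, Expr.eval, hj4, g4]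
    refine ⟨fun h => ⟨by omega, by omega, fun u => ?_⟩, fun h => fun u => ?_⟩
    · simp only [Mem.arr_setReg, Mem.arr_setArr, if_true]
      by_cases hu : u.val = j
      · rw [if_pos hu, if_pos ⟨by omega, by rw [hu]; exact h⟩]
      · have l : u.val < j + 1 ↔ u.val < j := by omega
        rw [if_neg hu, hI u]
        simp only [l]
    · rw [Mem.arr_setReg, hI u]
      by_cases hu : u.val = j
      · rw [if_neg (fun hh => by omega), if_neg (fun hh => hh.2 (by rw [hu]; exact h))]
      · have l : u.val < j + 1 ↔ u.val < j := by omega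
        simp only [l]
  · rw [r1] at h₂
    have g4 : m₂.arr 4 = m.arr 4 := (fr₂.2 4 rfl).trans (by rw [h₁]; funext i; simp)
    have g5 : m₂.arr 5 = m.arr 5 := (fr₂.2 5 rfl).trans (by rw [h₁]; funext i; simp)
    have g6 : m₂.arr 6 = m₁.arr 6 := fr₂.2 6 rfl
    have g8 : m₂.arr 8 = m.arr 8 := (fr₂.2 8 rfl).trans (by rw [h₁]; funext i; simp)
    have r2 : m₂.reg 0 = n := (fr₂.1 0 rfl).trans r1
    have hzero : ∀ x y : Fin n, table m₂ x y = 0 := fun x y => by rw [table, g8, h8]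
    have hcand : ∀ u : Fin n, m₂.arr 7 u = if G.Adj o u then 1 else 0 := by
      intro u
      rw [h₂ u]
      have := hM.adj o u
      simp only [ho, zero_mul, zero_add] at this
      simp only [Fin.is_lt, true_and, this, ho]
    refine .mono (.forLoop (l := 1) (T := n * 54 + 30) (fun j m' => ∃ S : Finset (Fin n),
      S.card = j ∧ TreeState G S m') rfl (by omega) (by omega)
      ⟨{o}, by simp, ?_, ?_, ?_, ?_, ?_, ?_⟩
      ?_) ?_ ?_
    · intro u
      simp only [Mem.arr_setReg, g6, h₁, Mem.arr_setArr, if_true, e0, Finset.mem_singleton, h6]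
      split_ifs with h <;> simp [h]
    · intro u hu hne
      rw [Mem.arr_setReg, hcand] at hne ⊢
      split_ifs at hne ⊢ with hadj
      · exact ⟨o, by simp, rfl, hadj.symm⟩
      · exact absurd rfl hne
    · intro u hu c hc hadj
      obtain rfl := Finset.mem_singleton.1 hc
      rw [Mem.arr_setReg, hcand, if_pos hadj.symm]
      exact one_ne_zero
    · rw [Finset.coe_singleton]
      exact SimpleGraph.isTreeMetricOn_singleton (hzero o o)
    · exact fun u _ => hzero u u
    · intro x _ y _
      rw [Finset.card_singleton]
      exact lt_of_le_of_lt (hzero x y).le one_pos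
    · intro j m₃ hj1 hj hj3 fr ⟨S, hS, hst⟩
      rw [r2] at hj
      refine .mono (runs_attachLeaf hG hB ((fr.1 0 rfl).trans r2)
        (hM.frame ((fr.2 4 rfl).trans g4) ((fr.2 5 rfl).trans g5))
        (Finset.card_pos.1 (by omega)) (by omega) hst) le_rfl ?_
      rintro m' ⟨S', h1, h2⟩
      exact ⟨S', by omega, ⟨h2.visited, h2.cand_spec, h2.cand_ne, h2.tree, h2.zero, h2.lt⟩⟩
    · rw [r2]
      simp only [Expr.cost]
      have : (n - 1) * (n * 54 + 30 + 8) ≤ n * (n * 54 + 38) := Nat.mul_le_mul_right _ (by omega)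
      omega
    · rintro m' ⟨S, hS, hst⟩
      rw [r2] at hS
      have huniv : S = Finset.univ := (Finset.card_eq_iff_eq_univ S).1 (by simpa using hS)
      have ht := hst.tree
      have hl := hst.lt
      rw [hS] at hl
      subst huniv
      rw [Finset.coe_univ] at ht
      exact ⟨ht, fun x y => hl x (Finset.mem_univ x) y (Finset.mem_univ y)⟩

/-! ### The root -/

/-- Finds in register 9 a vertex minimizing the total tree distance to the points of `U`.
Register 10 holds the least total found so far. -/
def chooseRoot : Prog :=
  forLoop 3 (const 0) 0
    (.seq (assign 11 (const 0))
      (.seq (forLoop 4 (const 0) 0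
          (ite (get 2 (.reg 4))
            (assign 11 (.add (.reg 11) (get 8 (.add (get 5 (.reg 3)) (.reg 4))))) .skip))
        (ite (.add (.eq (.reg 3) (const 0)) (.lt (.reg 11) (.reg 10)))
          (.seq (assign 10 (.reg 11)) (assign 9 (.reg 3))) .skip)))

theorem filter_lt_succ {n j : ℕ} (U : Finset (Fin n)) (hj : j < n) :
    U.filter (fun u => u.val < j + 1) = if (⟨j, hj⟩ : Fin n) ∈ U
      then insert ⟨j, hj⟩ (U.filter fun u => u.val < j) else U.filter fun u => u.val < j := by
  split_ifs with h
  · ext u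
    simp only [Finset.mem_filter, Finset.mem_insert, Fin.ext_iff]
    constructor
    · rintro ⟨h1, h2⟩
      by_cases hu : u.val = j
      · exact Or.inl hu
      · exact Or.inr ⟨h1, by omega⟩
    · rintro (h1 | ⟨h1, h2⟩)
      · exact ⟨by rwa [show u = ⟨j, hj⟩ from Fin.ext h1], by omega⟩
      · exact ⟨h1, by omega⟩
  · refine Finset.filter_congr fun u hu => ⟨fun h' => ?_, fun h' => by omega⟩
    refine lt_of_le_of_ne (by omega) fun h'' => h ?_
    rwa [show (⟨j, hj⟩ : Fin n) = u from Fin.ext h''.symm]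

theorem notMem_filter_lt {n j : ℕ} (U : Finset (Fin n)) (hj : j < n) :
    (⟨j, hj⟩ : Fin n) ∉ U.filter fun u => u.val < j := by simp

/-- Array 2 holds the indicator function of `U`. -/
def HasPoints {n : ℕ} (U : Finset (Fin n)) (m : Mem) : Prop :=
  ∀ u : Fin n, m.arr 2 u ≠ 0 ↔ u ∈ U

theorem runs_chooseRoot {n : ℕ} {U : Finset (Fin n)} {m : Mem} {B : ℕ} (hn0 : 0 < n)
    (hB : n * n + n ≤ B) (hn : m.reg 0 = n) (hrow : ∀ x < n, m.arr 5 x = x * n)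
    (hU : HasPoints U m) (hlt : ∀ x y : Fin n, table m x y < n) :
    Runs B chooseRoot (n * (n * 20 + 30) + 6) m fun m' => ∃ v : Fin n, m'.reg 9 = v ∧
      ∀ c, ∑ u ∈ U, table m v u ≤ ∑ u ∈ U, table m c u := by
  refine .mono (.forLoop (l := 0) (T := n * 20 + 22) (fun j m' => 0 < j → ∃ v : Fin n,
    m'.reg 9 = v ∧ m'.reg 10 = ∑ u ∈ U, table m v u ∧
    ∀ c : Fin n, c.val < j → ∑ u ∈ U, table m v u ≤ ∑ u ∈ U, table m c u) rfl (Nat.zero_le _)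
    (by omega) (fun h => absurd h (lt_irrefl _)) ?_) ?_ fun m' h => ?_
  · intro j m₁ _ hj hj3 fr hI
    rw [hn] at hj
    have r0 : m₁.reg 0 = n := (fr.1 0 rfl).trans hn
    have g2 : m₁.arr 2 = m.arr 2 := fr.2 2 rfl
    have g5 : m₁.arr 5 = m.arr 5 := fr.2 5 rfl
    have g8 : m₁.arr 8 = m.arr 8 := fr.2 8 rfl
    refine .mono (.seq (T := 2) (T' := n * 20 + 20) (.mono (.of_wp (Q := fun m' =>
      m' = m₁.setReg 11 0) ?_) (by decide) fun _ h => h) fun m₂ h₂ _ => ?_) (by omega) fun _ h => h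
    · simp [Prog.wp, Expr.eval]
    refine .mono (.seq (T := n * 20 + 6) (T' := 14) (.mono (.forLoop (l := 0) (T := 12)
      (fun i m' => m'.reg 11 = ∑ u ∈ U.filter (fun u => u.val < i), table m ⟨j, hj⟩ u ∧
        m'.reg 11 ≤ i * n) rfl (Nat.zero_le _)
      (by simp [h₂, r0]; omega) ?_ ?_) ?_ fun _ h => h) fun m₃ h₃ fr₃ => ?_) (by omega) fun _ h => h
    · simp [h₂]
    · intro i m₃ _ hi hi4 fr₃ hI₃
      replace hi : i < n := by simpa [h₂, r0] using hi
      have s3 : m₃.reg 3 = j := (fr₃.1 3 rfl).trans (by simp [h₂, hj3])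
      have k2 : m₃.arr 2 = m.arr 2 := (fr₃.2 2 rfl).trans (by rw [h₂]; exact g2)
      have k5 : m₃.arr 5 = m.arr 5 := (fr₃.2 5 rfl).trans (by rw [h₂]; exact g5)
      have k8 : m₃.arr 8 = m.arr 8 := (fr₃.2 8 rfl).trans (by rw [h₂]; exact g8)
      have hd := hlt ⟨j, hj⟩ ⟨i, hi⟩
      have hu := hU ⟨i, hi⟩
      simp only [table] at hd
      have hin : (i + 1) * n ≤ n * n := Nat.mul_le_mul_right n hi
      have hin' : (i + 1) * n = i * n + n := Nat.succ_mul i n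
      refine .mono (.of_wp ?_) (show _ ≤ 12 by decide) fun _ h => h
      simp only [Prog.wp, Expr.eval, hi4, k2, k5, k8, s3, hrow j hj]
      rw [filter_lt_succ U hi]
      refine ⟨fun h => ⟨by omega, ?_⟩, fun h => ?_⟩
      · rw [if_pos (hu.1 h), Finset.sum_insert (notMem_filter_lt U hi)]
        simp only [Mem.reg_setReg]
        refine ⟨?_, ?_⟩
        · simp [table, hI₃.1]; omega
        · simp; omega
      · rw [if_neg (fun hh => hu.2 hh h)]
        simp only [Mem.reg_setReg]
        exact ⟨by simpa using hI₃.1, by simp; omega⟩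
    · simp [h₂, r0, Expr.cost]
    · have h20 : m₂.reg 0 = n := by simp [h₂, r0]
      rw [h20] at h₃
      simp only [Fin.is_lt, Finset.filter_true] at h₃
      have s3 : m₃.reg 3 = j := (fr₃.1 3 rfl).trans (by simp [h₂, hj3])
      have s9 : m₃.reg 9 = m₁.reg 9 := (fr₃.1 9 rfl).trans (by simp [h₂])
      have s10 : m₃.reg 10 = m₁.reg 10 := (fr₃.1 10 rfl).trans (by simp [h₂])
      refine .mono (.of_wp ?_) (show _ ≤ 14 by decide) fun _ h => h
      simp only [Prog.wp, Expr.eval, s3, s10, Expr.eqVal, Expr.ltVal, h₃.1]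
      refine ⟨fun h => ⟨by omega, by simp [s3]; omega, fun _ =>
          ⟨⟨j, hj⟩, by simp [s3], by simp, ?_⟩⟩,
        fun h _ => ?_⟩
      · intro c hc
        by_cases hcj : c.val = j
        · rw [show c = ⟨j, hj⟩ from Fin.ext hcj]
        · obtain ⟨v, -, hv1, hv2⟩ := hI (by omega)
          rw [if_neg (by omega), hv1] at h
          have h' : ∑ u ∈ U, table m ⟨j, hj⟩ u < ∑ u ∈ U, table m v u := by
            by_contra hcon
            simp [hcon] at h
          exact h'.le.trans (hv2 c (by omega))
      · obtain ⟨v, hv0, hv1, hv2⟩ := hI (by by_contra hj0; simp [show j = 0 by omega] at h)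
        refine ⟨v, by simp [s9, hv0], by simp [s10, hv1], fun c hc => ?_⟩
        by_cases hcj : c.val = j
        · rw [show c = ⟨j, hj⟩ from Fin.ext hcj]
          by_contra hcon
          rw [hv1] at h
          simp at h
          omega
        · exact hv2 c (by omega)
  · rw [hn]; exact le_rfl
  · rw [hn] at h
    obtain ⟨v, h1, -, h3⟩ := h hn0
    exact ⟨v, h1, fun c => h3 c c.2⟩

/-! ### Branch labels and their sizes -/

/-- Writes into array 9 the branch labels at the root in register 9: the label of `x` is the child
of the root that is closer to `x` than the root is. Register 24 receives the row offset of the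
root. -/
def labelBranches : Prog :=
  .seq (assign 24 (get 5 (.reg 9)))
    (forLoop 3 (const 0) 0
      (.seq (store 9 (.reg 3) (.reg 9))
        (forLoop 4 (const 0) 0
          (ite (.eq (get 8 (.add (.reg 24) (.reg 4))) (const 1))
            (ite (.lt (get 8 (.add (get 5 (.reg 4)) (.reg 3))) (get 8 (.add (.reg 24) (.reg 3))))
              (store 9 (.reg 3) (.reg 4)) .skip) .skip))))

/-- Array 9 holds the label function `lab`. -/
def HasLabels {n : ℕ} (lab : Fin n → Fin n) (m : Mem) : Prop :=
  ∀ u : Fin n, m.arr 9 u = lab u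

theorem runs_labelBranches {n : ℕ} {G : SimpleGraph (Fin n)} {m : Mem} {B : ℕ}
    (hB : n * n + n ≤ B) (hn : m.reg 0 = n) (hrow : ∀ x < n, m.arr 5 x = x * n)
    (hD : G.IsTreeMetricOn Set.univ (table (n := n) m)) {v : Fin n} (hv : m.reg 9 = v) :
    Runs B labelBranches (n * (n * 30 + 30) + 10) m fun m' =>
      m'.reg 24 = v * n ∧ ∃ lab, HasLabels lab m' ∧ IsBranchLabel (table m) v lab := by
  have hvn := index_lt v.2 v.2
  have hgood : ∀ u w : Fin n, table m v w = 1 → table m w u < table m v u →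
      u ≠ v ∧ table m v u = table m w u + 1 := by
    intro u w h1 h2
    refine ⟨?_, ?_⟩
    · rintro rfl
      rw [hD.dist_self] at h2
      omega
    · have := hD.dist_edge h1 u
      omega
  have hex : ∀ u : Fin n, u ≠ v → ∃ w, table m v w = 1 ∧ table m w u < table m v u := by
    intro u hu
    obtain ⟨lab, hl⟩ := hD.exists_isBranchLabel v
    have := hl.child u hu
    exact ⟨lab u, this.1, by omega⟩
  refine .mono (.seq (T := 3) (T' := n * (n * 30 + 30) + 6) (.mono (.of_wp (Q := fun m' =>
    m' = m.setReg 24 (v * n)) ?_) (by decide) fun _ h => h) fun m₁ h₁ _ => ?_) (by omega)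
    fun _ h => h
  · simp [Prog.wp, Expr.eval, hv, hrow v v.2]; omega
  have r1 : m₁.reg 0 = n := by simp [h₁, hn]
  refine .mono (.forLoop (l := 0) (T := n * 30 + 22) (fun j m' => m'.reg 24 = v * n ∧
    ∀ u : Fin n, u.val < j → ∃ c : Fin n, m'.arr 9 u = c ∧ (u = v → c = v) ∧
      (u ≠ v → table m v c = 1 ∧ table m v u = table m c u + 1)) rfl (Nat.zero_le _) (by omega)
      ⟨by simp [h₁], fun u hu => absurd hu (Nat.not_lt_zero _)⟩ ?_) ?_ ?_
  · intro j m₂ _ hj hj3 fr hI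
    rw [r1] at hj
    have r0 : m₂.reg 0 = n := (fr.1 0 rfl).trans r1
    have r9 : m₂.reg 9 = v := (fr.1 9 rfl).trans (by simp [h₁, hv])
    have g5 : m₂.arr 5 = m.arr 5 := (fr.2 5 rfl).trans (by rw [h₁]; rfl)
    have g8 : m₂.arr 8 = m.arr 8 := (fr.2 8 rfl).trans (by rw [h₁]; rfl)
    refine .mono (.seq (T := 3) (T' := n * 30 + 10) (.mono (.of_wp (Q := fun m' =>
      m' = m₂.setArr 9 j v) ?_) (by decide) fun _ h => h) fun m₃ h₃ _ => ?_) (by omega)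
      fun _ h => h
    · have := v.2
      simp [Prog.wp, Expr.eval, hj3, r9]; omega
    have r3 : m₃.reg 0 = n := by simp [h₃, r0]
    refine .mono (.forLoop (l := 0) (T := 22) (fun i m' => m'.reg 24 = v * n ∧
      (∀ u : Fin n, u.val < j → m'.arr 9 u = m₂.arr 9 u) ∧
      ((m'.arr 9 j = v ∧ ∀ w : Fin n, w.val < i → table m v w = 1 →
          ¬ table m w ⟨j, hj⟩ < table m v ⟨j, hj⟩) ∨
        ∃ w : Fin n, m'.arr 9 j = w ∧ table m v w = 1 ∧ table m w ⟨j, hj⟩ < table m v ⟨j, hj⟩))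
      rfl (Nat.zero_le _) (by omega) ⟨?_, ?_, ?_⟩ ?_) ?_ ?_
    · simp [h₃, hI.1]
    · intro u hu
      simp [h₃, hu.ne]
    · left
      simp [h₃]
    · intro i m₄ _ hi hi4 fr₄ hI₄
      rw [r3] at hi
      have s3 : m₄.reg 3 = j := (fr₄.1 3 rfl).trans (by simp [h₃, hj3])
      have k5 : m₄.arr 5 = m.arr 5 := (fr₄.2 5 rfl).trans (by rw [h₃, ← g5]; funext i; simp)
      have k8 : m₄.arr 8 = m.arr 8 := (fr₄.2 8 rfl).trans (by rw [h₃, ← g8]; funext i; simp)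
      refine .mono (.of_wp ?_) (show _ ≤ 22 by decide) fun _ h => h
      have t1 : m.arr 8 (v * n + i) = table m v ⟨i, hi⟩ := rfl
      have t2 : m.arr 8 (i * n + j) = table m (⟨i, hi⟩ : Fin n) ⟨j, hj⟩ := rfl
      have t3 : m.arr 8 (v * n + j) = table m v ⟨j, hj⟩ := rfl
      simp only [Prog.wp, Expr.eval, Expr.eqVal, Expr.ltVal, hi4, k5, k8, s3, hI₄.1, hrow i hi,
        t1, t2, t3]
      have keep : ¬ (table m v ⟨i, hi⟩ = 1 ∧ table m (⟨i, hi⟩ : Fin n) ⟨j, hj⟩ <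
          table m v ⟨j, hj⟩) →
          ((m₄.arr 9 j = v ∧ ∀ w : Fin n, w.val < i + 1 → table m v w = 1 →
            ¬ table m w ⟨j, hj⟩ < table m v ⟨j, hj⟩) ∨
          ∃ w : Fin n, m₄.arr 9 j = w ∧ table m v w = 1 ∧
            table m w ⟨j, hj⟩ < table m v ⟨j, hj⟩) := by
        intro hno
        rcases hI₄.2.2 with ⟨h1, h2⟩ | h
        · refine Or.inl ⟨h1, fun w hw hw1 hw2 => ?_⟩
          by_cases hwi : w.val = i
          · obtain rfl : w = ⟨i, hi⟩ := Fin.ext hwi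
            exact hno ⟨hw1, hw2⟩
          · exact h2 w (by omega) hw1 hw2
        · exact Or.inr h
      refine ⟨fun ha => ⟨fun hb => ⟨by omega, by omega, by simp [hI₄.1], fun u hu => ?_, Or.inr
        ⟨⟨i, hi⟩, by simp, by simpa using ha, by simpa using hb⟩⟩,
        fun hb => ⟨by simp [hI₄.1], fun u hu => ?_, keep fun h => by simp [h.2] at hb⟩⟩,
        fun ha => ⟨by simp [hI₄.1], fun u hu => ?_, keep fun h => by simp [h.1] at ha⟩⟩
      · simpa [hu.ne] using hI₄.2.1 u hu
      · simpa using hI₄.2.1 u hu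
      · simpa using hI₄.2.1 u hu
    · rw [r3]; simp [Expr.cost]
    · intro m₄ h₄
      rw [r3] at h₄
      refine ⟨by simp [h₄.1], fun u hu => ?_⟩
      by_cases huj : u.val = j
      · obtain rfl : u = ⟨j, hj⟩ := Fin.ext huj
        rcases h₄.2.2 with ⟨h1, h2⟩ | ⟨w, h1, h2, h3⟩
        · refine ⟨v, by simpa using h1, fun _ => rfl, fun hne => ?_⟩
          obtain ⟨w, hw1, hw2⟩ := hex _ hne
          exact absurd hw2 (h2 w w.2 hw1)
        · obtain ⟨h4, h5⟩ := hgood _ w h2 h3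
          exact ⟨w, by simpa using h1, fun h => absurd h h4, fun _ => ⟨h2, h5⟩⟩
      · obtain ⟨c, hc1, hc2⟩ := hI.2 u (by omega)
        exact ⟨c, by rw [Mem.arr_setReg, h₄.2.1 u (by omega), hc1], hc2⟩
  · rw [r1]; simp [Expr.cost]
  · intro m' h
    rw [r1] at h
    refine ⟨h.1, ?_⟩
    choose lab h1 h2 h3 using fun u : Fin n => h.2 u u.2
    exact ⟨lab, h1, h2 v rfl, h3⟩

/-- Counts in array 10 the points of `U` in every branch and initializes array 11, the table of
mates, to the identity. -/
def countBranches : Prog :=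
  forLoop 3 (const 0) 0
    (.seq (store 11 (.reg 3) (.reg 3))
      (ite (get 2 (.reg 3))
        (store 10 (get 9 (.reg 3)) (.add (get 10 (get 9 (.reg 3))) (const 1))) .skip))

/-- Array 10 holds the numbers of points of `U` with a given label. -/
def HasCounts {n : ℕ} (U : Finset (Fin n)) (lab : Fin n → Fin n) (m : Mem) : Prop :=
  ∀ c : Fin n, m.arr 10 c = (U.filter fun u => lab u = c).card

theorem runs_countBranches {n : ℕ} {m : Mem} {B : ℕ} (hB : n ≤ B) (hn : m.reg 0 = n)
    {U : Finset (Fin n)} (hU : HasPoints U m) {lab : Fin n → Fin n} (hl : HasLabels lab m)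
    (h10 : ∀ i, m.arr 10 i = 0) :
    Runs B countBranches (n * 24 + 6) m fun m' =>
      HasCounts U lab m' ∧ ∀ c : Fin n, m'.arr 11 c = c := by
  refine .mono (.forLoop (l := 0) (T := 16) (fun j m' =>
    (∀ c : Fin n, m'.arr 10 c = ((U.filter fun u => u.val < j).filter fun u => lab u = c).card) ∧
      ∀ c : Fin n, c.val < j → m'.arr 11 c = c) rfl (Nat.zero_le _) (by omega) ⟨?_, ?_⟩ ?_) ?_ ?_
  · simp [h10]
  · exact fun c hc => absurd hc (Nat.not_lt_zero _)
  · intro j m₁ _ hj hj3 fr hI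
    rw [hn] at hj
    have g2 : m₁.arr 2 = m.arr 2 := fr.2 2 rfl
    have g9 : m₁.arr 9 = m.arr 9 := fr.2 9 rfl
    have hu := hU ⟨j, hj⟩
    have e9 : m.arr 9 j = lab ⟨j, hj⟩ := hl ⟨j, hj⟩
    have hlab := (lab ⟨j, hj⟩).2
    have hcard : ((U.filter fun u => u.val < j).filter fun u => lab u = lab ⟨j, hj⟩).card ≤ j := by
      refine (Finset.card_le_card_of_injOn (t := Finset.range j) (fun u : Fin n => u.val)
        (fun u hu => ?_) (fun a _ b _ h => Fin.ext h)).trans (by simp)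
      have hu := Finset.mem_coe.1 hu
      rw [Finset.mem_filter, Finset.mem_filter] at hu
      exact Finset.mem_coe.2 (Finset.mem_range.2 hu.1.2)
    refine .mono (.of_wp ?_) (show _ ≤ 16 by decide) fun _ h => h
    simp only [Prog.wp, Expr.eval, hj3, Mem.arr_setArr, Mem.reg_setArr, Nat.reduceEqDiff, if_false,
      g2,
      g9, e9, hI.1, filter_lt_succ U hj]
    have h11 : ∀ c : Fin n, c.val < j + 1 → (if c.val = j then j else m₁.arr 11 c) = c := by
      intro c hc
      split_ifs with hcj
      · exact hcj.symm
      · exact hI.2 c (by omega)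
    refine ⟨by omega, by omega, fun h => ⟨by omega, by omega, fun c => ?_, fun c hc => ?_⟩,
      fun h => ⟨fun c => ?_, fun c hc => ?_⟩⟩
    · rw [if_pos (hu.1 h)]
      simp only [Mem.arr_setReg, Mem.arr_setArr, Nat.reduceEqDiff, if_true, if_false,
        Finset.filter_insert, ← Fin.ext_iff, eq_comm (a := c)]
      split_ifs with hc
      · subst hc
        rw [Finset.card_insert_of_notMem (fun hmem => notMem_filter_lt U hj
          (Finset.mem_filter.1 hmem).1)]
      · exact hI.1 c
    · simpa using h11 c hc
    · rw [if_neg (fun hh => hu.2 hh h)]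
      simpa using hI.1 c
    · simpa using h11 c hc
  · rw [hn]; exact le_rfl
  · intro m' h
    rw [hn] at h
    exact ⟨fun c => by simpa using h.1 c, fun c => h.2 c c.2⟩

/-! ### Crossing edges and pairing keys -/

/-- Handles the pair of vertices in registers 3 and 4: if it is a crossing edge, the mate of the
first branch is recorded, and if moreover the two branches together hold more points than
register 20 says, the edge is saved in registers 15 and 16 and register 14 is set. -/
def testCrossing : Prog :=
  ite (.add (.eq (.reg 3) (.reg 9))
      (.add (.eq (.reg 4) (.reg 9)) (.eq (get 9 (.reg 3)) (get 9 (.reg 4))))) .skip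
    (ite (get 4 (.add (get 5 (.reg 3)) (.reg 4)))
      (.seq (store 11 (get 9 (.reg 3)) (get 9 (.reg 4)))
        (ite (.lt (.reg 20) (.add (get 10 (get 9 (.reg 3))) (get 10 (get 9 (.reg 4)))))
          (.seq (assign 14 (const 1)) (.seq (assign 15 (.reg 3)) (assign 16 (.reg 4)))) .skip))
      .skip)

/-- Examines all crossing edges; register 20 is set to `2 * k - 1`, half the number of points. -/
def findCrossings : Prog :=
  .seq (.seq (assign 20 (.sub (.add (.reg 1) (.reg 1)) (const 1))) (assign 14 (const 0)))
    (forLoop 3 (const 0) 0 (forLoop 4 (const 0) 0 testCrossing))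

/-- The state of `findCrossings` after the pairs in `done` have been examined. -/
structure CrossingState {n : ℕ} (G : SimpleGraph (Fin n)) (v : Fin n) (lab : Fin n → Fin n)
    (U : Finset (Fin n)) (h : ℕ) (done : Fin n → Fin n → Prop) (mate : Fin n → Fin n) (m : Mem) :
    Prop where
  mate_eq : ∀ c : Fin n, m.arr 11 c = mate c
  of_crossing : ∀ x y, G.Crossing v lab x y → done x y →
    ∃ x' y', G.Crossing v lab x' y' ∧ lab x' = lab x ∧ mate (lab x) = lab y'
  eq_or : ∀ c, mate c = c ∨ ∃ x y, G.Crossing v lab x y ∧ lab x = c ∧ mate c = lab y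
  light : m.reg 14 = 0 → ∀ x y, G.Crossing v lab x y → done x y →
    (U.filter fun u => lab u = lab x).card + (U.filter fun u => lab u = lab y).card ≤ h
  heavy : m.reg 14 ≠ 0 → ∃ a b : Fin n, m.reg 15 = a ∧ m.reg 16 = b ∧ G.Crossing v lab a b ∧
    h < (U.filter fun u => lab u = lab a).card + (U.filter fun u => lab u = lab b).card

theorem CrossingState.congr {n : ℕ} {G : SimpleGraph (Fin n)} {v : Fin n} {lab : Fin n → Fin n}
    {U : Finset (Fin n)} {h : ℕ} {done done' : Fin n → Fin n → Prop} {mate : Fin n → Fin n}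
    {m m' : Mem} (hs : CrossingState G v lab U h done mate m)
    (hd : ∀ x y, G.Crossing v lab x y → done' x y → done x y) (h11 : m'.arr 11 = m.arr 11)
    (h14 : m'.reg 14 = m.reg 14) (h15 : m'.reg 15 = m.reg 15) (h16 : m'.reg 16 = m.reg 16) :
    CrossingState G v lab U h done' mate m' :=
  ⟨by rw [h11]; exact hs.mate_eq, fun x y hxy hxy' => hs.of_crossing x y hxy (hd x y hxy hxy'),
    hs.eq_or, by rw [h14]; exact fun h0 x y hxy hxy' => hs.light h0 x y hxy (hd x y hxy hxy'),
    by rw [h14, h15, h16]; exact hs.heavy⟩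

theorem runs_testCrossing {n : ℕ} {G : SimpleGraph (Fin n)} {m : Mem} {B : ℕ}
    (hB : n * n + n ≤ B) (hM : HasMatrix G m) {v : Fin n} (hv : m.reg 9 = v)
    {lab : Fin n → Fin n} (hl : HasLabels lab m) {U : Finset (Fin n)} (hc : HasCounts U lab m)
    {x y : Fin n} (h3 : m.reg 3 = x) (h4 : m.reg 4 = y) {done : Fin n → Fin n → Prop}
    {mate : Fin n → Fin n} (hs : CrossingState G v lab U (m.reg 20) done mate m) :
    Runs B testCrossing 48 m fun m' => ∃ mate', CrossingState G v lab U (m.reg 20)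
      (fun x' y' => done x' y' ∨ (x' = x ∧ y' = y)) mate' m' := by
  have hx := x.2
  have hy := y.2
  have hlx := (lab x).2
  have hly := (lab y).2
  have hskip : ¬ G.Crossing v lab x y → CrossingState G v lab U (m.reg 20)
      (fun x' y' => done x' y' ∨ (x' = x ∧ y' = y)) mate m := by
    intro hno
    refine hs.congr (fun x' y' hc' hd => hd.resolve_right ?_) rfl rfl rfl rfl
    rintro ⟨rfl, rfl⟩
    exact hno hc'
  refine .mono (.of_wp ?_) (show _ ≤ 48 by decide) fun _ h => h
  simp only [testCrossing, Prog.wp, Expr.eval, Expr.eqVal, Expr.ltVal, h3, h4, hv, hl x, hl y,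
    hM.row x hx,
    hM.adj x y, Mem.reg_setArr, Mem.arr_setArr, Nat.reduceEqDiff, if_false, hc (lab x), hc (lab y),
    ← Fin.ext_iff]
  refine ⟨fun hg => ⟨mate, hskip fun hcr => hg ?_⟩, fun hg => ⟨fun hadj => ?_, fun hadj =>
    ⟨mate, hskip fun hcr => (hM.adj x y).2 hcr.1 hadj⟩⟩⟩
  · rw [if_neg hcr.2.1, if_neg hcr.2.2.1, if_neg hcr.2.2.2]
  · have hcr : G.Crossing v lab x y := by
      refine ⟨hadj, fun h => ?_, fun h => ?_, fun h => ?_⟩ <;> simp [h] at hg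
    have hmate : ∀ c : Fin n, (if (c : ℕ) = lab x then (lab y : ℕ) else m.arr 11 c) =
        (Function.update mate (lab x) (lab y) c : Fin n) := by
      intro c
      rw [Function.update_apply]
      by_cases hcx : c = lab x
      · rw [if_pos (by rw [hcx]), if_pos hcx]
      · rw [if_neg (fun h => hcx (Fin.ext h)), if_neg hcx, hs.mate_eq]
    have hof : ∀ x' y', G.Crossing v lab x' y' → done x' y' ∨ (x' = x ∧ y' = y) →
        ∃ x'' y'', G.Crossing v lab x'' y'' ∧ lab x'' = lab x' ∧
          Function.update mate (lab x) (lab y) (lab x') = lab y'' := by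
      intro x' y' hc' hd
      by_cases hcx : lab x' = lab x
      · exact ⟨x, y, hcr, hcx.symm, by rw [hcx, Function.update_self]⟩
      · rw [Function.update_of_ne hcx]
        refine hs.of_crossing x' y' hc' (hd.resolve_right ?_)
        rintro ⟨rfl, rfl⟩
        exact hcx rfl
    have heq : ∀ c, Function.update mate (lab x) (lab y) c = c ∨ ∃ x' y',
        G.Crossing v lab x' y' ∧ lab x' = c ∧
          Function.update mate (lab x) (lab y) c = lab y' := by
      intro c
      by_cases hcx : c = lab x
      · exact Or.inr ⟨x, y, hcr, hcx.symm, by rw [hcx, Function.update_self]⟩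
      · rw [Function.update_of_ne hcx]
        exact hs.eq_or c
    refine ⟨by omega, by omega, fun hlt => ?_, fun hlt => ?_⟩
    · simp only [Mem.reg_setReg, Mem.reg_setArr, Nat.reduceEqDiff, if_false, h3, h4]
      refine ⟨by omega, by omega, by omega, Function.update mate (lab x) (lab y), ?_, hof, heq,
        by simp, fun _ => ⟨x, y, by simp, by simp, hcr, ?_⟩⟩
      · intro c
        rw [← hmate c]
        simp
      · by_contra hcon
        simp [hcon] at hlt
    · refine ⟨Function.update mate (lab x) (lab y), ?_, hof, heq, ?_, ?_⟩
      · intro c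
        rw [← hmate c]
        simp
      · rintro h0 x' y' hc' (hd | ⟨rfl, rfl⟩)
        · exact hs.light h0 x' y' hc' hd
        · by_contra hcon
          rw [if_pos (by omega)] at hlt
          exact one_ne_zero hlt
      · exact hs.heavy

theorem runs_findCrossings {n : ℕ} {G : SimpleGraph (Fin n)} {m : Mem} {B : ℕ}
    (hB : n * n + n ≤ B) (hn : m.reg 0 = n) (hM : HasMatrix G m) {k : ℕ} (hk : m.reg 1 = k)
    (hkB : 2 * k - 1 ≤ B) {v : Fin n} (hv : m.reg 9 = v)
    {lab : Fin n → Fin n} (hl : HasLabels lab m) {U : Finset (Fin n)} (hc : HasCounts U lab m)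
    (h11 : ∀ c : Fin n, m.arr 11 c = c) :
    Runs B findCrossings (n * (n * 56 + 20) + 20) m fun m' => m'.reg 20 = 2 * k - 1 ∧
      ∃ mate, CrossingState G v lab U (2 * k - 1) (fun _ _ => True) mate m' := by
  refine .mono (.seq (T := 10) (T' := n * (n * 56 + 14) + 6) (.mono (.of_wp (Q := fun m' =>
    m' = (m.setReg 20 (2 * k - 1)).setReg 14 0) ?_) (by decide) fun _ h => h) fun m₁ h₁ _ => ?_)
    (by have : n * (n * 56 + 20) = n * (n * 56 + 14) + n * 6 := by ring
        omega) fun _ h => h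
  · simp [Prog.wp, Expr.eval, hk, ← two_mul]; omega
  have r1 : m₁.reg 0 = n := by simp [h₁, hn]
  refine .mono (.forLoop (l := 0) (T := n * 56 + 6) (fun j m' => m'.reg 20 = 2 * k - 1 ∧
    ∃ mate, CrossingState G v lab U (2 * k - 1) (fun x _ => x.val < j) mate m') rfl (Nat.zero_le _)
      (by omega) ⟨by simp [h₁], fun c => c, ?_⟩ ?_) ?_ ?_
  · exact ⟨by simpa [h₁] using h11, fun _ _ _ hd => absurd hd (Nat.not_lt_zero _),
      fun c => Or.inl rfl, fun _ _ _ _ hd => absurd hd (Nat.not_lt_zero _), by simp [h₁]⟩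
  · intro j m₂ _ hj hj3 fr ⟨hI20, mate, hI⟩
    rw [r1] at hj
    have r0 : m₂.reg 0 = n := (fr.1 0 rfl).trans r1
    have f4 : m₂.arr 4 = m.arr 4 := (fr.2 4 rfl).trans (by rw [h₁]; rfl)
    have f5 : m₂.arr 5 = m.arr 5 := (fr.2 5 rfl).trans (by rw [h₁]; rfl)
    have f9 : m₂.arr 9 = m.arr 9 := (fr.2 9 rfl).trans (by rw [h₁]; rfl)
    have f10 : m₂.arr 10 = m.arr 10 := (fr.2 10 rfl).trans (by rw [h₁]; rfl)
    have s9 : m₂.reg 9 = v := (fr.1 9 rfl).trans (by simp [h₁, hv])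
    refine .mono (.forLoop (l := 0) (T := 48) (fun i m' => m'.reg 20 = 2 * k - 1 ∧
      ∃ mate, CrossingState G v lab U (2 * k - 1)
        (fun x y => x.val < j ∨ (x.val = j ∧ y.val < i)) mate m') rfl (Nat.zero_le _)
        (by omega) ⟨by simpa using hI20, mate, ?_⟩ ?_) ?_ ?_
    · exact hI.congr (fun x y _ hd => by omega) rfl rfl rfl rfl
    · intro i m₃ _ hi hi4 fr₃ ⟨hJ20, mate₃, hJ⟩
      rw [r0] at hi
      rw [← hJ20] at hJ
      have s3 : m₃.reg 3 = j := (fr₃.1 3 rfl).trans hj3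
      refine .mono (runs_testCrossing (x := ⟨j, hj⟩) (y := ⟨i, hi⟩) hB
        (hM.frame ((fr₃.2 4 rfl).trans f4) ((fr₃.2 5 rfl).trans f5)) ((fr₃.1 9 rfl).trans s9)
        (by rw [HasLabels, fr₃.2 9 rfl, f9]; exact hl)
        (by rw [HasCounts, fr₃.2 10 rfl, f10]; exact hc) s3 hi4 hJ).frame le_rfl ?_
      rintro m₄ ⟨⟨mate₄, h₄⟩, fr₄⟩
      rw [hJ20] at h₄
      refine ⟨by simpa using (fr₄.1 20 rfl).trans hJ20, mate₄, h₄.congr (fun x y _ hd => ?_)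
        rfl rfl rfl rfl⟩
      rw [Fin.ext_iff, Fin.ext_iff]
      simp only
      omega
    · rw [r0]; simp [Expr.cost]
    · rintro m₃ ⟨hJ20, mate₃, hJ⟩
      rw [r0] at hJ
      exact ⟨by simpa using hJ20, mate₃, hJ.congr
        (fun x y _ hd => by have := y.2; omega) rfl rfl rfl rfl⟩
  · rw [r1]; simp [Expr.cost]
  · rintro m' ⟨h20, mate, hI⟩
    rw [r1] at hI
    exact ⟨h20, mate, hI.congr (fun x _ _ _ => x.2) rfl rfl rfl rfl⟩

/-- Writes the keys into array 12 and the modulus of the arc test into register 17: positions on the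
cycle through the saved crossing edge if there is one, numbers of components otherwise. -/
def computeKeys : Prog :=
  .seq (ite (.reg 14)
      (assign 17 (.add (.add (.add (get 8 (.add (.reg 24) (.reg 15)))
        (get 8 (.add (.reg 24) (.reg 16)))) (const 1))
        (.add (.add (get 8 (.add (.reg 24) (.reg 15)))
          (get 8 (.add (.reg 24) (.reg 16)))) (const 1))))
      (assign 17 (const 0)))
    (forLoop 3 (const 0) 0
      (ite (.reg 14)
        (ite (.eq (get 9 (.reg 3)) (get 9 (.reg 15)))
          (store 12 (.reg 3) (.sub (.add (get 8 (.add (.reg 24) (.reg 3)))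
            (get 8 (.add (.reg 24) (.reg 15)))) (get 8 (.add (get 5 (.reg 3)) (.reg 15)))))
          (ite (.eq (get 9 (.reg 3)) (get 9 (.reg 16)))
            (store 12 (.reg 3) (.sub (.reg 17) (.sub (.add (get 8 (.add (.reg 24) (.reg 3)))
              (get 8 (.add (.reg 24) (.reg 16)))) (get 8 (.add (get 5 (.reg 3)) (.reg 16))))))
            (store 12 (.reg 3) (const 0))))
        (ite (.lt (get 9 (.reg 3)) (get 11 (get 9 (.reg 3))))
          (store 12 (.reg 3) (get 9 (.reg 3)))
          (store 12 (.reg 3) (get 11 (get 9 (.reg 3)))))))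

theorem runs_computeKeys {n : ℕ} {G : SimpleGraph (Fin n)} (hG : G.IsCactus) {m : Mem} {B : ℕ}
    (hB : 4 * n ≤ B) (hn : m.reg 0 = n) (hrow : ∀ x < n, m.arr 5 x = x * n)
    (hD : G.IsTreeMetricOn Set.univ (table (n := n) m)) (hlt : ∀ x y : Fin n, table m x y < n)
    {v : Fin n} (h24 : m.reg 24 = v * n)
    {lab : Fin n → Fin n} (hlab : HasLabels lab m) (hl : IsBranchLabel (table m) v lab)
    {U : Finset (Fin n)} {h : ℕ} (hh : 1 ≤ h) (hU : U.card = 2 * h)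
    (hmin : ∀ c, ∑ u ∈ U, table m v u ≤ ∑ u ∈ U, table m c u)
    {mate : Fin n → Fin n} (hs : CrossingState G v lab U h (fun _ _ => True) mate m) :
    Runs B computeKeys (n * 60 + 50) m fun m' => m'.reg 17 ≤ 4 * n ∧ ∃ key : Fin n → ℕ,
      (∀ u : Fin n, m'.arr 12 u = key u) ∧ (∀ u, key u ≤ 4 * n) ∧
      IsPairingKey G U h key (m'.reg 17) := by
  -- the keys and the modulus, in the form in which the program computes them
  obtain ⟨key, L, hL, hkey, hpair, hprog, hprogL⟩ : ∃ (key : Fin n → ℕ) (L : ℕ), L ≤ 4 * n ∧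
      (∀ u, key u ≤ 4 * n) ∧ IsPairingKey G U h key L ∧
      ((m.reg 14 = 0 ∧ ∀ u, key u = min (lab u : ℕ) (mate (lab u))) ∨
      (m.reg 14 ≠ 0 ∧ ∃ a b : Fin n, m.reg 15 = a ∧ m.reg 16 = b ∧
        (∀ u, key u = if lab u = lab a then table m v u + table m v a - table m u a
          else if lab u = lab b then L - (table m v u + table m v b - table m u b) else 0))) ∧
      ((m.reg 14 = 0 ∧ L = 0) ∨ (m.reg 14 ≠ 0 ∧ ∀ a b : Fin n, m.reg 15 = a → m.reg 16 = b →
        L = table m v a + table m v b + 1 + (table m v a + table m v b + 1))) := by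
    have hbranch := hD.card_branch_le hl hh hU hmin
    by_cases h14 : m.reg 14 = 0
    · refine ⟨fun u => min (lab u : ℕ) (mate (lab u)), 0, by omega, fun u => ?_,
        hD.isPairingKey_of_light hl ⟨fun x y hxy => hs.of_crossing x y hxy trivial, hs.eq_or⟩ hG
          hbranch (fun x y hxy => hs.light h14 x y hxy trivial) Fin.val_injective (fun _ => rfl) 0,
        Or.inl ⟨h14, fun _ => rfl⟩, Or.inl ⟨h14, rfl⟩⟩
      have := (lab u).2
      simp only
      omega
    · obtain ⟨a, b, ha, hb, hab, hheavy⟩ := hs.heavy h14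
      have l1 := hlt v a
      have l2 := hlt v b
      refine ⟨_, _, ?_, ?_, hD.isPairingKey_of_heavy hl hG hU hbranch hab hheavy rfl
        (fun _ => rfl), Or.inr ⟨h14, a, b, ha, hb, fun _ => rfl⟩, Or.inr ⟨h14, ?_⟩⟩
      · omega
      · intro u
        have l3 := hlt v u
        split_ifs <;> omega
      · intro a' b' ha' hb'
        rw [ha] at ha'
        rw [hb] at hb'
        obtain rfl := Fin.ext ha'
        obtain rfl := Fin.ext hb'
        ring
  refine .mono (.seq (T := 40) (T' := n * 60 + 6) (.mono (.of_wp (Q := fun m' =>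
    m' = m.setReg 17 L) ?_) (by decide) fun _ h => h) fun m₁ h₁ _ => ?_) (by omega) fun _ h => h
  · simp only [Prog.wp, Expr.eval, h24]
    rcases hprogL with ⟨h14, hL0⟩ | ⟨h14, hLe⟩
    · exact ⟨fun h => absurd h14 h, fun _ => ⟨Nat.zero_le _, by rw [hL0]⟩⟩
    · refine ⟨fun _ => ?_, fun h => absurd h h14⟩
      obtain ⟨a, b, ha, hb, -⟩ := hs.heavy h14
      have e := hLe a b ha hb
      simp only [table] at e
      rw [ha, hb, ← e]
      exact ⟨by omega, rfl⟩
  have r1 : m₁.reg 0 = n := by simp [h₁, hn]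
  refine .mono (.forLoop (l := 0) (T := 52) (fun j m' => m'.reg 17 = L ∧
    ∀ u : Fin n, u.val < j → m'.arr 12 u = key u) rfl (Nat.zero_le _)
      (by omega) ⟨by simp [h₁], fun u hu => absurd hu (Nat.not_lt_zero _)⟩ ?_) ?_ ?_
  · intro j m₂ _ hj hj3 fr hI
    rw [r1] at hj
    have f5 : m₂.arr 5 = m.arr 5 := (fr.2 5 rfl).trans (by rw [h₁]; rfl)
    have f8 : m₂.arr 8 = m.arr 8 := (fr.2 8 rfl).trans (by rw [h₁]; rfl)
    have f9 : m₂.arr 9 = m.arr 9 := (fr.2 9 rfl).trans (by rw [h₁]; rfl)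
    have f11 : m₂.arr 11 = m.arr 11 := (fr.2 11 rfl).trans (by rw [h₁]; rfl)
    have s14 : m₂.reg 14 = m.reg 14 := (fr.1 14 rfl).trans (by simp [h₁])
    have s15 : m₂.reg 15 = m.reg 15 := (fr.1 15 rfl).trans (by simp [h₁])
    have s16 : m₂.reg 16 = m.reg 16 := (fr.1 16 rfl).trans (by simp [h₁])
    have s24 : m₂.reg 24 = v * n := (fr.1 24 rfl).trans (by simp [h₁, h24])
    have e9 : m.arr 9 j = lab ⟨j, hj⟩ := hlab ⟨j, hj⟩
    have hkj := hkey ⟨j, hj⟩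
    -- storing the value `key j` in cell `j` extends the invariant
    have put : ∀ w, w = key ⟨j, hj⟩ → j ≤ B ∧ w ≤ B ∧
        ((m₂.setArr 12 j w).setReg 3 (j + 1)).reg 17 = L ∧
        ∀ u : Fin n, u.val < j + 1 →
          ((m₂.setArr 12 j w).setReg 3 (j + 1)).arr 12 u = key u := by
      rintro w rfl
      refine ⟨by omega, by omega, by simpa using hI.1, fun u hu => ?_⟩
      simp only [Mem.arr_setReg, Mem.arr_setArr, if_true]
      by_cases huj : u.val = j
      · rw [if_pos huj, show u = ⟨j, hj⟩ from Fin.ext huj]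
      · rw [if_neg huj, hI.2 u (by omega)]
    refine .mono (.of_wp ?_) (show _ ≤ 52 by decide) fun _ h => h
    simp only [Prog.wp, Expr.eval, Expr.eqVal, Expr.ltVal, hj3, f5, f8, f9, f11, s14, s15, s16,
      s24, hI.1, e9, hrow j hj, hs.mate_eq]
    rcases hprog with ⟨h14, hk⟩ | ⟨h14, a, b, ha, hb, hk⟩
    · refine ⟨fun h => absurd h14 h, fun _ => ⟨fun hc => put _ ?_, fun hc => put _ ?_⟩⟩
      · have : (lab ⟨j, hj⟩ : ℕ) < mate (lab ⟨j, hj⟩) := by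
          by_contra hcon
          simp [hcon] at hc
        rw [hk, min_eq_left this.le]
      · have : ¬ (lab ⟨j, hj⟩ : ℕ) < mate (lab ⟨j, hj⟩) := by
          intro hcon
          rw [if_pos hcon] at hc
          exact one_ne_zero hc
        rw [hk, min_eq_right (not_lt.1 this)]
    · simp only [ha, hb, hlab a, hlab b, ← Fin.ext_iff]
      have hk := hk ⟨j, hj⟩
      refine ⟨fun _ => ⟨fun hc => put _ ?_, fun hc => ⟨fun hc' => put _ ?_, fun hc' => put _ ?_⟩⟩,
        fun h => absurd h h14⟩
      · have : lab ⟨j, hj⟩ = lab a := by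
          by_contra hcon
          simp [hcon] at hc
        rw [hk, if_pos this]
        rfl
      · have h1 : lab ⟨j, hj⟩ ≠ lab a := fun hcon => by simp [hcon] at hc
        have h2 : lab ⟨j, hj⟩ = lab b := by
          by_contra hcon
          simp [hcon] at hc'
        rw [hk, if_neg h1, if_pos h2]
        rfl
      · have h1 : lab ⟨j, hj⟩ ≠ lab a := fun hcon => by simp [hcon] at hc
        have h2 : lab ⟨j, hj⟩ ≠ lab b := fun hcon => by simp [hcon] at hc'
        rw [hk, if_neg h1, if_neg h2]
  · rw [r1]; simp [Expr.cost]
  · intro m' hm'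
    rw [r1] at hm'
    exact ⟨by omega, key, fun u => hm'.2 u u.2, hkey, by rw [hm'.1]; exact hpair⟩

/-! ### Sorting by the keys -/

/-- Bucket sort: for each value of the key in turn, the points with that key are appended to
array 13. Register 18 bounds the keys, register 19 counts the points written. -/
def sortPoints : Prog :=
  .seq (.seq (assign 18 (.add (.add (.reg 0) (.reg 0)) (.add (.reg 0) (.add (.reg 0) (const 1)))))
      (assign 19 (const 0)))
    (forLoop 3 (const 0) 18 (forLoop 4 (const 0) 0
      (ite (get 2 (.reg 4))
        (ite (.eq (get 12 (.reg 4)) (.reg 3))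
          (.seq (store 13 (.reg 19) (.reg 4)) (assign 19 (.add (.reg 19) (const 1)))) .skip)
        .skip)))

/-- Array 13 lists the elements of `S`, in the order of the sequence `P`. -/
structure Lists {n : ℕ} (S : Finset (Fin n)) (key : Fin n → ℕ) (P : ℕ → Fin n) (m : Mem) :
    Prop where
  enum : IsSortedEnum S key S.card P
  arr_eq : ∀ i < S.card, m.arr 13 i = P i

theorem runs_sortPoints {n : ℕ} (hn0 : 0 < n) {m : Mem} {B : ℕ} (hB : 4 * n + 1 ≤ B)
    (hn : m.reg 0 = n) {U : Finset (Fin n)} (hU : HasPoints U m) {key : Fin n → ℕ}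
    (h12 : ∀ u : Fin n, m.arr 12 u = key u) (hkey : ∀ u, key u ≤ 4 * n) :
    Runs B sortPoints ((4 * n + 1) * (n * 32 + 16) + 20) m fun m' => ∃ P, Lists U key P m' := by
  refine .mono (.seq (T := 14) (T' := (4 * n + 1) * (n * 32 + 16) + 6) (.mono
    (.of_wp (Q := fun m' => m' = (m.setReg 18 (4 * n + 1)).setReg 19 0) ?_) (by decide)
    fun _ h => h)
    fun m₁ h₁ _ => ?_)
    (by omega) fun _ h => h
  · have e : n + n + (n + (n + 1)) = 4 * n + 1 := by ring
    simp [Prog.wp, Expr.eval, hn, e]; omega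
  have r0 : m₁.reg 0 = n := by simp [h₁, hn]
  have r18 : m₁.reg 18 = 4 * n + 1 := by simp [h₁]
  have r19 : m₁.reg 19 = 0 := by simp [h₁]
  -- the points met before the inner round `i` of the outer round `j`
  let S : ℕ → ℕ → Finset (Fin n) := fun j i => U.filter fun u => key u < j ∨ (key u = j ∧ u.val < i)
  have hSle : ∀ j i, (S j i).card ≤ n := fun j i => (Finset.card_le_univ _).trans (by simp)
  refine .mono (.forLoop (l := 0) (T := n * 32 + 6) (fun j m' => m'.reg 19 = (S j 0).card ∧
    ∃ P, Lists (S j 0) key P m') rfl (Nat.zero_le _) (by omega) ?_ ?_) ?_ ?_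
  · have : S 0 0 = ∅ := Finset.filter_false_of_mem (by simp)
    rw [this]
    exact ⟨by simp [h₁], fun _ => ⟨0, hn0⟩, ⟨fun i hi => absurd hi (Nat.not_lt_zero _),
      fun i hi => absurd hi (Nat.not_lt_zero _), fun i j _ hj => absurd hj (Nat.not_lt_zero _)⟩,
      fun i hi => absurd hi (Nat.not_lt_zero _)⟩
  · intro j m₂ _ hj hj3 fr ⟨hI19, P, hI⟩
    have s0 : m₂.reg 0 = n := (fr.1 0 rfl).trans r0
    refine .mono (.forLoop (l := 0) (T := 24) (fun i m' => m'.reg 19 = (S j i).card ∧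
      ∃ P, Lists (S j i) key P m') rfl (Nat.zero_le _) (by omega)
      ⟨by simpa using hI19, P, hI.1, hI.2⟩ ?_) ?_ ?_
    · intro i m₃ _ hi hi4 fr₃ ⟨hJ19, P₃, hJ⟩
      rw [s0] at hi
      have t3 : m₃.reg 3 = j := (fr₃.1 3 rfl).trans hj3
      have t2 : m₃.arr 2 i ≠ 0 ↔ (⟨i, hi⟩ : Fin n) ∈ U := by
        rw [fr₃.2 2 rfl, fr.2 2 rfl, h₁]; exact hU ⟨i, hi⟩
      have t12 : m₃.arr 12 i = key ⟨i, hi⟩ := by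
        rw [fr₃.2 12 rfl, fr.2 12 rfl, h₁]; exact h12 ⟨i, hi⟩
      have hle := hSle j i
      have same : ¬ ((⟨i, hi⟩ : Fin n) ∈ U ∧ key ⟨i, hi⟩ = j) → S j (i + 1) = S j i := by
        intro hno
        refine Finset.filter_congr fun u hu => ?_
        have : key u = j → u.val ≠ i := fun hk hui =>
          hno ⟨by rwa [show (⟨i, hi⟩ : Fin n) = u from Fin.ext hui.symm],
            by rwa [show (⟨i, hi⟩ : Fin n) = u from Fin.ext hui.symm]⟩
        omega
      have keep : ¬ ((⟨i, hi⟩ : Fin n) ∈ U ∧ key ⟨i, hi⟩ = j) →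
          (m₃.setReg 4 (i + 1)).reg 19 = (S j (i + 1)).card ∧
            ∃ P, Lists (S j (i + 1)) key P (m₃.setReg 4 (i + 1)) := by
        intro hno
        rw [same hno]
        exact ⟨by simpa using hJ19, P₃, hJ.1, hJ.2⟩
      refine .mono (.of_wp ?_) (show _ ≤ 24 by decide) fun _ h => h
      simp only [Prog.wp, Expr.eval, Expr.eqVal, hi4, t3, t12, hJ19, Mem.reg_setArr]
      refine ⟨fun hg => ⟨fun hg' => ?_, fun hg' => keep fun h => ?_⟩,
        fun hg => keep fun h => t2.2 h.1 hg⟩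
      · have hmem := t2.1 hg
        have hkj : key ⟨i, hi⟩ = j := by
          by_contra hcon
          simp [hcon] at hg'
        have hnot : (⟨i, hi⟩ : Fin n) ∉ S j i := by simp [S, hkj]
        have hins : S j (i + 1) = insert ⟨i, hi⟩ (S j i) := by
          ext u
          simp only [S, Finset.mem_filter, Finset.mem_insert]
          constructor
          · rintro ⟨hu, h⟩
            by_cases hui : u = ⟨i, hi⟩
            · exact Or.inl hui
            · have : u.val ≠ i := fun h => hui (Fin.ext h)
              exact Or.inr ⟨hu, by omega⟩
          · rintro (rfl | ⟨hu, h⟩)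
            · exact ⟨hmem, Or.inr ⟨hkj, Nat.lt_succ_self _⟩⟩
            · exact ⟨hu, by omega⟩
        have hcard : (S j (i + 1)).card = (S j i).card + 1 := by
          rw [hins, Finset.card_insert_of_notMem hnot]
        refine ⟨by omega, by omega, by omega, ?_, Function.update P₃ (S j i).card ⟨i, hi⟩, ?_, ?_⟩
        · simp [hcard]
        · rw [hcard, hins]
          refine hJ.enum.insert hnot fun w hw => ?_
          have := (Finset.mem_filter.1 hw).2
          omega
        · intro l hl
          rw [hcard] at hl
          by_cases hlc : l = (S j i).card
          · simp [hlc]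
          · simp [hlc, hJ.arr_eq l (by omega)]
      · simp [h.2] at hg'
    · rw [s0]; simp [Expr.cost]
    · rintro m₃ ⟨hJ19, P₃, hJ⟩
      rw [s0] at hJ19 hJ
      have : S (j + 1) 0 = S j n := by
        refine Finset.filter_congr fun u _ => ?_
        have := u.2
        omega
      rw [this]
      exact ⟨by simpa using hJ19, P₃, hJ.1, hJ.2⟩
  · rw [r18]; simp [Expr.cost]
  · rintro m' ⟨-, P, hI⟩
    rw [r18] at hI
    have : S (4 * n + 1) 0 = U := Finset.filter_true_of_mem fun u _ => by have := hkey u; omega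
    rw [this] at hI
    exact ⟨P, hI⟩

/-! ### Selecting a position and writing the partition -/

/-- Tests whether the position in register `x` lies on the shorter arc between the keys of the
points number `i` and `i + h`, where `i` is in register 4 and `h` in register 20. Comparisons have
the values `0` and `1`, so conjunctions and disjunctions are expressed by bounds for sums. -/
def arcTest (x : ℕ) : Expr :=
  let s : Expr := get 12 (get 13 (.reg 4))
  let t : Expr := get 12 (get 13 (.add (.reg 4) (.reg 20)))
  .add
    (.eq (const 3) (.add (.lt (.sub (.add t t) (.add s s)) (.add (.reg 17) (const 1)))
      (.add (.lt s (.add (.reg x) (const 1))) (.lt (.reg x) (.add t (const 1))))))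
    (.lt (const 1) (.add (.lt (.reg 17) (.add (.sub (.add t t) (.add s s)) (const 1)))
      (.lt (const 0) (.add (.lt (.reg x) (.add s (const 1))) (.lt t (.add (.reg x) (const 1)))))))

theorem eval_arcTest_ne_zero {m : Mem} (x : ℕ) :
    (arcTest x).eval m ≠ 0 ↔ OnShortArc (m.reg 17) (m.arr 12 (m.arr 13 (m.reg 4)))
      (m.arr 12 (m.arr 13 (m.reg 4 + m.reg 20))) (m.reg x) := by
  simp only [arcTest, Expr.eval, OnShortArc]
  generalize m.arr 12 (m.arr 13 (m.reg 4)) = s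
  generalize m.arr 12 (m.arr 13 (m.reg 4 + m.reg 20)) = t
  generalize m.reg x = τ
  generalize m.reg 17 = L
  simp only [Expr.eqVal, Expr.ltVal]
  split_ifs <;> omega

/-- Looks for a point whose position lies on at least `k` of the arcs between opposite points, and
writes its position into register 22. -/
def selectPosition : Prog :=
  .seq (assign 21 (.add (.reg 20) (.reg 20)))
    (forLoop 3 (const 0) 21
      (.seq (.seq (assign 26 (get 12 (get 13 (.reg 3)))) (assign 23 (const 0)))
        (.seq (forLoop 4 (const 0) 20
            (ite (arcTest 26) (assign 23 (.add (.reg 23) (const 1))) .skip))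
          (ite (.lt (.reg 1) (.add (.reg 23) (const 1))) (assign 22 (.reg 26)) .skip))))

open Classical in
/-- The number of pairs of opposite points among the first `i` whose shorter arc contains the
position `τ`. -/
noncomputable def arcCount (L h : ℕ) (t : ℕ → ℕ) (τ i : ℕ) : ℕ :=
  Nat.count (fun i => OnShortArc L (t i) (t (i + h)) τ) i

open Classical in
theorem arcCount_succ (L h : ℕ) (t : ℕ → ℕ) (τ i : ℕ) : arcCount L h t τ (i + 1) =
    arcCount L h t τ i + if OnShortArc L (t i) (t (i + h)) τ then 1 else 0 :=
  Nat.count_succ _ _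

theorem arcCount_le (L h : ℕ) (t : ℕ → ℕ) (τ i : ℕ) : arcCount L h t τ i ≤ i := by
  classical
  rw [arcCount, Nat.count_eq_card_filter_range]
  exact (Finset.card_filter_le _ _).trans (by simp)

theorem runs_selectPosition {n : ℕ} {m : Mem} {B k : ℕ} (hk1 : 1 ≤ k) (hB : 4 * n ≤ B)
    (hkn : 4 * k - 2 ≤ n) (hk : m.reg 1 = k) (h20 : m.reg 20 = 2 * k - 1)
    {U : Finset (Fin n)} (hU : U.card = 4 * k - 2) {key : Fin n → ℕ}
    (h12 : ∀ u : Fin n, m.arr 12 u = key u) (hkey : ∀ u, key u ≤ 4 * n) {P : ℕ → Fin n}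
    (hP : Lists U key P m) :
    Runs B selectPosition (n * (n * 120 + 40) + 10) m fun m' => ∃ j < 4 * k - 2,
      m'.reg 22 = key (P j) ∧
      k ≤ arcCount (m.reg 17) (2 * k - 1) (fun i => key (P i)) (key (P j)) (2 * k - 1) := by
  set L := m.reg 17 with hL
  have hlist : ∀ i < 4 * k - 2, m.arr 13 i = P i := fun i hi => hP.arr_eq i (by omega)
  have hmono := hP.enum.mono
  rw [hU] at hmono
  refine .mono (.seq (T := 4) (T' := (4 * k - 2) * (n * 120 + 40) + 6) (.mono
    (.of_wp (Q := fun m' => m' = m.setReg 21 (4 * k - 2)) ?_) (by decide) fun _ h => h)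
    fun m₁ h₁ _ => ?_)
    (by have := Nat.mul_le_mul_right (n * 120 + 40) hkn; omega) fun _ h => h
  · have e : 2 * k - 1 + (2 * k - 1) = 4 * k - 2 := by omega
    simp [Prog.wp, Expr.eval, h20, e]; omega
  have r21 : m₁.reg 21 = 4 * k - 2 := by simp [h₁]
  refine .mono (.forLoop (l := 0) (T := n * 120 + 30) (fun j m' =>
    (∃ j' < j, k ≤ arcCount L (2 * k - 1) (fun i => key (P i)) (key (P j')) (2 * k - 1)) →
      ∃ j' < 4 * k - 2, m'.reg 22 = key (P j') ∧
        k ≤ arcCount L (2 * k - 1) (fun i => key (P i)) (key (P j')) (2 * k - 1))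
    rfl (Nat.zero_le _) (by omega) (fun ⟨j', hj', _⟩ => absurd hj' (Nat.not_lt_zero _)) ?_) ?_ ?_
  · intro j m₂ _ hj hj3 fr hI
    rw [r21] at hj
    have s1 : m₂.reg 1 = k := (fr.1 1 rfl).trans (by simp [h₁, hk])
    have s17 : m₂.reg 17 = L := (fr.1 17 rfl).trans (by simp [h₁, hL])
    have s20 : m₂.reg 20 = 2 * k - 1 := (fr.1 20 rfl).trans (by simp [h₁, h20])
    have s12 : m₂.arr 12 = m.arr 12 := (fr.2 12 rfl).trans (by rw [h₁]; rfl)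
    have s13 : m₂.arr 13 = m.arr 13 := (fr.2 13 rfl).trans (by rw [h₁]; rfl)
    have hkj := hkey (P j)
    refine .mono (.seq (T := 8) (T' := n * 120 + 22) (.mono (.of_wp (Q := fun m' =>
      m' = (m₂.setReg 26 (key (P j))).setReg 23 0) ?_) (by decide) fun _ h => h)
      fun m₃ h₃ _ => ?_) (by omega) fun _ h => h
    · simp [Prog.wp, Expr.eval, hj3, s12, s13, hlist j hj, h12]; omega
    have t20 : m₃.reg 20 = 2 * k - 1 := by simp [h₃, s20]
    refine .mono (.seq (T := (2 * k - 1) * 120 + 6) (T' := 8) (.mono (.forLoop (l := 0) (T := 112)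
      (fun i m' => m'.reg 23 = arcCount L (2 * k - 1) (fun i => key (P i)) (key (P j)) i) rfl
      (Nat.zero_le _) (by omega) (by simp [h₃, arcCount]) ?_) ?_ fun _ h => h)
      fun m₄ h₄ fr₄ => ?_) (by omega) fun _ h => h
    · intro i m₄ _ hi hi4 fr₄ hJ
      rw [t20] at hi
      have w12 : m₄.arr 12 = m.arr 12 := (fr₄.2 12 rfl).trans (by rw [h₃]; exact s12)
      have w13 : m₄.arr 13 = m.arr 13 := (fr₄.2 13 rfl).trans (by rw [h₃]; exact s13)
      have w17 : m₄.reg 17 = L := (fr₄.1 17 rfl).trans (by simp [h₃, s17])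
      have w20 : m₄.reg 20 = 2 * k - 1 := (fr₄.1 20 rfl).trans t20
      have w26 : m₄.reg 26 = key (P j) := (fr₄.1 26 rfl).trans (by simp [h₃])
      have test := eval_arcTest_ne_zero (m := m₄) 26
      rw [w12, w13, w17, w20, w26, hi4, hlist i (by omega), hlist _ (by omega), h12, h12] at test
      have hle := arcCount_le L (2 * k - 1) (fun i => key (P i)) (key (P j)) i
      refine .mono (.of_wp ?_) (show _ ≤ 112 by decide) fun _ h => h
      simp only [Prog.wp]
      refine ⟨fun h => ⟨?_, ?_⟩, fun h => ?_⟩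
      · simp only [Expr.eval, hJ]; omega
      · rw [arcCount_succ, if_pos (test.1 h)]
        simp [Expr.eval, hJ]
      · rw [arcCount_succ, if_neg (fun hh => test.2 hh h)]
        simpa using hJ
    · rw [t20]; simp [Expr.cost]
    · rw [t20] at h₄
      have w1 : m₄.reg 1 = k := (fr₄.1 1 rfl).trans (by simp [h₃, s1])
      have w26 : m₄.reg 26 = key (P j) := (fr₄.1 26 rfl).trans (by simp [h₃])
      have w22 : m₄.reg 22 = m₂.reg 22 := (fr₄.1 22 rfl).trans (by simp [h₃])
      refine .mono (.of_wp ?_) (show _ ≤ 8 by decide) fun _ h => h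
      simp only [Prog.wp, Expr.eval, Expr.ltVal, w1, w26, h₄]
      refine ⟨fun h => ⟨by omega, fun _ => ⟨j, hj, by simp, ?_⟩⟩, fun h => ?_⟩
      · by_contra hcon
        rw [if_neg (by omega)] at h
        exact h rfl
      · rintro ⟨j', hj', hgood⟩
        rw [Mem.reg_setReg, if_neg (by decide), w22]
        refine hI ⟨j', lt_of_le_of_ne (by omega) ?_, hgood⟩
        rintro rfl
        rw [if_pos (by omega)] at h
        exact one_ne_zero h
  · rw [r21]
    simp only [Expr.cost, Nat.sub_zero]
    have := Nat.mul_le_mul_left (4 * k - 2) (show n * 120 + 30 + 8 ≤ n * 120 + 40 by omega)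
    omega
  · intro m' hm'
    rw [r21] at hm'
    classical
    obtain ⟨j, hj, hcard⟩ := exists_position_on_many_arcs hk1 (L := L)
      (t := fun i => key (P i)) hmono
    refine hm' ⟨j, hj, ?_⟩
    rw [arcCount, Nat.count_eq_card_filter_range]
    convert hcard

/-- Gives the numbers `0, …, k - 1` to the first `k` pairs of opposite points whose shorter arc
contains the position in register 22. All other points keep the number 0. -/
def writeParts : Prog :=
  .seq (assign 23 (const 0))
    (forLoop 4 (const 0) 20
      (ite (arcTest 22)
        (ite (.lt (.reg 23) (.reg 1))
          (.seq (store 3 (get 13 (.reg 4)) (.reg 23))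
            (.seq (store 3 (get 13 (.add (.reg 4) (.reg 20))) (.reg 23))
              (assign 23 (.add (.reg 23) (const 1))))) .skip)
        .skip))

theorem runs_writeParts {n : ℕ} {m : Mem} {B k : ℕ} (hk1 : 1 ≤ k) (hB : n ≤ B)
    (hkn : 4 * k - 2 ≤ n) (hk : m.reg 1 = k) (h20 : m.reg 20 = 2 * k - 1)
    {U : Finset (Fin n)} (hU : U.card = 4 * k - 2) {key : Fin n → ℕ}
    (h12 : ∀ u : Fin n, m.arr 12 u = key u) {P : ℕ → Fin n} (hP : Lists U key P m)
    (h3 : ∀ i, m.arr 3 i = 0)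
    (hcount : k ≤ arcCount (m.reg 17) (2 * k - 1) (fun i => key (P i)) (m.reg 22) (2 * k - 1)) :
    Runs B writeParts (n * 160 + 10) m fun m' => (∀ u : Fin n, m'.arr 3 u < k) ∧ ∀ c < k,
      ∃ i < 2 * k - 1, OnShortArc (m.reg 17) (key (P i)) (key (P (i + (2 * k - 1)))) (m.reg 22) ∧
        m'.arr 3 (P i) = c ∧ m'.arr 3 (P (i + (2 * k - 1))) = c := by
  set L := m.reg 17 with hL
  set τ := m.reg 22 with hτ
  have hlist : ∀ i < 4 * k - 2, m.arr 13 i = P i := fun i hi => hP.arr_eq i (by omega)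
  have hinj : ∀ i < 4 * k - 2, ∀ j < 4 * k - 2, (P i : ℕ) = P j → i = j :=
    fun i hi j hj h => hP.enum.inj i (by omega) j (by omega) (Fin.ext h)
  refine .mono (.seq (T := 2) (T' := (2 * k - 1) * 160 + 6) (.mono (.of_wp (Q := fun m' =>
    m' = m.setReg 23 0) ?_) (by decide) fun _ h => h) fun m₁ h₁ _ => ?_)
    (by omega) fun _ h => h
  · simp [Prog.wp, Expr.eval]
  have r20 : m₁.reg 20 = 2 * k - 1 := by simp [h₁, h20]
  refine .mono (.forLoop (l := 0) (T := 152) (fun i m' =>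
    m'.reg 23 = min k (arcCount L (2 * k - 1) (fun i => key (P i)) τ i) ∧
    (∀ u : Fin n, m'.arr 3 u < k) ∧ ∀ c < m'.reg 23, ∃ i' < i,
      OnShortArc L (key (P i')) (key (P (i' + (2 * k - 1)))) τ ∧
        m'.arr 3 (P i') = c ∧ m'.arr 3 (P (i' + (2 * k - 1))) = c)
    rfl (Nat.zero_le _) (by omega) ⟨by simp [h₁, arcCount], fun u => ?_, fun c hc => ?_⟩ ?_) ?_ ?_
  · simp only [h₁, Mem.arr_setReg, h3]; omega
  · simp [h₁] at hc
  · intro i m₂ _ hi hi4 fr ⟨hI23, hIlt, hI⟩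
    rw [r20] at hi
    have s1 : m₂.reg 1 = k := (fr.1 1 rfl).trans (by simp [h₁, hk])
    have s12 : m₂.arr 12 = m.arr 12 := (fr.2 12 rfl).trans (by rw [h₁]; rfl)
    have s13 : m₂.arr 13 = m.arr 13 := (fr.2 13 rfl).trans (by rw [h₁]; rfl)
    have s17 : m₂.reg 17 = L := (fr.1 17 rfl).trans (by simp [h₁, hL])
    have s20 : m₂.reg 20 = 2 * k - 1 := (fr.1 20 rfl).trans r20
    have s22 : m₂.reg 22 = τ := (fr.1 22 rfl).trans (by simp [h₁, hτ])
    have test := eval_arcTest_ne_zero (m := m₂) 22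
    rw [s12, s13, s17, s20, s22, hi4, hlist i (by omega), hlist _ (by omega), h12, h12] at test
    have keep : min k (arcCount L (2 * k - 1) (fun i => key (P i)) τ (i + 1)) =
        min k (arcCount L (2 * k - 1) (fun i => key (P i)) τ i) →
        (m₂.setReg 4 (i + 1)).reg 23 =
          min k (arcCount L (2 * k - 1) (fun i => key (P i)) τ (i + 1)) ∧
        (∀ u : Fin n, (m₂.setReg 4 (i + 1)).arr 3 u < k) ∧
        ∀ c < (m₂.setReg 4 (i + 1)).reg 23, ∃ i' < i + 1,
          OnShortArc L (key (P i')) (key (P (i' + (2 * k - 1)))) τ ∧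
            (m₂.setReg 4 (i + 1)).arr 3 (P i') = c ∧
            (m₂.setReg 4 (i + 1)).arr 3 (P (i' + (2 * k - 1))) = c := by
      intro heq
      refine ⟨by simpa [heq] using hI23, by simpa using hIlt, fun c hc => ?_⟩
      obtain ⟨i', hi', h⟩ := hI c (by simpa using hc)
      exact ⟨i', by omega, by simpa using h⟩
    have hPi := (P i).2
    have hPi' := (P (i + (2 * k - 1))).2
    refine .mono (.of_wp ?_) (show _ ≤ 152 by decide) fun _ h => h
    simp only [Prog.wp]
    refine ⟨fun h => ⟨fun hlt => ?_, fun hge => keep ?_⟩, fun h => keep ?_⟩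
    · have harc := test.1 h
      have hlt' : m₂.reg 23 < k := by
        by_contra hcon
        simp [Expr.eval, Expr.ltVal, s1, hcon] at hlt
      simp only [Expr.eval, hi4, s13, s20, Mem.reg_setArr, Mem.arr_setArr, Nat.reduceEqDiff,
        if_false, hlist i (by omega), hlist (i + (2 * k - 1)) (by omega)]
      refine ⟨by omega, by omega, by omega, by omega, by omega, ?_, fun u => ?_, fun c hc => ?_⟩
      · rw [arcCount_succ, if_pos harc]
        simp
        omega
      · simp only [Mem.arr_setReg, Mem.arr_setArr, if_true]
        have := hIlt u
        split_ifs <;> omega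
      · simp only [Mem.reg_setReg, Mem.reg_setArr, Nat.reduceEqDiff, if_false, if_true] at hc
        simp only [Mem.arr_setReg, Mem.arr_setArr, if_true]
        rcases Nat.lt_succ_iff_lt_or_eq.1 hc with hc | rfl
        · obtain ⟨i', hi', h1, h2, h3⟩ := hI c hc
          refine ⟨i', by omega, h1, ?_, ?_⟩
          · rw [if_neg fun h => ?_, if_neg fun h => ?_, h2]
            · have := hinj _ (by omega) _ (by omega) h; omega
            · have := hinj _ (by omega) _ (by omega) h; omega
          · rw [if_neg fun h => ?_, if_neg fun h => ?_, h3]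
            · have := hinj _ (by omega) _ (by omega) h; omega
            · have := hinj _ (by omega) _ (by omega) h; omega
        · exact ⟨i, by omega, harc, by simp, by simp⟩
    · have : ¬ m₂.reg 23 < k := by
        intro hcon
        simp [Expr.eval, Expr.ltVal, s1, hcon] at hge
      rw [arcCount_succ]
      split_ifs <;> omega
    · rw [arcCount_succ, if_neg (fun hh => test.2 hh h)]
      rfl
  · rw [r20]; simp [Expr.cost]
  · rintro m' ⟨h23, hlt, hall⟩
    rw [r20] at h23 hall
    rw [min_eq_left hcount] at h23
    rw [h23] at hall
    exact ⟨hlt, hall⟩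

/-! ### The whole program -/

/-- The program that finds a Tverberg partition of `4 * k - 2` points of a cactus.

Registers: 0 is `n`, 1 is `k`, 3 and 4 are loop counters, 9 is the root, 14 tells whether a heavy
crossing edge has been found and 15, 16 are its ends, 17 is the modulus of the arc test, 20 is
`2 * k - 1`, 22 is the selected position; the others are auxiliary. Arrays: 0, 1, 2 are the input
and 3 is the output; 4 is the adjacency matrix, 5 the row offsets, 8 the table of tree distances,
9 the branch labels, 10 the sizes of the branches, 11 their mates, 12 the keys, 13 the sorted list
of points; 6 and 7 are auxiliary. -/
def tverbergProgram : Prog :=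
  .seq buildMatrix (.seq buildTree (.seq chooseRoot (.seq labelBranches (.seq countBranches
    (.seq findCrossings (.seq computeKeys (.seq sortPoints
      (.seq selectPosition writeParts))))))))

theorem runs_tverbergProgram {n : ℕ} {G : SimpleGraph (Fin n)} (hG : G.IsCactus) {k : ℕ}
    {U : Finset (Fin n)} (hk : 1 ≤ k) (hU : U.card = 4 * k - 2) {m : Mem} (hm : IsInput G k U m) :
    Runs ((n + 1) ^ 3) tverbergProgram (2000 * n ^ 2) m fun m' =>
      G.IsTverbergPartition U (outputParts k U m') := by
  have hkn : 4 * k - 2 ≤ n := by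
    have := Finset.card_le_univ U
    rw [Fintype.card_fin] at this
    omega
  have hn1 : 1 ≤ n := by omega
  have hsq : n ≤ n * n := Nat.le_mul_self n
  -- words up to `(n + 1) ^ 3` suffice: nothing larger than `n * n + n` or `4 * n + 1` is stored
  set B := (n + 1) ^ 3
  have hB : n * n + n ≤ B := by
    have : (n + 1) ^ 3 = n * n * n + 3 * (n * n) + 3 * n + 1 := by ring
    omega
  have hB4 : 4 * n + 1 ≤ B := by
    have : (n + 1) ^ 3 = n * n * n + 3 * (n * n) + 3 * n + 1 := by ring
    omega
  refine Runs.mono (T := (2 + (n * (n * 14 + 30) + 6)) + ((n * (n * 54 + 60) + 20) +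
    ((n * (n * 20 + 30) + 6) + ((n * (n * 30 + 30) + 10) + ((n * 24 + 6) +
    ((n * (n * 56 + 20) + 20) + ((n * 60 + 50) + (((4 * n + 1) * (n * 32 + 16) + 20) +
    ((n * (n * 120 + 40) + 10) + (n * 160 + 10)))))))))) ?_ (by nlinarith) fun _ h => h
  -- array 2 is never written, and array 3 only by `writeParts`
  have points : ∀ m' : Mem, m'.arr 2 = m.arr 2 → HasPoints U m' := fun m' h u => by
    rw [h, hm.mem_iff]
    split_ifs with hu <;> simp [hu]
  refine .seq (runs_buildMatrix hm hB (by omega)) fun m₁ ⟨hM₁, _⟩ f₁ => ?_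
  have zero : ∀ a, 3 ≤ a → buildMatrix.writesArr a = false → ∀ i, m₁.arr a i = 0 :=
    fun a ha h i => by rw [f₁.2 a h, hm.arr_rest a ha]
  have n₁ : m₁.reg 0 = n := (f₁.1 0 rfl).trans hm.reg_zero
  have k₁ : m₁.reg 1 = k := (f₁.1 1 rfl).trans hm.reg_one
  have p₁ : m₁.arr 2 = m.arr 2 := f₁.2 2 rfl
  refine .seq (runs_buildTree hG.connected hB n₁ hM₁ (zero 6 (by decide) rfl)
    (zero 7 (by decide) rfl) (zero 8 (by decide) rfl)) fun m₂ ⟨hD₂, hlt₂⟩ f₂ => ?_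
  have n₂ : m₂.reg 0 = n := (f₂.1 0 rfl).trans n₁
  have k₂ : m₂.reg 1 = k := (f₂.1 1 rfl).trans k₁
  have p₂ : m₂.arr 2 = m.arr 2 := (f₂.2 2 rfl).trans p₁
  have hM₂ : HasMatrix G m₂ := hM₁.frame (f₂.2 4 rfl) (f₂.2 5 rfl)
  refine .seq (runs_chooseRoot hn1 hB n₂ hM₂.row (points m₂ p₂) hlt₂) fun m₃ ⟨v, hv, hmin⟩ f₃ => ?_
  have n₃ : m₃.reg 0 = n := (f₃.1 0 rfl).trans n₂
  have k₃ : m₃.reg 1 = k := (f₃.1 1 rfl).trans k₂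
  have p₃ : m₃.arr 2 = m.arr 2 := (f₃.2 2 rfl).trans p₂
  have hM₃ : HasMatrix G m₃ := hM₂.frame (f₃.2 4 rfl) (f₃.2 5 rfl)
  have e₃ : table (n := n) m₃ = table m₂ := by
    funext x y
    simp only [table, f₃.2 8 rfl]
  rw [← e₃] at hD₂ hlt₂ hmin
  refine .seq (runs_labelBranches hB n₃ hM₃.row hD₂ hv) fun m₄ ⟨h24, lab, hlab, hl⟩ f₄ => ?_
  have n₄ : m₄.reg 0 = n := (f₄.1 0 rfl).trans n₃
  have k₄ : m₄.reg 1 = k := (f₄.1 1 rfl).trans k₃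
  have p₄ : m₄.arr 2 = m.arr 2 := (f₄.2 2 rfl).trans p₃
  have hM₄ : HasMatrix G m₄ := hM₃.frame (f₄.2 4 rfl) (f₄.2 5 rfl)
  have v₄ : m₄.reg 9 = v := (f₄.1 9 rfl).trans hv
  refine .seq (runs_countBranches (by omega) n₄ (points m₄ p₄) hlab fun i => by
    rw [f₄.2 10 rfl, f₃.2 10 rfl, f₂.2 10 rfl]; exact zero 10 (by decide) rfl i)
    fun m₅ ⟨hc, h11⟩ f₅ => ?_
  have n₅ : m₅.reg 0 = n := (f₅.1 0 rfl).trans n₄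
  have k₅ : m₅.reg 1 = k := (f₅.1 1 rfl).trans k₄
  have p₅ : m₅.arr 2 = m.arr 2 := (f₅.2 2 rfl).trans p₄
  have hM₅ : HasMatrix G m₅ := hM₄.frame (f₅.2 4 rfl) (f₅.2 5 rfl)
  have v₅ : m₅.reg 9 = v := (f₅.1 9 rfl).trans v₄
  have lab₅ : HasLabels lab m₅ := fun u => by rw [f₅.2 9 rfl]; exact hlab u
  refine .seq (runs_findCrossings hB n₅ hM₅ k₅ (by omega) v₅ lab₅ hc h11)
    fun m₆ ⟨h20, mate, hs⟩ f₆ => ?_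
  have n₆ : m₆.reg 0 = n := (f₆.1 0 rfl).trans n₅
  have k₆ : m₆.reg 1 = k := (f₆.1 1 rfl).trans k₅
  have p₆ : m₆.arr 2 = m.arr 2 := (f₆.2 2 rfl).trans p₅
  have hM₆ : HasMatrix G m₆ := hM₅.frame (f₆.2 4 rfl) (f₆.2 5 rfl)
  have lab₆ : HasLabels lab m₆ := fun u => by rw [f₆.2 9 rfl]; exact lab₅ u
  have e₆ : table (n := n) m₆ = table m₃ := by
    funext x y
    simp only [table, f₆.2 8 rfl, f₅.2 8 rfl, f₄.2 8 rfl]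
  rw [← e₆] at hD₂ hlt₂ hmin hl
  refine .seq (runs_computeKeys hG (by omega) n₆ hM₆.row hD₂ hlt₂
    ((f₆.1 24 rfl).trans ((f₅.1 24 rfl).trans h24)) lab₆ hl (by omega) (by omega) hmin hs)
    fun m₇ ⟨_, key, h12, hkey, hpair⟩ f₇ => ?_
  have n₇ : m₇.reg 0 = n := (f₇.1 0 rfl).trans n₆
  have k₇ : m₇.reg 1 = k := (f₇.1 1 rfl).trans k₆
  have p₇ : m₇.arr 2 = m.arr 2 := (f₇.2 2 rfl).trans p₆
  refine .seq (runs_sortPoints hn1 hB4 n₇ (points m₇ p₇) h12 hkey) fun m₈ ⟨P, hP⟩ f₈ => ?_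
  have k₈ : m₈.reg 1 = k := (f₈.1 1 rfl).trans k₇
  have h12₈ : ∀ u : Fin n, m₈.arr 12 u = key u := fun u => by rw [f₈.2 12 rfl]; exact h12 u
  have h20₈ : m₈.reg 20 = 2 * k - 1 := (f₈.1 20 rfl).trans ((f₇.1 20 rfl).trans h20)
  refine .seq (runs_selectPosition hk (by omega) hkn k₈ h20₈ hU h12₈ hkey hP)
    fun m₉ ⟨j, hj, h22, hcount⟩ f₉ => ?_
  have hL : m₉.reg 17 = m₇.reg 17 := (f₉.1 17 rfl).trans (f₈.1 17 rfl)
  rw [← f₉.1 17 rfl, ← h22] at hcount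
  refine .mono (runs_writeParts hk (by omega) hkn ((f₉.1 1 rfl).trans k₈)
    ((f₉.1 20 rfl).trans h20₈) hU (fun u => by rw [f₉.2 12 rfl]; exact h12₈ u)
    ⟨hP.enum, fun i hi => by rw [f₉.2 13 rfl]; exact hP.arr_eq i hi⟩
    (fun i => by
      rw [f₉.2 3 rfl, f₈.2 3 rfl, f₇.2 3 rfl, f₆.2 3 rfl, f₅.2 3 rfl, f₄.2 3 rfl, f₃.2 3 rfl,
        f₂.2 3 rfl]
      exact zero 3 le_rfl rfl i) hcount) le_rfl fun m' ⟨hlt, hall⟩ => ?_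
  have hPU := hP.enum
  rw [hU] at hPU
  obtain ⟨x, hx⟩ := hpair.exists_common hPU hj
  refine isTverbergPartition_of_labels (fun u : Fin n => m'.arr 3 u) (fun u _ => hlt u) (x := x)
    fun c hc => ?_
  obtain ⟨i, hi, harc, h1, h2⟩ := hall c hc
  rw [hL, h22] at harc
  exact ⟨P i, hPU.mem i (by omega), P (i + (2 * k - 1)), hPU.mem _ (by omega), h1, h2, hx i hi harc⟩

end RAM

/-- First part: existence of the partition. Second part: one program finds such a partition for
every input in at most `C * n ^ 2` steps, on machine words of `O(log n)` bits. -/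
theorem mainTheorem6 :
    (∀ (V : Type*) [Fintype V] (G : SimpleGraph V), G.IsCactus →
      ∀ (k : ℕ) (U : Finset V), 1 ≤ k → U.card = 4 * k - 2 →
        ∃ A : Fin k → Finset V, G.IsTverbergPartition U A) ∧
    (∃ (P : RAM.Prog) (c C : ℕ),
      ∀ (n : ℕ) (G : SimpleGraph (Fin n)), G.IsCactus →
      ∀ (k : ℕ) (U : Finset (Fin n)), 1 ≤ k → U.card = 4 * k - 2 →
      ∀ m : RAM.Mem, RAM.IsInput G k U m →
        ∃ (t : ℕ) (m' : RAM.Mem), RAM.Exec ((n + 1) ^ c) P m t m' ∧ t ≤ C * n ^ 2 ∧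
          G.IsTverbergPartition U (RAM.outputParts k U m')) :=
  ⟨fun _ _ _ hG _ _ hk hU => hG.exists_isTverbergPartition hk hU,
    RAM.tverbergProgram, 3, 2000, fun _ _ hG _ _ hk hU _ hm =>
      RAM.runs_tverbergProgram hG hk hU hm⟩
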